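/- Let $d\in\mathbb N$, $T>0$, let $\mathfrak f\in C_c^\infty(\mathbb R^d\times\mathbb R;\mathbb R^d)$ (in particular $\mathfrak f$ is bounded) and $u_0\in C_c^\infty(\mathbb R^d)$. Consider the Cauchy problem $$u_t+\operatorname{div}\big(\mathfrak f(x,u)\big)=\Delta u+\partial_t\Delta u\quad\text{in }[0,T)\times\mathbb R^d,\qquad u|_{t=0}=u_0,\tag{P}$$ where $\operatorname{div}$ and $\Delta$ act in the variable $x$ (and $\operatorname{div}$ is the total divergence of $x\mapsto\mathfrak f(x,u(t,x))$). A weak solution of (P) is a function $u\in L^2((0,T)\times\mathbb R^d)$ such that, for every $\varphi\in C_c^\infty([0,T)\times\mathbb R^d)$, $$\int_0^T\!\!\int_{\mathbb R^d}\Big(u\,\varphi_t+\mathfrak f(x,u)\cdot\nabla\varphi+u\,\Delta\varphi-u\,\partial_t\Delta\varphi\Big)\,dx\,dt+\int_{\mathbb R^d}u_0(x)\big(\varphi(0,x)-\Delta\varphi(0,x)\big)\,dx=0 .$$ Then (P) has a weak solution $u\in L^2((0,T)\times\mathbb R^d)$, and it is unique: every weak solution in $L^2((0,T)\times\mathbb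 R^d)$ coincides with $u$ almost everywhere in $(0,T)\times\mathbb R^d$. Moreover, $u$ has a representative in $C^\infty([0,T]\times\mathbb R^d)$ (smooth up to $t=0$ and $t=T$), and this representative satisfies the equation at every point of $[0,T)\times\mathbb R^d$, with one-sided time derivatives at $t=0$, and $u(0,x)=u_0(x)$ for all $x\in\mathbb R^d$. -/

import Mathlib

open MeasureTheory Set
open scoped ContDiff

noncomputable section

/-- The Euclidean space `ℝ^d`. -/
abbrev Space (d : ℕ) : Type := EuclideanSpace ℝ (Fin d)

/-- The divergence `∑ i, ∂_{x_i} F_i` of a vector field on `ℝ^d`. -/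
def divergence {d : ℕ} (F : Space d → Space d) (x : Space d) : ℝ :=
  ∑ i : Fin d, (fderiv ℝ F x (EuclideanSpace.single i (1 : ℝ))) i

/-- The Laplacian in the space variable of a function of `(t, x)`. -/
def spaceLaplacian {d : ℕ} (w : ℝ × Space d → ℝ) (p : ℝ × Space d) : ℝ :=
  Laplacian.laplacian (fun y : Space d => w (p.1, y)) p.2

/-- The gradient in the space variable of a function of `(t, x)`. -/
def spaceGradient {d : ℕ} (w : ℝ × Space d → ℝ) (p : ℝ × Space d) : Space d :=
  gradient (fun y : Space d => w (p.1, y)) p.2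

/-- The time derivative, taken within the time set `I` (one-sided at end points of `I`). -/
def timeDerivWithin {d : ℕ} (I : Set ℝ) (w : ℝ × Space d → ℝ) (p : ℝ × Space d) : ℝ :=
  derivWithin (fun s : ℝ => w (s, p.2)) I p.1

/-- The time derivative. -/
def timeDeriv {d : ℕ} (w : ℝ × Space d → ℝ) (p : ℝ × Space d) : ℝ :=
  deriv (fun s : ℝ => w (s, p.2)) p.1

/-- Lebesgue measure on `(0, T) × ℝ^d`. -/
def slabMeasure (d : ℕ) (T : ℝ) : Measure (ℝ × Space d) :=
  (volume : Measure (ℝ × Space d)).restrict (Ioo 0 T ×ˢ univ)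

/-- Test functions: smooth, with compact support in `[0, T) × ℝ^d` as far as times `t ≥ 0` are
concerned. They need not vanish at `t = 0`; only their values for `t ≥ 0` are ever used. -/
structure IsTestFunction {d : ℕ} (T : ℝ) (φ : ℝ × Space d → ℝ) : Prop where
  smooth : ContDiff ℝ ∞ φ
  compactSupport : HasCompactSupport φ
  support_subset : tsupport φ ⊆ Iio T ×ˢ univ

/-- Weak solutions in `L²((0, T) × ℝ^d)` of the Cauchy problem
`u_t + div (f (x, u)) = Δ u + ∂_t Δ u`, `u|_{t = 0} = u₀`. -/
structure IsWeakSolution {d : ℕ} (T : ℝ) (f : Space d × ℝ → Space d) (u₀ : Space d → ℝ)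
    (u : ℝ × Space d → ℝ) : Prop where
  memLp : MemLp u 2 (slabMeasure d T)
  weak_eq : ∀ φ : ℝ × Space d → ℝ, IsTestFunction T φ →
    (∫ p, (u p * timeDeriv φ p + inner ℝ (f (p.2, u p)) (spaceGradient φ p)
        + u p * spaceLaplacian φ p - u p * timeDeriv (spaceLaplacian φ) p) ∂(slabMeasure d T))
      + ∫ x : Space d, u₀ x * (φ (0, x) - spaceLaplacian φ (0, x)) = 0

/-- Smooth classical solutions of the same Cauchy problem: smooth on `[0, T] × ℝ^d` up to the
boundary, satisfying the equation at every point of `[0, T) × ℝ^d` (with the one-sided time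
derivative at `t = 0`) and attaining the initial value. -/
structure IsSmoothClassicalSolution {d : ℕ} (T : ℝ) (f : Space d × ℝ → Space d)
    (u₀ : Space d → ℝ) (u : ℝ × Space d → ℝ) : Prop where
  smooth : ContDiffOn ℝ ∞ u (Icc 0 T ×ˢ univ)
  equation : ∀ t ∈ Ico 0 T, ∀ x : Space d,
    timeDerivWithin (Ico 0 T) u (t, x) + divergence (fun y => f (y, u (t, y))) x
      = spaceLaplacian u (t, x) + timeDerivWithin (Ico 0 T) (spaceLaplacian u) (t, x)
  initial : ∀ x : Space d, u (0, x) = u₀ x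

end

/-! ### Gaussian averages and the Bessel kernel. -/

section

open Filter Topology

/-! Moving `∂_t Δ u` to the left and inverting `1 - Δ` turns the equation into an ordinary
differential equation in time, `u_t = -u + (1 - Δ)⁻¹ u - ∑ ∂ᵢ (1 - Δ)⁻¹ fᵢ(x, u)`. Its right hand
side loses no derivative and is globally Lipschitz in `u`, because `f` is smooth with compact
support.

The inverse is made explicit as `(1 - Δ)⁻¹ = ∫₀^∞ e^{-s} e^{sΔ} ds`. With `s = r² / 2` this is a
superposition of Gaussian averages of `w(x + r z)`, and Gaussian integration by parts gives an
integrable kernel for `∂ᵢ (1 - Δ)⁻¹` too (`kernelAvg_besselKernel_sub`,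
`kernelAvg_besselGradKernel`). All regularity of these operators that is needed reduces to moments
of Gaussians.

Existence: the integrated equation is solved by contraction on bounded continuous functions, with an
exponential weight in time (`CausalBound.existsUnique`); a polynomial weight in space shows that the
solution decays and hence lies in `L²` (`CausalBound.decay`). Smoothness: the rescaled translate
`(s, x) ↦ u(t s, x + y)` is itself the fixed point of a map in which `t` and `y` are parameters.
These enter smoothly, through the scalar factor `t` and through the arguments of `f` and `u₀`, so
the implicit function theorem makes the fixed point smooth in `(t, y)` (`contDiff_mildSol`);
evaluation at `(1, 0)` gives back `u(t, y)` (`mildSol_apply`).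

Weak and mild formulations are linked by testing against `(1 - Δ) χ`, which cancels the inverse
(`integral_mildOp_mul`). Hence the mild solution is weak (`weak_eq_of_mild`), and being smooth it is
classical (`residual_eq_zero_of_weak`). Conversely the difference of two weak solutions solves a
homogeneous mild equation almost everywhere (`ae_eq_timeInt_of_weak`), which rests on the
injectivity of `1 - Δ` on `L²` in the distributional sense (`ae_eq_zero_of_integral_mul_oneSubLap`);
a Gronwall argument for the spatial `L²` energy then makes the difference vanish
(`ae_eq_zero_of_weak`). -/

theorem one_add_pow_le_exp_sq {a : ℝ} (ha : 0 ≤ a) {N : ℕ} (hN : 1 ≤ N) :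
    (1 + a) ^ (2 * N) ≤ (4 * N : ℝ) ^ N * Real.exp (a ^ 2 / 2) := by
  have hN' : (1 : ℝ) ≤ N := by exact_mod_cast hN
  have h0 : (0 : ℝ) < N := by linarith
  -- The inequality `1 + y ≤ exp y` at `y = a² / (2N)`, so that the `N`-th power produces exactly
  -- `exp (a² / 2)`.
  have h1 : (1 + a) ^ 2 ≤ 4 * N * Real.exp (a ^ 2 / (2 * N)) := by
    have h2 := Real.add_one_le_exp (a ^ 2 / (2 * N))
    have h3 : 4 * N * (a ^ 2 / (2 * N) + 1) = 2 * a ^ 2 + 4 * N := by field_simp; ring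
    have h4 := mul_le_mul_of_nonneg_left h2 (by positivity : (0 : ℝ) ≤ 4 * N)
    nlinarith [sq_nonneg (a - 1)]
  calc (1 + a) ^ (2 * N) = ((1 + a) ^ 2) ^ N := by rw [pow_mul]
    _ ≤ (4 * N * Real.exp (a ^ 2 / (2 * N))) ^ N := by gcongr
    _ = (4 * N : ℝ) ^ N * Real.exp (a ^ 2 / 2) := by
      rw [mul_pow, ← Real.exp_nat_mul]; congr 2; field_simp

theorem integrable_one_add_norm_pow_mul_exp {E : Type*} [NormedAddCommGroup E] [NormedSpace ℝ E]
    [FiniteDimensional ℝ E] [MeasurableSpace E] [BorelSpace E] (μ : Measure E)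
    [μ.IsAddHaarMeasure] (n : ℕ) :
    Integrable (fun z : E => (1 + ‖z‖) ^ n * Real.exp (-‖z‖ ^ 2 / 2)) μ := by
  -- The summand `n` absorbs the polynomial; `finrank + 1` leaves an integrable power of `1 + ‖z‖`.
  set N := n + Module.finrank ℝ E + 1 with hN
  have hint : Integrable (fun z : E => (1 + ‖z‖) ^ (-((Module.finrank ℝ E + 1 : ℕ) : ℝ))) μ :=
    integrable_one_add_norm (by push_cast; linarith)
  refine (hint.const_mul ((4 * N : ℝ) ^ N)).mono' (by fun_prop) (ae_of_all _ fun z => ?_)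
  have hz : 0 ≤ ‖z‖ := norm_nonneg z
  have h1 := one_add_pow_le_exp_sq hz (N := N) (by omega)
  rw [Real.norm_of_nonneg (by positivity), Real.rpow_neg (by positivity), Real.rpow_natCast,
    neg_div, Real.exp_neg, ← div_eq_mul_inv, ← div_eq_mul_inv, div_le_div_iff₀ (by positivity)
    (by positivity)]
  refine le_trans ?_ h1
  rw [← pow_add]
  exact pow_le_pow_right₀ (by linarith) (by omega)

/-- The unnormalized Gaussian density. -/
noncomputable def gaussianWeight {E : Type*} [Norm E] (z : E) : ℝ := Real.exp (-‖z‖ ^ 2 / 2)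

theorem gaussianWeight_pos {E : Type*} [Norm E] (z : E) : 0 < gaussianWeight z := Real.exp_pos _

theorem continuous_gaussianWeight {E : Type*} [SeminormedAddCommGroup E] :
    Continuous (gaussianWeight : E → ℝ) := by
  unfold gaussianWeight; fun_prop

theorem integrable_gaussianWeight_mul {E : Type*} [NormedAddCommGroup E] [NormedSpace ℝ E]
    [FiniteDimensional ℝ E] [MeasurableSpace E] [BorelSpace E] (μ : Measure E)
    [μ.IsAddHaarMeasure] {g : E → ℝ} (hg : AEStronglyMeasurable g μ) {C : ℝ} {n : ℕ}
    (hC : ∀ z, |g z| ≤ C * (1 + ‖z‖) ^ n) :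
    Integrable (fun z => gaussianWeight z * g z) μ := by
  refine ((integrable_one_add_norm_pow_mul_exp μ n).const_mul C).mono'
    (continuous_gaussianWeight.aestronglyMeasurable.mul hg) (ae_of_all _ fun z => ?_)
  rw [norm_mul, Real.norm_of_nonneg (gaussianWeight_pos z).le, Real.norm_eq_abs]
  have := mul_le_mul_of_nonneg_left (hC z) (gaussianWeight_pos z).le
  unfold gaussianWeight at *
  linarith

/-- The total mass of the unnormalized Gaussian density. -/
noncomputable def gaussianMass (d : ℕ) : ℝ := ∫ z : Space d, gaussianWeight z

theorem integrable_gaussianWeight {d : ℕ} : Integrable (gaussianWeight : Space d → ℝ) := by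
  simpa using integrable_gaussianWeight_mul (volume : Measure (Space d)) (g := fun _ => 1) (C := 1)
    (n := 0) (by fun_prop) (by simp)

theorem gaussianMass_pos (d : ℕ) : 0 < gaussianMass d := by
  unfold gaussianMass
  rw [integral_pos_iff_support_of_nonneg (fun z => (gaussianWeight_pos z).le)
    integrable_gaussianWeight]
  have : Function.support (gaussianWeight : Space d → ℝ) = univ := by
    ext z; simp [(gaussianWeight_pos z).ne']
  rw [this]
  exact Measure.measure_univ_pos.2 (NeZero.ne _)

/-- The `i`-th partial derivative. -/
noncomputable def partialDeriv {d : ℕ} (i : Fin d) (φ : Space d → ℝ) (x : Space d) : ℝ :=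
  fderiv ℝ φ x (EuclideanSpace.single i 1)

theorem fderiv_apply_eq_sum_partialDeriv {d : ℕ} (φ : Space d → ℝ) (x z : Space d) :
    fderiv ℝ φ x z = ∑ i, z i * partialDeriv i φ x := by
  have h : z = ∑ i, z i • (EuclideanSpace.single i (1 : ℝ) : Space d) := by
    ext j
    simp [Finset.sum_apply, Pi.single_apply]
  conv_lhs => rw [h]
  simp [partialDeriv]

theorem hasFDerivAt_gaussianWeight {d : ℕ} (z : Space d) :
    HasFDerivAt (gaussianWeight : Space d → ℝ) (-(gaussianWeight z) • innerSL ℝ z) z := by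
  have h := ((hasStrictFDerivAt_norm_sq z).hasFDerivAt.const_mul (-1 / 2 : ℝ)).exp
  have e : (fun z : Space d => Real.exp (-1 / 2 * ‖z‖ ^ 2)) = gaussianWeight := by
    ext z; unfold gaussianWeight; congr 1; ring
  rw [e] at h
  refine h.congr_fderiv ?_
  ext w
  have e' := congrFun e z
  beta_reduce at e'
  rw [e']
  simp
  ring

/-- Stein's identity: `zᵢ` times the Gaussian is minus its `i`-th derivative, so integration by
parts moves the derivative to `ψ(x + r z)`, where the chain rule produces `r`. -/
theorem integral_gaussianWeight_mul_coord {d : ℕ} (i : Fin d) {ψ : Space d → ℝ} (hψ : ContDiff ℝ 1 ψ)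
    {C : ℝ} (hC : ∀ x, |ψ x| ≤ C) (hC' : ∀ x, |partialDeriv i ψ x| ≤ C) (r : ℝ) (x : Space d) :
    ∫ z, gaussianWeight z * (z i * ψ (x + r • z))
      = r * ∫ z, gaussianWeight z * partialDeriv i ψ (x + r • z) := by
  have hd : ∀ z : Space d, HasFDerivAt (fun z : Space d => ψ (x + r • z))
      (r • fderiv ℝ ψ (x + r • z)) z := by
    intro z
    have h1 : HasFDerivAt (fun z : Space d => x + r • z) (r • ContinuousLinearMap.id ℝ (Space d)) z :=
      ((hasFDerivAt_id z).const_smul r).const_add x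
    have h2 := ((hψ.differentiable one_ne_zero) (x + r • z)).hasFDerivAt.comp z h1
    refine h2.congr_fderiv ?_
    ext w; simp
  have hcψ := hψ.continuous
  have hcd : Continuous (partialDeriv i ψ) := by
    have := hψ.continuous_fderiv one_ne_zero
    unfold partialDeriv; fun_prop
  have hzi : ∀ z : Space d, |z i| ≤ 1 + ‖z‖ := fun z => by
    have := PiLp.norm_apply_le z i
    rw [Real.norm_eq_abs] at this; linarith
  have hC0 : 0 ≤ C := (abs_nonneg _).trans (hC 0)
  have I1 : Integrable (fun z : Space d => gaussianWeight z * (z i * ψ (x + r • z))) :=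
    integrable_gaussianWeight_mul volume (C := C) (n := 1) (by fun_prop) fun z => by
      rw [abs_mul, pow_one, mul_comm]
      exact mul_le_mul (hC _) (hzi z) (abs_nonneg _) hC0
  have I2 : Integrable (fun z : Space d => gaussianWeight z * partialDeriv i ψ (x + r • z)) :=
    integrable_gaussianWeight_mul volume (C := C) (n := 0) (by fun_prop) fun z => by
      simpa using hC' _
  have I3 : Integrable (fun z : Space d => gaussianWeight z * ψ (x + r • z)) :=
    integrable_gaussianWeight_mul volume (C := C) (n := 0) (by fun_prop) fun z => by
      simpa using hC _
  have e1 : ∀ z : Space d, fderiv ℝ (gaussianWeight : Space d → ℝ) z (EuclideanSpace.single i 1)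
      = - (gaussianWeight z * z i) := by
    intro z
    rw [(hasFDerivAt_gaussianWeight z).fderiv]
    simp [EuclideanSpace.inner_single_right]
  have e2 : ∀ z : Space d, fderiv ℝ (fun z : Space d => ψ (x + r • z)) z
      (EuclideanSpace.single i 1) = r * partialDeriv i ψ (x + r • z) := by
    intro z
    rw [(hd z).fderiv]
    simp [partialDeriv]
  have key := integral_mul_fderiv_eq_neg_fderiv_mul_of_integrable (μ := (volume : Measure (Space d)))
    (f := fun z : Space d => ψ (x + r • z)) (g := gaussianWeight) (v := EuclideanSpace.single i 1)
    (by simp only [e2]; exact (I2.const_mul r).congr (ae_of_all _ fun z => by simp; ring))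
    (by simp only [e1]; exact I1.neg.congr (ae_of_all _ fun z => by simp; ring))
    (I3.congr (ae_of_all _ fun z => by simp; ring))
    (fun z _ => (hd z).differentiableAt) (fun z _ => (hasFDerivAt_gaussianWeight z).differentiableAt)
  simp only [e1, e2] at key
  rw [← integral_const_mul, ← neg_inj, ← integral_neg]
  rw [show (fun z : Space d => -(gaussianWeight z * (z i * ψ (x + r • z))))
    = fun z => ψ (x + r • z) * -(gaussianWeight z * z i) from by ext z; ring, key]
  congr 2; ext z; ring

/-- Lebesgue measure on `(0, ∞) × ℝ^d`. -/
noncomputable def halfMeasure (d : ℕ) : Measure (ℝ × Space d) :=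
  (volume.restrict (Ioi 0)).prod volume

instance (d : ℕ) : SFinite (halfMeasure d) := by unfold halfMeasure; infer_instance

/-- The superposition `∫ k(r, z) w(x + r z) d(r, z)` of dilated averages of `w`. -/
noncomputable def kernelAvg {d : ℕ} (k : ℝ × Space d → ℝ) (w : Space d → ℝ) (x : Space d) : ℝ :=
  ∫ q, k q * w (x + q.1 • q.2) ∂(halfMeasure d)

/-- Kernels all of whose moments in `r z` are finite. -/
structure IsRapidKernel {d : ℕ} (k : ℝ × Space d → ℝ) : Prop where
  measurable : Measurable k
  integrable_pow : ∀ m : ℕ,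
    Integrable (fun q => (1 + ‖q.1 • q.2‖) ^ m * |k q|) (halfMeasure d)

theorem IsRapidKernel.integrable {d : ℕ} {k : ℝ × Space d → ℝ} (hk : IsRapidKernel k) :
    Integrable k (halfMeasure d) := by
  refine (hk.integrable_pow 0).mono' hk.measurable.aestronglyMeasurable (ae_of_all _ fun q => ?_)
  simp

/-- Since `1 + |r| ‖z‖ ≤ (1 + |r|)(1 + ‖z‖)`, the moments factor into one-variable Gaussian moments.
The linear factors in the bound leave room for the `r` of `besselKernel` and the `zᵢ` of
`besselGradKernel`. -/
theorem isRapidKernel_of_le {d : ℕ} {k : ℝ × Space d → ℝ} (hk : Measurable k) {C : ℝ}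
    (hC : ∀ q, |k q| ≤
      C * (((1 + ‖q.1‖) * gaussianWeight q.1) * ((1 + ‖q.2‖) * gaussianWeight q.2))) :
    IsRapidKernel k := by
  refine ⟨hk, fun m => ?_⟩
  have h1 := (integrable_one_add_norm_pow_mul_exp (volume : Measure ℝ) (m + 1)).restrict
    (s := Ioi 0)
  have h2 := integrable_one_add_norm_pow_mul_exp (volume : Measure (Space d)) (m + 1)
  refine ((h1.mul_prod h2).const_mul C).mono' (by fun_prop) (ae_of_all _ fun q => ?_)
  rw [norm_mul, Real.norm_eq_abs |k q|, abs_abs, Real.norm_of_nonneg (by positivity), norm_smul]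
  have e : (1 + ‖q.1‖ * ‖q.2‖) ^ m ≤ (1 + ‖q.1‖) ^ m * (1 + ‖q.2‖) ^ m := by
    rw [← mul_pow]
    gcongr
    nlinarith [norm_nonneg q.1, norm_nonneg q.2]
  refine (mul_le_mul e (hC q) (abs_nonneg _) (by positivity)).trans (le_of_eq ?_)
  unfold gaussianWeight
  ring

/-- The kernel of `(1 - Δ)⁻¹`. -/
noncomputable def besselKernel {d : ℕ} (q : ℝ × Space d) : ℝ :=
  (gaussianMass d)⁻¹ * (q.1 * gaussianWeight q.1 * gaussianWeight q.2)

/-- The kernel of `∂ᵢ (1 - Δ)⁻¹`. -/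
noncomputable def besselGradKernel {d : ℕ} (i : Fin d) (q : ℝ × Space d) : ℝ :=
  (gaussianMass d)⁻¹ * (gaussianWeight q.1 * (gaussianWeight q.2 * q.2 i))

theorem isRapidKernel_besselKernel {d : ℕ} : IsRapidKernel (besselKernel (d := d)) := by
  have hc := gaussianMass_pos d
  refine isRapidKernel_of_le (C := (gaussianMass d)⁻¹) ?_ fun q => ?_
  · have := (continuous_gaussianWeight (E := ℝ)).measurable
    have := (continuous_gaussianWeight (E := Space d)).measurable
    unfold besselKernel; fun_prop
  · unfold besselKernel
    have h1 := gaussianWeight_pos q.1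
    have h2 := gaussianWeight_pos q.2
    rw [abs_mul, abs_mul, abs_mul, abs_of_pos h1, abs_of_pos h2, abs_of_pos (inv_pos.2 hc)]
    have : |q.1| ≤ 1 + ‖q.1‖ := by rw [Real.norm_eq_abs]; linarith
    have : 1 ≤ 1 + ‖q.2‖ := by linarith [norm_nonneg q.2]
    gcongr
    nlinarith

theorem isRapidKernel_besselGradKernel {d : ℕ} (i : Fin d) :
    IsRapidKernel (besselGradKernel i) := by
  have hc := gaussianMass_pos d
  refine isRapidKernel_of_le (C := (gaussianMass d)⁻¹) ?_ fun q => ?_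
  · have := (continuous_gaussianWeight (E := ℝ)).measurable
    have := (continuous_gaussianWeight (E := Space d)).measurable
    unfold besselGradKernel; fun_prop
  · unfold besselGradKernel
    have h1 := gaussianWeight_pos q.1
    have h2 := gaussianWeight_pos q.2
    rw [abs_mul, abs_mul, abs_mul, abs_of_pos h1, abs_of_pos h2, abs_of_pos (inv_pos.2 hc)]
    have h3 : |q.2 i| ≤ 1 + ‖q.2‖ := by
      have := PiLp.norm_apply_le q.2 i
      rw [Real.norm_eq_abs] at this; linarith
    have h4 : 1 ≤ 1 + ‖q.1‖ := by linarith [norm_nonneg q.1]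
    rw [mul_comm (gaussianWeight q.2)]
    gcongr
    nlinarith

theorem IsRapidKernel.integrable_mul {d : ℕ} {k : ℝ × Space d → ℝ} (hk : IsRapidKernel k)
    {w : Space d → ℝ} (hw : Measurable w) {C : ℝ} (hC : ∀ x, |w x| ≤ C) (x : Space d) :
    Integrable (fun q => k q * w (x + q.1 • q.2)) (halfMeasure d) := by
  refine hk.integrable.mul_bdd (c := C) ?_ (ae_of_all _ fun q => hC _)
  exact (hw.comp (by fun_prop)).aestronglyMeasurable

/-- The Laplacian as a sum of iterated partial derivatives. -/
noncomputable def sumPartialSq {d : ℕ} (φ : Space d → ℝ) (x : Space d) : ℝ :=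
  ∑ i, partialDeriv i (partialDeriv i φ) x

theorem contDiff_partialDeriv {d : ℕ} {φ : Space d → ℝ} {n m : WithTop ℕ∞} (hφ : ContDiff ℝ n φ)
    (hmn : m + 1 ≤ n) (i : Fin d) : ContDiff ℝ m (partialDeriv i φ) := by
  unfold partialDeriv
  exact (hφ.fderiv_right hmn).clm_apply contDiff_const

/-- This is the heat equation in the variable `s = r² / 2`. Differentiation under the integral gives
the average of `z · ∇φ`, and Stein's identity for each `∂ᵢ φ` converts it into `r` times the average
of the Laplacian. -/
theorem hasDerivAt_gaussianAvg {d : ℕ} {φ : Space d → ℝ} (hφ : ContDiff ℝ 2 φ) {C : ℝ}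
    (h0 : ∀ x, |φ x| ≤ C) (h1 : ∀ i x, |partialDeriv i φ x| ≤ C)
    (h2 : ∀ i x, |partialDeriv i (partialDeriv i φ) x| ≤ C) (r : ℝ) (x : Space d) :
    HasDerivAt (fun r : ℝ => ∫ z, gaussianWeight z * φ (x + r • z))
      (r * ∫ z, gaussianWeight z * sumPartialSq φ (x + r • z)) r := by
  have hC0 : 0 ≤ C := (abs_nonneg _).trans (h0 0)
  have hcφ := hφ.continuous
  have hcg := continuous_gaussianWeight (E := Space d)
  have hc1 : ∀ i, Continuous (partialDeriv i φ) := fun i =>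
    (contDiff_partialDeriv hφ (m := 1) (by norm_num) i).continuous
  have hc2 : ∀ i, Continuous (partialDeriv i (partialDeriv i φ)) := fun i =>
    (contDiff_partialDeriv (contDiff_partialDeriv hφ (m := 1) (by norm_num) i) (m := 0)
      (by norm_num) i).continuous
  have hzi : ∀ (z : Space d) i, |z i| ≤ 1 + ‖z‖ := fun z i => by
    have := PiLp.norm_apply_le z i
    rw [Real.norm_eq_abs] at this; linarith
  have hI1 : ∀ i, Integrable (fun z : Space d =>
      gaussianWeight z * (z i * partialDeriv i φ (x + r • z))) := fun i =>
    integrable_gaussianWeight_mul volume (C := C) (n := 1)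
      (by have := hc1 i; fun_prop) fun z => by
      rw [abs_mul, pow_one, mul_comm]
      exact mul_le_mul (h1 _ _) (hzi z i) (abs_nonneg _) hC0
  have hI2 : ∀ i, Integrable (fun z : Space d =>
      gaussianWeight z * partialDeriv i (partialDeriv i φ) (x + r • z)) := fun i =>
    integrable_gaussianWeight_mul volume (C := C) (n := 0)
      (by have := hc2 i; fun_prop) fun z => by simpa using h2 _ _
  have key := (hasDerivAt_integral_of_dominated_loc_of_deriv_le (μ := (volume : Measure (Space d)))
    (F := fun (r : ℝ) z => gaussianWeight z * φ (x + r • z))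
    (F' := fun (r : ℝ) z => gaussianWeight z * ∑ i, z i * partialDeriv i φ (x + r • z))
    (bound := fun z => gaussianWeight z * (d * C * (1 + ‖z‖))) (s := univ) (x₀ := r)
    Filter.univ_mem (Eventually.of_forall fun r => by fun_prop)
    (integrable_gaussianWeight_mul volume (C := C) (n := 0) (by fun_prop) fun z => by
      simpa using h0 _) (by fun_prop) (ae_of_all _ fun z s _ => ?_)
    (integrable_gaussianWeight_mul volume (C := d * C) (n := 1) (by fun_prop) fun z => by
      rw [abs_of_nonneg (by positivity), pow_one]) (ae_of_all _ fun z s _ => ?_)).2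
  · refine key.congr_deriv ?_
    simp_rw [Finset.mul_sum]
    rw [integral_finsetSum _ fun i _ => hI1 i]
    unfold sumPartialSq
    simp_rw [Finset.mul_sum]
    rw [integral_finsetSum _ fun i _ => hI2 i, Finset.mul_sum]
    refine Finset.sum_congr rfl fun i _ => ?_
    exact integral_gaussianWeight_mul_coord i (contDiff_partialDeriv hφ (by norm_num) i)
      (h1 i) (h2 i) r x
  · rw [norm_mul, Real.norm_of_nonneg (gaussianWeight_pos z).le]
    refine mul_le_mul_of_nonneg_left ?_ (gaussianWeight_pos z).le
    refine (norm_sum_le _ _).trans ?_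
    calc _ ≤ ∑ i : Fin d, C * (1 + ‖z‖) := Finset.sum_le_sum fun i _ => by
          rw [norm_mul, mul_comm]
          exact mul_le_mul (h1 _ _) (hzi z i) (abs_nonneg _) hC0
      _ = _ := by simp; ring
  · refine HasDerivAt.const_mul _ ?_
    have e1 : HasDerivAt (fun s : ℝ => x + s • z) z s := by
      simpa using ((hasDerivAt_id s).smul_const z).const_add x
    have e2 := ((hφ.differentiable two_ne_zero) (x + s • z)).hasFDerivAt.comp_hasDerivAt s e1
    rw [fderiv_apply_eq_sum_partialDeriv] at e2
    exact e2

theorem abs_integral_gaussianWeight_mul_le {d : ℕ} {g : Space d → ℝ} {C : ℝ} 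
    (h0 : ∀ x, |g x| ≤ C) : |∫ z, gaussianWeight z * g z| ≤ C * gaussianMass d := by
  unfold gaussianMass
  rw [← integral_const_mul, ← Real.norm_eq_abs]
  refine norm_integral_le_of_norm_le (integrable_gaussianWeight.const_mul C)
    (ae_of_all _ fun z => ?_)
  rw [norm_mul, Real.norm_of_nonneg (gaussianWeight_pos z).le, mul_comm]
  exact mul_le_mul_of_nonneg_right (h0 z) (gaussianWeight_pos z).le

theorem hasDerivAt_gaussianWeight_real (r : ℝ) :
    HasDerivAt (gaussianWeight : ℝ → ℝ) (-(r * gaussianWeight r)) r := by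
  have h := (((hasDerivAt_id r).pow 2).const_mul (-1 / 2 : ℝ)).exp
  have e : (gaussianWeight : ℝ → ℝ) = fun z : ℝ => Real.exp (-1 / 2 * (id ^ 2) z) := by
    ext z; unfold gaussianWeight; congr 1; simp; ring
  rw [e]
  refine h.congr_deriv ?_
  simp
  ring

theorem tendsto_gaussianWeight_real : Tendsto (gaussianWeight : ℝ → ℝ) atTop (𝓝 0) := by
  unfold gaussianWeight
  refine Real.tendsto_exp_atBot.comp ?_
  have : Tendsto (fun r : ℝ => r ^ 2 / 2) atTop atTop :=
    (tendsto_pow_atTop two_ne_zero).atTop_div_const (by norm_num)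
  refine (tendsto_neg_atTop_atBot.comp this).congr fun r => ?_
  simp [neg_div]

/-- With `g` the Gaussian and `h(r)` the Gaussian average of `φ(x + r z)`, the heat equation shows
that the integrand in `r` is the exact derivative of `-g(r) h(r)` divided by the mass. This vanishes
at infinity, and its value at `r = 0` is `-φ(x)`. Only boundedness of `φ` and its derivatives is
assumed, since the identity is later needed for convolutions without compact support. -/
theorem kernelAvg_besselKernel_sub {d : ℕ} {φ : Space d → ℝ} (hφ : ContDiff ℝ 2 φ) {C : ℝ}
    (h0 : ∀ x, |φ x| ≤ C) (h1 : ∀ i x, |partialDeriv i φ x| ≤ C)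
    (h2 : ∀ i x, |partialDeriv i (partialDeriv i φ) x| ≤ C) (x : Space d) :
    kernelAvg besselKernel (fun y => φ y - sumPartialSq φ y) x = φ x := by
  have hC0 : 0 ≤ C := (abs_nonneg _).trans (h0 0)
  have hcφ := hφ.continuous
  have hcg := continuous_gaussianWeight (E := Space d)
  have hc2 : ∀ i, Continuous (partialDeriv i (partialDeriv i φ)) := fun i =>
    (contDiff_partialDeriv (contDiff_partialDeriv hφ (m := 1) (by norm_num) i) (m := 0)
      (by norm_num) i).continuous
  have hcs : Continuous (sumPartialSq φ) := by unfold sumPartialSq; fun_prop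
  have hbs : ∀ y, |sumPartialSq φ y| ≤ d * C := fun y => by
    unfold sumPartialSq
    refine (Finset.abs_sum_le_sum_abs _ _).trans ?_
    calc _ ≤ ∑ i : Fin d, C := Finset.sum_le_sum fun i _ => h2 i y
      _ = _ := by simp
  have hint := isRapidKernel_besselKernel.integrable_mul (w := fun y => φ y - sumPartialSq φ y)
    (by fun_prop) (C := C + d * C) (fun y => (abs_sub _ _).trans (add_le_add (h0 y) (hbs y))) x
  have hI0 : ∀ r : ℝ, Integrable (fun z : Space d => gaussianWeight z * φ (x + r • z)) := fun r =>
    integrable_gaussianWeight_mul volume (C := C) (n := 0) (by fun_prop) fun z => by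
      simpa using h0 _
  have hI1 : ∀ r : ℝ, Integrable (fun z : Space d =>
      gaussianWeight z * sumPartialSq φ (x + r • z)) := fun r =>
    integrable_gaussianWeight_mul volume (C := d * C) (n := 0) (by fun_prop) fun z => by
      simpa using hbs _
  set h : ℝ → ℝ := fun r => ∫ z, gaussianWeight z * φ (x + r • z) with hh
  set F : ℝ → ℝ := fun r => -(gaussianMass d)⁻¹ * (gaussianWeight r * h r) with hF
  unfold kernelAvg halfMeasure at *
  have hinner : ∀ r : ℝ, ∫ z, besselKernel (r, z) * (φ (x + r • z) - sumPartialSq φ (x + r • z))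
      = -(gaussianMass d)⁻¹ * (-(r * gaussianWeight r) * h r + gaussianWeight r *
        (r * ∫ z, gaussianWeight z * sumPartialSq φ (x + r • z))) := by
    intro r
    have : ∀ z, besselKernel (r, z) * (φ (x + r • z) - sumPartialSq φ (x + r • z))
        = (gaussianMass d)⁻¹ * (r * gaussianWeight r) * (gaussianWeight z * φ (x + r • z)
          - gaussianWeight z * sumPartialSq φ (x + r • z)) := fun z => by
      unfold besselKernel; ring
    simp_rw [this]
    rw [integral_const_mul, integral_sub (hI0 r) (hI1 r)]
    ring
  have hFd : ∀ r ∈ Ici (0 : ℝ), HasDerivAt F (∫ z, besselKernel (r, z) *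
      (φ (x + r • z) - sumPartialSq φ (x + r • z))) r := by
    intro r _
    rw [hinner]
    exact ((hasDerivAt_gaussianWeight_real r).mul
      (hasDerivAt_gaussianAvg hφ h0 h1 h2 r x)).const_mul _
  have hF0 : Tendsto F atTop (𝓝 0) := by
    have hb : ∀ r, |h r| ≤ C * gaussianMass d := fun r =>
      abs_integral_gaussianWeight_mul_le fun z => h0 _
    have : Tendsto (fun r => gaussianWeight r * h r) atTop (𝓝 0) := by
      refine squeeze_zero_norm (fun r => ?_)
        (by simpa using tendsto_gaussianWeight_real.mul_const (C * gaussianMass d))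
      rw [norm_mul, Real.norm_of_nonneg (gaussianWeight_pos r).le]
      exact mul_le_mul_of_nonneg_left (hb r) (gaussianWeight_pos r).le
    simpa [hF] using this.const_mul (-(gaussianMass d)⁻¹)
  rw [integral_prod _ hint]
  have e := integral_Ioi_of_hasDerivAt_of_tendsto' hFd hint.integral_prod_left hF0
  beta_reduce at e ⊢
  rw [e]
  have : h 0 = gaussianMass d * φ x := by
    simp [hh, gaussianMass, integral_mul_const]
  have hc := (gaussianMass_pos d).ne'
  simp only [hF, this]
  simp [gaussianWeight]
  field_simp

/-- For each fixed `r`, Stein's identity trades the factor `zᵢ` for `r ∂ᵢ`, which supplies precisely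
the `r` by which the two kernels differ. -/
theorem kernelAvg_besselGradKernel {d : ℕ} (i : Fin d) {ψ : Space d → ℝ} (hψ : ContDiff ℝ 1 ψ)
    {C : ℝ} (hC : ∀ x, |ψ x| ≤ C) (hC' : ∀ x, |partialDeriv i ψ x| ≤ C) (x : Space d) :
    kernelAvg (besselGradKernel i) ψ x = kernelAvg besselKernel (partialDeriv i ψ) x := by
  have h1 := (isRapidKernel_besselGradKernel i).integrable_mul hψ.continuous.measurable hC x
  have h2 := isRapidKernel_besselKernel.integrable_mul
    (contDiff_partialDeriv hψ (m := 0) (by norm_num) i).continuous.measurable hC' x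
  unfold kernelAvg halfMeasure at *
  rw [integral_prod _ h1, integral_prod _ h2]
  congr 1
  ext r
  have e := integral_gaussianWeight_mul_coord i hψ hC hC' r x
  have e1 : ∀ z, besselGradKernel i (r, z) * ψ (x + r • z) = (gaussianMass d)⁻¹ * gaussianWeight r *
    (gaussianWeight z * (z i * ψ (x + r • z))) := fun z => by unfold besselGradKernel; ring
  have e2 : ∀ z, besselKernel (r, z) * partialDeriv i ψ (x + r • z) =
    (gaussianMass d)⁻¹ * gaussianWeight r * r * (gaussianWeight z * partialDeriv i ψ (x + r • z)) :=
    fun z => by unfold besselKernel; ring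
  simp only [e1, e2, integral_const_mul]
  rw [e]; ring

end

/-! ### Superposition and averaging operators on bounded continuous functions. -/

section

open Filter Topology
open scoped BoundedContinuousFunction

section Superposition

variable {X : Type} [TopologicalSpace X] {E V : Type} [NormedAddCommGroup E] [NormedSpace ℝ E]
  [NormedAddCommGroup V] [NormedSpace ℝ V]

/-- Pointwise application of operator-valued bounded continuous functions. -/
noncomputable def pointwiseApply (X E V : Type) [TopologicalSpace X] [NormedAddCommGroup E]
    [NormedSpace ℝ E] [NormedAddCommGroup V] [NormedSpace ℝ V] :
    (X →ᵇ (E →L[ℝ] V)) →L[ℝ] (X →ᵇ E) →L[ℝ] (X →ᵇ V) :=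
  LinearMap.mkContinuous₂
    (LinearMap.mk₂ ℝ (fun (L : X →ᵇ (E →L[ℝ] V)) (h : X →ᵇ E) =>
      BoundedContinuousFunction.ofNormedAddCommGroup (fun x => L x (h x))
        (L.continuous.clm_apply h.continuous) (‖L‖ * ‖h‖) fun x =>
          (L x).le_of_opNorm_le_of_le (L.norm_coe_le_norm x) (h.norm_coe_le_norm x))
      (fun _ _ _ => by ext; simp) (fun _ _ _ => by ext; simp) (fun _ _ _ => by ext; simp)
      (fun _ _ _ => by ext; simp)) 1 fun L h => by
    rw [one_mul]
    exact (BoundedContinuousFunction.norm_le (by positivity)).2 fun x =>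
      (L x).le_of_opNorm_le_of_le (L.norm_coe_le_norm x) (h.norm_coe_le_norm x)

/-- The superposition operator `h ↦ f (g + h)`. -/
noncomputable def superposition (f : E → V) (hf : ContDiff ℝ ∞ f) (hfc : HasCompactSupport f)
    (g : C(X, E)) (h : X →ᵇ E) : X →ᵇ V :=
  BoundedContinuousFunction.ofNormedAddCommGroup (fun x => f (g x + h x))
    (hf.continuous.comp (g.continuous.add h.continuous))
    (hfc.exists_bound_of_continuous hf.continuous).choose
    fun _ => (hfc.exists_bound_of_continuous hf.continuous).choose_spec _

@[simp]
theorem superposition_apply (f : E → V) (hf : ContDiff ℝ ∞ f) (hfc : HasCompactSupport f)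
    (g : C(X, E)) (h : X →ᵇ E) (x : X) : superposition f hf hfc g h x = f (g x + h x) := rfl

theorem exists_forall_norm_sub_le {f : E → V} (hf : ContDiff ℝ ∞ f) (hfc : HasCompactSupport f) :
    ∃ C : ℝ, 0 ≤ C ∧ ∀ a b, ‖f a - f b‖ ≤ C * ‖a - b‖ := by
  obtain ⟨C, hC⟩ := hf.lipschitzWith_of_hasCompactSupport hfc (by simp)
  exact ⟨C, C.2, fun a b => by simpa [dist_eq_norm] using hC.dist_le_mul a b⟩

theorem continuous_superposition (f : E → V) (hf : ContDiff ℝ ∞ f) (hfc : HasCompactSupport f)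
    (g : C(X, E)) : Continuous (superposition f hf hfc g) := by
  obtain ⟨C, hC0, hC⟩ := exists_forall_norm_sub_le hf hfc
  refine (LipschitzWith.of_dist_le_mul (K := ⟨C, hC0⟩) fun h h' => ?_).continuous
  refine (BoundedContinuousFunction.dist_le (by positivity)).2 fun x => ?_
  rw [dist_eq_norm]
  refine (hC _ _).trans ?_
  rw [add_sub_add_left_eq_sub, ← dist_eq_norm]
  exact mul_le_mul_of_nonneg_left (h.dist_coe_le_dist x) hC0

/-- The derivative of `f` is globally Lipschitz by compact support, so the pointwise Taylor
remainder is at most `C ‖h' - h‖²` uniformly in the point. In the sup norm this is a genuine Fréchet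
remainder. -/
theorem hasFDerivAt_superposition (f : E → V) (hf : ContDiff ℝ ∞ f) (hfc : HasCompactSupport f)
    (g : C(X, E)) (h : X →ᵇ E) :
    HasFDerivAt (superposition f hf hfc g) (pointwiseApply X E V
      (superposition (fderiv ℝ f) (hf.fderiv_right (by simp)) (hfc.fderiv ℝ) g h)) h := by
  obtain ⟨C, hC0, hC⟩ := exists_forall_norm_sub_le (f := fderiv ℝ f) (hf.fderiv_right (by simp))
    (hfc.fderiv ℝ)
  refine HasFDerivAt.of_isLittleO ?_
  have hO : (fun h' : X →ᵇ E => superposition f hf hfc g h' - superposition f hf hfc g h -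
      pointwiseApply X E V (superposition (fderiv ℝ f) (hf.fderiv_right (by simp)) (hfc.fderiv ℝ)
      g h) (h' - h)) =O[𝓝 h] fun h' => ‖h' - h‖ ^ 2 := by
    refine Asymptotics.IsBigO.of_bound C (Eventually.of_forall fun h' => ?_)
    refine (BoundedContinuousFunction.norm_le (by positivity)).2 fun x => ?_
    have hx : ‖h' x - h x‖ ≤ ‖h' - h‖ := (h' - h).norm_coe_le_norm x
    -- Mean value inequality on a ball of radius `‖h' - h‖`, on which the derivative of `f` varies
    -- by at most `C ‖h' - h‖`.
    have key := (convex_closedBall (g x + h x) ‖h' - h‖).norm_image_sub_le_of_norm_fderiv_le'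
      (𝕜 := ℝ) (f := f) (φ := fderiv ℝ f (g x + h x)) (C := C * ‖h' - h‖) (x := g x + h x)
      (y := g x + h' x) (fun a _ => hf.differentiable (by simp) a) (fun a ha => ?_)
      (Metric.mem_closedBall_self (norm_nonneg _)) ?_
    · simp only [add_sub_add_left_eq_sub] at key
      refine (key.trans (mul_le_mul_of_nonneg_left hx (by positivity))).trans (le_of_eq ?_)
      simp; ring
    · refine (hC _ _).trans (mul_le_mul_of_nonneg_left ?_ hC0)
      simpa [dist_eq_norm] using ha
    · simpa [dist_eq_norm] using hx
  refine hO.trans_isLittleO ?_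
  have h1 : Tendsto (fun h' : X →ᵇ E => ‖h' - h‖) (𝓝 h) (𝓝 0) := by
    have : Continuous fun h' : X →ᵇ E => ‖h' - h‖ := by fun_prop
    simpa using this.tendsto h
  have h2 := ((Asymptotics.isLittleO_one_iff ℝ).2 h1).mul_isBigO
    (Asymptotics.isBigO_refl (fun h' : X →ᵇ E => ‖h' - h‖) (𝓝 h))
  simp only [one_mul, ← sq] at h2
  exact h2.trans_isBigO (Asymptotics.isBigO_norm_left.2 (Asymptotics.isBigO_refl _ _))

/-- The derivative is again a superposition operator, for `fderiv ℝ f`, followed by a fixed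
continuous linear map, so induction applies. The target changes from `V` to `E →L[ℝ] V` at each
step, hence the quantifier over `V` inside the induction. -/
theorem contDiff_superposition_nat (n : ℕ) : ∀ {V : Type} [NormedAddCommGroup V] [NormedSpace ℝ V]
    (f : E → V) (hf : ContDiff ℝ ∞ f) (hfc : HasCompactSupport f) (g : C(X, E)),
    ContDiff ℝ n (superposition f hf hfc g) := by
  induction n with
  | zero => exact fun f hf hfc g => contDiff_zero.2 (continuous_superposition f hf hfc g)
  | succ n ih =>
    intro V _ _ f hf hfc g
    refine contDiff_succ_iff_hasFDerivAt.2 ⟨_, ?_, hasFDerivAt_superposition f hf hfc g⟩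
    exact (pointwiseApply X E V).contDiff.comp (ih _ _ _ g)

theorem contDiff_superposition (f : E → V) (hf : ContDiff ℝ ∞ f) (hfc : HasCompactSupport f)
    (g : C(X, E)) : ContDiff ℝ ∞ (superposition f hf hfc g) :=
  contDiff_infty.2 fun n => contDiff_superposition_nat n f hf hfc g

end Superposition

section Averages

variable {X Ω : Type} [TopologicalSpace X] [MeasurableSpace X] [MeasurableSpace Ω]

/-- The averages `x ↦ ∫ k(x, q) w(θ(x, q)) dq` are well behaved for bounded continuous `w`. -/
structure IsAvgKernel (μ : Measure Ω) (k : X → Ω → ℝ) (θ : X → Ω → X) (κ : Ω → ℝ) : Prop where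
  continuous_kernel : ∀ q, Continuous fun x => k x q
  measurable_kernel : ∀ x, Measurable (k x)
  continuous_point : ∀ q, Continuous fun x => θ x q
  measurable_point : ∀ x, Measurable (θ x)
  integrable_bound : Integrable κ μ
  le_bound : ∀ x q, |k x q| ≤ κ q

variable {μ : Measure Ω} {k : X → Ω → ℝ} {θ : X → Ω → X} {κ : Ω → ℝ}

theorem IsAvgKernel.norm_le (h : IsAvgKernel μ k θ κ) (w : X →ᵇ ℝ) (x : X) :
    ‖∫ q, k x q * w (θ x q) ∂μ‖ ≤ (∫ q, κ q ∂μ) * ‖w‖ := by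
  rw [← integral_mul_const]
  refine norm_integral_le_of_norm_le (h.integrable_bound.mul_const _) (ae_of_all _ fun q => ?_)
  rw [norm_mul]
  exact mul_le_mul (h.le_bound x q) (w.norm_coe_le_norm _) (norm_nonneg _)
    ((abs_nonneg _).trans (h.le_bound x q))

variable [OpensMeasurableSpace X]

theorem IsAvgKernel.integrable (h : IsAvgKernel μ k θ κ) (w : X →ᵇ ℝ) (x : X) :
    Integrable (fun q => k x q * w (θ x q)) μ := by
  refine (h.integrable_bound.mul_const ‖w‖).mono' ?_ (ae_of_all _ fun q => ?_)
  · exact ((h.measurable_kernel x).mul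
      (w.continuous.measurable.comp (h.measurable_point x))).aestronglyMeasurable
  · rw [norm_mul]
    exact mul_le_mul (h.le_bound x q) (w.norm_coe_le_norm _) (norm_nonneg _)
      ((abs_nonneg _).trans (h.le_bound x q))

variable [FirstCountableTopology X]

theorem IsAvgKernel.continuous (h : IsAvgKernel μ k θ κ) (w : X →ᵇ ℝ) :
    Continuous fun x => ∫ q, k x q * w (θ x q) ∂μ := by
  refine continuous_of_dominated (bound := fun q => κ q * ‖w‖)
    (fun x => (h.integrable w x).aestronglyMeasurable) (fun x => ae_of_all _ fun q => ?_)
    (h.integrable_bound.mul_const _) (ae_of_all _ fun q => ?_)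
  · rw [norm_mul]
    exact mul_le_mul (h.le_bound x q) (w.norm_coe_le_norm _) (norm_nonneg _)
      ((abs_nonneg _).trans (h.le_bound x q))
  · exact (h.continuous_kernel q).mul (w.continuous.comp (h.continuous_point q))

/-- The averaging operator on bounded continuous functions. -/
noncomputable def avgOperator (h : IsAvgKernel μ k θ κ) : (X →ᵇ ℝ) →L[ℝ] (X →ᵇ ℝ) :=
  LinearMap.mkContinuous
    { toFun := fun w => BoundedContinuousFunction.ofNormedAddCommGroup
        (fun x => ∫ q, k x q * w (θ x q) ∂μ) (h.continuous w) _ (h.norm_le w)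
      map_add' := fun w w' => by
        ext x
        simp only [BoundedContinuousFunction.coe_ofNormedAddCommGroup,
          BoundedContinuousFunction.coe_add, Pi.add_apply, mul_add]
        exact integral_add (h.integrable w x) (h.integrable w' x)
      map_smul' := fun c w => by
        ext x
        simp only [BoundedContinuousFunction.coe_ofNormedAddCommGroup, RingHom.id_apply,
          BoundedContinuousFunction.coe_smul, smul_eq_mul]
        rw [← integral_const_mul]
        congr 1; ext q; ring } (∫ q, κ q ∂μ) fun w => by
    have h0 : 0 ≤ (∫ q, κ q ∂μ) * ‖w‖ := by
      rcases isEmpty_or_nonempty X with hX | ⟨⟨x⟩⟩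
      · rw [BoundedContinuousFunction.norm_eq_zero_of_empty, mul_zero]
      · exact (norm_nonneg _).trans (h.norm_le w x)
    exact (BoundedContinuousFunction.norm_le h0).2 fun x => h.norm_le w x

end Averages

/-- The cylinder `[0, 1] × ℝ^d`. -/
abbrev Cyl (d : ℕ) : Type := unitInterval × Space d

theorem isAvgKernel_time (d : ℕ) : IsAvgKernel (X := Cyl d) (volume : Measure unitInterval)
    (fun p _ => (p.1 : ℝ)) (fun p q => (p.1 * q, p.2)) (fun _ => 1) where
  continuous_kernel q := by fun_prop
  measurable_kernel p := by fun_prop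
  continuous_point q := by fun_prop
  measurable_point p := by
    have : Continuous fun q : unitInterval => ((p.1 * q, p.2) : Cyl d) := by fun_prop
    exact this.measurable
  integrable_bound := by simp
  le_bound p q := by rw [abs_of_nonneg p.1.2.1]; exact p.1.2.2

theorem IsRapidKernel.isAvgKernel {d : ℕ} {k : ℝ × Space d → ℝ} (hk : IsRapidKernel k) :
    IsAvgKernel (X := Cyl d) (halfMeasure d) (fun _ q => k q)
    (fun p q => (p.1, p.2 + q.1 • q.2)) (fun q => |k q|) where
  continuous_kernel q := by fun_prop
  measurable_kernel p := hk.measurable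
  continuous_point q := by fun_prop
  measurable_point p := by fun_prop
  integrable_bound := hk.integrable.abs
  le_bound p q := le_rfl

/-- `w ↦ ∫₀ˢ w dσ = s ∫₀¹ w(s σ) dσ`. -/
noncomputable def timeAvg (d : ℕ) : (Cyl d →ᵇ ℝ) →L[ℝ] (Cyl d →ᵇ ℝ) :=
  avgOperator (isAvgKernel_time d)

/-- `kernelAvg` in the space variable. -/
noncomputable def spaceAvg {d : ℕ} {k : ℝ × Space d → ℝ} (hk : IsRapidKernel k) :
    (Cyl d →ᵇ ℝ) →L[ℝ] (Cyl d →ᵇ ℝ) :=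
  avgOperator hk.isAvgKernel

theorem timeAvg_apply {d : ℕ} (w : Cyl d →ᵇ ℝ) (s : unitInterval) (x : Space d) :
    timeAvg d w (s, x) = s * ∫ σ : unitInterval, w (s * σ, x) := by
  rw [← integral_const_mul]; rfl

theorem spaceAvg_apply {d : ℕ} {k : ℝ × Space d → ℝ} (hk : IsRapidKernel k) (w : Cyl d →ᵇ ℝ)
    (s : unitInterval) (x : Space d) :
    spaceAvg hk w (s, x) = kernelAvg k (fun y => w (s, y)) x := rfl

end

/-! ### Contraction in weighted norms. -/

section

open Filter Topology
open scoped BoundedContinuousFunction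

/-- The polynomial weight `(1 + |x|)^{-m}`. -/
noncomputable def decayWeight {d : ℕ} (m : ℕ) (x : Space d) : ℝ := ((1 + ‖x‖) ^ m)⁻¹

theorem decayWeight_pos {d : ℕ} (m : ℕ) (x : Space d) : 0 < decayWeight m x := by
  unfold decayWeight; positivity

@[simp]
theorem decayWeight_zero {d : ℕ} (x : Space d) : decayWeight 0 x = 1 := by simp [decayWeight]

/-- A Peetre-type inequality: a translation by `z` costs a polynomial in `‖z‖`, which the moments of
a rapid kernel absorb. -/
theorem decayWeight_add_le {d : ℕ} (m : ℕ) (x z : Space d) :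
    decayWeight m (x + z) ≤ (1 + ‖z‖) ^ m * decayWeight m x := by
  unfold decayWeight
  rw [← div_eq_mul_inv, inv_eq_one_div, div_le_div_iff₀ (by positivity) (by positivity), one_mul,
    ← mul_pow]
  refine pow_le_pow_left₀ (by positivity) ?_ m
  have h : ‖x‖ ≤ ‖x + z‖ + ‖z‖ := by simpa using norm_sub_le (x + z) z
  nlinarith [norm_nonneg z, norm_nonneg (x + z)]

theorem integral_exp_mul_le {l : ℝ} (hl : 0 < l) {s : unitInterval} :
    s * ∫ σ : unitInterval, Real.exp (l * (s * σ : unitInterval)) ≤ l⁻¹ * Real.exp (l * s) := by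
  have e : ∫ σ : unitInterval, Real.exp (l * (s * σ : unitInterval))
      = ∫ σ in (0 : ℝ)..1, Real.exp (l * (s * σ)) := by
    rw [intervalIntegral.integral_of_le zero_le_one, ← integral_Icc_eq_integral_Ioc]
    exact integral_subtype_comap measurableSet_Icc fun σ : ℝ => Real.exp (l * (s * σ))
  rw [e]
  have h := intervalIntegral.mul_integral_comp_mul_left (f := fun x => Real.exp (l * x))
    (a := 0) (b := 1) (c := s)
  have h' := intervalIntegral.mul_integral_comp_mul_left (f := fun x => Real.exp x)
    (a := 0) (b := s) (c := l)
  rw [h]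
  simp only [mul_zero, mul_one, integral_exp, Real.exp_zero] at h' ⊢
  have : ∫ x in (0 : ℝ)..s, Real.exp (l * x) = l⁻¹ * (Real.exp (l * s) - 1) := by
    rw [← h']; field_simp
  rw [this]
  have := inv_pos.2 hl
  nlinarith

/-- Integrating `exp (l τ)` in time gains `l⁻¹`; for large `l` this gain beats any Lipschitz
constant, whatever the length of the time interval. -/
theorem abs_timeAvg_le {d : ℕ} {w : Cyl d →ᵇ ℝ} {l b : ℝ} (hl : 0 < l) (hb : 0 ≤ b) {x : Space d}
    (h : ∀ s : unitInterval, |w (s, x)| ≤ b * Real.exp (l * s)) (s : unitInterval) :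
    |timeAvg d w (s, x)| ≤ l⁻¹ * (b * Real.exp (l * s)) := by
  rw [timeAvg_apply, abs_mul, abs_of_nonneg s.2.1]
  have hc : Continuous fun σ : unitInterval => Real.exp (l * (s * σ : unitInterval)) := by fun_prop
  have h1 : |∫ σ : unitInterval, w (s * σ, x)| ≤ ∫ σ : unitInterval,
      b * Real.exp (l * (s * σ : unitInterval)) := by
    rw [← Real.norm_eq_abs]
    exact norm_integral_le_of_norm_le ((hc.integrable_of_hasCompactSupport
      (HasCompactSupport.of_compactSpace _)).const_mul b) (ae_of_all _ fun σ => h _)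
  rw [integral_const_mul] at h1
  have h2 := mul_le_mul_of_nonneg_left (integral_exp_mul_le hl (s := s)) hb
  have h3 := mul_le_mul_of_nonneg_left h1 s.2.1
  linarith

/-- The norm of `kernelAvg k` on functions with the given polynomial decay. -/
noncomputable def kernelMoment {d : ℕ} (k : ℝ × Space d → ℝ) (m : ℕ) : ℝ :=
  ∫ q, (1 + ‖q.1 • q.2‖) ^ m * |k q| ∂(halfMeasure d)

theorem kernelMoment_nonneg {d : ℕ} (k : ℝ × Space d → ℝ) (m : ℕ) : 0 ≤ kernelMoment k m :=
  integral_nonneg fun q => by positivity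

theorem abs_kernelAvg_le {d : ℕ} {k : ℝ × Space d → ℝ} (hk : IsRapidKernel k) {w : Space d → ℝ}
    {b : ℝ} {m : ℕ} (hb : 0 ≤ b) (h : ∀ x, |w x| ≤ b * decayWeight m x) (x : Space d) :
    |kernelAvg k w x| ≤ kernelMoment k m * (b * decayWeight m x) := by
  unfold kernelAvg kernelMoment
  rw [← integral_mul_const, ← Real.norm_eq_abs]
  refine norm_integral_le_of_norm_le ((hk.integrable_pow m).mul_const _) (ae_of_all _ fun q => ?_)
  rw [norm_mul, Real.norm_eq_abs, Real.norm_eq_abs]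
  have h1 := (h (x + q.1 • q.2)).trans
    (mul_le_mul_of_nonneg_left (decayWeight_add_le m x (q.1 • q.2)) hb)
  calc _ ≤ |k q| * (b * ((1 + ‖q.1 • q.2‖) ^ m * decayWeight m x)) :=
        mul_le_mul_of_nonneg_left h1 (abs_nonneg _)
    _ = _ := by ring

/-- Lipschitz bounds in exponentially weighted norms, as satisfied by Volterra operators. -/
def CausalBound {d : ℕ} (m : ℕ) (C : ℝ) (A : (Cyl d →ᵇ ℝ) → (Cyl d →ᵇ ℝ)) : Prop :=
  ∀ l > 0, ∀ b ≥ 0, ∀ U V : Cyl d →ᵇ ℝ,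
    (∀ (s : unitInterval) x, |U (s, x) - V (s, x)| ≤ b * Real.exp (l * s) * decayWeight m x) →
    ∀ (s : unitInterval) x,
      |A U (s, x) - A V (s, x)| ≤ C / l * (b * Real.exp (l * s) * decayWeight m x)

theorem CausalBound.mono {d m : ℕ} {C C' : ℝ} {A : (Cyl d →ᵇ ℝ) → (Cyl d →ᵇ ℝ)}
    (h : CausalBound m C A) (hC : C ≤ C') : CausalBound m C' A := by
  intro l hl b hb U V hUV s x
  refine (h l hl b hb U V hUV s x).trans ?_
  have := decayWeight_pos m x
  gcongr

theorem CausalBound.const_add {d m : ℕ} {C : ℝ} {A : (Cyl d →ᵇ ℝ) → (Cyl d →ᵇ ℝ)}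
    (h : CausalBound m C A) (W : Cyl d →ᵇ ℝ) : CausalBound m C fun U => W + A U := by
  intro l hl b hb U V hUV s x
  simpa using h l hl b hb U V hUV s x

/-- The bound is homogeneous in `b`, so it passes to difference quotients of `A` in the direction `V
- V'`, evaluated at a point, and then to the limit. This lets the contraction argument also invert
the linearization required by the implicit function theorem. -/
theorem CausalBound.of_hasFDerivAt {d m : ℕ} {C : ℝ} (hC : 0 ≤ C)
    {A : (Cyl d →ᵇ ℝ) → (Cyl d →ᵇ ℝ)} (h : CausalBound m C A) {L : (Cyl d →ᵇ ℝ) →L[ℝ] (Cyl d →ᵇ ℝ)}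
    {U : Cyl d →ᵇ ℝ} (hL : HasFDerivAt A L U) : CausalBound m C L := by
  intro l hl b hb V V' hV s x
  have hρ := decayWeight_pos m x
  set W := V - V' with hW
  have e : L V (s, x) - L V' (s, x) = L W (s, x) := by rw [hW, map_sub]; rfl
  rw [e]
  have h1 : HasDerivAt (fun ε : ℝ => U + ε • W) W 0 := by
    simpa using ((hasDerivAt_id (0 : ℝ)).smul_const W).const_add U
  have h2 : HasDerivAt (fun ε : ℝ => A (U + ε • W)) (L W) 0 := by
    refine HasFDerivAt.comp_hasDerivAt (0 : ℝ) (f := fun ε : ℝ => U + ε • W) (l := A) ?_ h1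
    simpa using hL
  have h3 := (BoundedContinuousFunction.evalCLM ℝ ((s, x) : Cyl d)).hasFDerivAt.comp_hasDerivAt
    (0 : ℝ) h2
  refine h3.le_of_lip' (by positivity) (Eventually.of_forall fun ε => ?_)
  have h4 := h l hl (|ε| * b) (by positivity) (U + ε • W) U (fun s x => ?_) s x
  · simp only [Function.comp_apply, zero_smul, add_zero, sub_zero, Real.norm_eq_abs,
      BoundedContinuousFunction.evalCLM_apply]
    refine h4.trans (le_of_eq ?_)
    ring
  · have := mul_le_mul_of_nonneg_left (hV s x) (abs_nonneg ε)
    simpa [hW, abs_mul, mul_assoc] using this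

/-- The function `(s, x) ↦ exp (l s)`. -/
noncomputable def expWeight (d : ℕ) (l : ℝ) : Cyl d →ᵇ ℝ :=
  BoundedContinuousFunction.ofNormedAddCommGroup (fun p => Real.exp (l * p.1)) (by fun_prop)
    (Real.exp |l|) fun p => by
      rw [Real.norm_of_nonneg (Real.exp_pos _).le]
      refine Real.exp_le_exp.2 ((le_abs_self _).trans ?_)
      rw [abs_mul, abs_of_nonneg p.1.2.1]
      exact mul_le_of_le_one_right (abs_nonneg _) p.1.2.2

@[simp]
theorem expWeight_apply {d : ℕ} (l : ℝ) (s : unitInterval) (x : Space d) :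
    expWeight d l (s, x) = Real.exp (l * s) := rfl

theorem expWeight_mul_expWeight_neg {d : ℕ} (l : ℝ) : expWeight d l * expWeight d (-l) = 1 := by
  ext ⟨s, x⟩
  simp [← Real.exp_add]

/-- Conjugation of an operator by an exponential weight in time. -/
noncomputable def conjExp {d : ℕ} (l : ℝ) (A : (Cyl d →ᵇ ℝ) → (Cyl d →ᵇ ℝ)) (W : Cyl d →ᵇ ℝ) :
    Cyl d →ᵇ ℝ :=
  expWeight d (-l) * A (expWeight d l * W)

theorem isFixedPt_conjExp {d : ℕ} {l : ℝ} {A : (Cyl d →ᵇ ℝ) → (Cyl d →ᵇ ℝ)} {U : Cyl d →ᵇ ℝ}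
    (h : A U = U) : Function.IsFixedPt (conjExp l A) (expWeight d (-l) * U) := by
  unfold Function.IsFixedPt conjExp
  rw [← mul_assoc, expWeight_mul_expWeight_neg, one_mul, h]

/-- Conjugation turns the weighted norm into the plain sup norm, and `l = 2C + 1` makes `C / l ≤ 1 /
2`. -/
theorem CausalBound.contractingWith {d : ℕ} {C : ℝ} (hC : 0 ≤ C) {A : (Cyl d →ᵇ ℝ) → (Cyl d →ᵇ ℝ)}
    (h : CausalBound 0 C A) : ContractingWith (1 / 2) (conjExp (2 * C + 1) A) := by
  have hl : 0 < 2 * C + 1 := by linarith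
  refine ⟨by rw [← NNReal.coe_lt_coe]; norm_num, LipschitzWith.of_dist_le_mul fun U V => ?_⟩
  refine (BoundedContinuousFunction.dist_le (by positivity)).2 fun ⟨s, x⟩ => ?_
  have hE := Real.exp_pos ((2 * C + 1) * s)
  have key := h _ hl (dist U V) dist_nonneg (expWeight d (2 * C + 1) * U)
    (expWeight d (2 * C + 1) * V) (fun s x => ?_) s x
  · simp only [conjExp, BoundedContinuousFunction.coe_mul, Pi.mul_apply, expWeight_apply,
      Real.dist_eq, ← mul_sub, abs_mul, neg_mul, Real.exp_neg, abs_inv, abs_of_pos hE]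
    rw [inv_mul_le_iff₀ hE]
    refine key.trans ?_
    have : C / (2 * C + 1) ≤ 1 / 2 := by rw [div_le_div_iff₀ hl two_pos]; linarith
    rw [decayWeight_zero, mul_one]
    have hd : (0 : ℝ) ≤ dist U V := dist_nonneg
    calc C / (2 * C + 1) * (dist U V * Real.exp ((2 * C + 1) * s))
        ≤ 1 / 2 * (dist U V * Real.exp ((2 * C + 1) * s)) := by gcongr
      _ = _ := by push_cast; ring
  · have hE := Real.exp_pos ((2 * C + 1) * s)
    have := mul_le_mul_of_nonneg_left (U.dist_coe_le_dist (g := V) (s, x)) hE.le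
    simp only [BoundedContinuousFunction.coe_mul, Pi.mul_apply, expWeight_apply, ← mul_sub,
      abs_mul, abs_of_pos hE, decayWeight_zero, mul_one]
    rw [Real.dist_eq] at this
    linarith

theorem CausalBound.existsUnique {d : ℕ} {C : ℝ} (hC : 0 ≤ C) {A : (Cyl d →ᵇ ℝ) → (Cyl d →ᵇ ℝ)}
    (h : CausalBound 0 C A) : ∃! U, A U = U := by
  have hc := h.contractingWith hC
  refine ⟨expWeight d (2 * C + 1) * ContractingWith.fixedPoint _ hc, ?_, fun V hV => ?_⟩
  · have hf : expWeight d (-(2 * C + 1)) * A (expWeight d (2 * C + 1) *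
        ContractingWith.fixedPoint _ hc) = ContractingWith.fixedPoint _ hc :=
      hc.fixedPoint_isFixedPt
    dsimp only
    conv_rhs => rw [← hf]
    rw [← mul_assoc, expWeight_mul_expWeight_neg, one_mul]
  · rw [← hc.fixedPoint_unique (isFixedPt_conjExp hV), ← mul_assoc, expWeight_mul_expWeight_neg,
      one_mul]

/-- The set `|W| ≤ 2a · decayWeight m` is closed in the sup norm and invariant under the conjugated
map: the value at `0` contributes `a`, and half of `2a` comes from the weighted Lipschitz bound. The
iterates starting from `0` stay in it and converge to the fixed point. Undoing the conjugation costs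
at most `exp (2C + 1)`. -/
theorem CausalBound.decay {d m : ℕ} {C : ℝ} (hC : 0 ≤ C) {A : (Cyl d →ᵇ ℝ) → (Cyl d →ᵇ ℝ)}
    (h : CausalBound 0 C A) (hm : CausalBound m C A) {a : ℝ} (ha : 0 ≤ a)
    (h0 : ∀ s x, |A 0 (s, x)| ≤ a * decayWeight m x) {U : Cyl d →ᵇ ℝ} (hU : A U = U) :
    ∃ b ≥ 0, ∀ s x, |U (s, x)| ≤ b * decayWeight m x := by
  have hl : 0 < 2 * C + 1 := by linarith
  have hc := h.contractingWith hC
  set S : Set (Cyl d →ᵇ ℝ) := {W | ∀ s x, |W (s, x)| ≤ 2 * a * decayWeight m x} with hS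
  have hSc : IsClosed S := by
    simp only [hS, ofPred_forall]
    refine isClosed_iInter fun s => isClosed_iInter fun x => isClosed_le ?_ continuous_const
    exact ((BoundedContinuousFunction.evalCLM ℝ ((s, x) : Cyl d)).continuous).abs
  have hmap : MapsTo (conjExp (2 * C + 1) A) S S := by
    intro W hW s x
    have hE := Real.exp_pos ((2 * C + 1) * s)
    have hE1 : 1 ≤ Real.exp ((2 * C + 1) * s) := Real.one_le_exp (mul_nonneg hl.le s.2.1)
    have hρ := decayWeight_pos m x
    have key := hm _ hl (2 * a) (by positivity) (expWeight d (2 * C + 1) * W) 0 (fun s x => ?_) s x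
    · simp only [conjExp, BoundedContinuousFunction.coe_mul, Pi.mul_apply, expWeight_apply,
        abs_mul, neg_mul, Real.exp_neg, abs_inv, abs_of_pos hE]
      rw [inv_mul_le_iff₀ hE]
      have h1 := abs_sub_abs_le_abs_sub (A (expWeight d (2 * C + 1) * W) (s, x)) (A 0 (s, x))
      have : C / (2 * C + 1) ≤ 1 / 2 := by rw [div_le_div_iff₀ hl two_pos]; linarith
      have h2 : C / (2 * C + 1) * (2 * a * Real.exp ((2 * C + 1) * s) * decayWeight m x)
        ≤ 1 / 2 * (2 * a * Real.exp ((2 * C + 1) * s) * decayWeight m x) := by gcongr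
      have h3 := h0 s x
      have h4 : a * decayWeight m x ≤ a * decayWeight m x * Real.exp ((2 * C + 1) * s) :=
        le_mul_of_one_le_right (by positivity) hE1
      nlinarith
    · have hE := Real.exp_pos ((2 * C + 1) * s)
      have := mul_le_mul_of_nonneg_left (hW s x) hE.le
      simp only [BoundedContinuousFunction.coe_mul, Pi.mul_apply, expWeight_apply,
        BoundedContinuousFunction.coe_zero, Pi.zero_apply, sub_zero, abs_mul, abs_of_pos hE]
      linarith
  have hmem : ContractingWith.fixedPoint _ hc ∈ S := by
    refine hSc.mem_of_tendsto (hc.tendsto_iterate_fixedPoint 0) (Eventually.of_forall fun n => ?_)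
    refine hmap.iterate n ?_
    intro s x
    have hρ := decayWeight_pos m x
    simp only [BoundedContinuousFunction.coe_zero, Pi.zero_apply, abs_zero]
    positivity
  rw [← hc.fixedPoint_unique (isFixedPt_conjExp hU)] at hmem
  refine ⟨Real.exp (2 * C + 1) * (2 * a), by positivity, fun s x => ?_⟩
  have hρ := decayWeight_pos m x
  have hE := Real.exp_pos ((2 * C + 1) * s)
  have h1 := hmem s x
  simp only [BoundedContinuousFunction.coe_mul, Pi.mul_apply, expWeight_apply,
    abs_mul, neg_mul, Real.exp_neg, abs_inv, abs_of_pos hE] at h1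
  rw [inv_mul_le_iff₀ hE] at h1
  refine h1.trans ?_
  rw [mul_assoc, mul_assoc, mul_assoc]
  refine mul_le_mul_of_nonneg_right (Real.exp_le_exp.2 ?_) (by positivity)
  exact mul_le_of_le_one_right hl.le s.2.2

/-- Solving `U - L U = W` means finding a fixed point of `U ↦ W + L U`, which exists and is unique
with no smallness of `‖L‖`; the open mapping theorem makes the inverse continuous. -/
theorem CausalBound.bijective_id_sub {d : ℕ} {C : ℝ} (hC : 0 ≤ C)
    {L : (Cyl d →ᵇ ℝ) →L[ℝ] (Cyl d →ᵇ ℝ)} (h : CausalBound 0 C L) :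
    (ContinuousLinearMap.id ℝ (Cyl d →ᵇ ℝ) - L).IsInvertible := by
  have hex : ∀ W, ∃! U, W + L U = U := fun W => (h.const_add W).existsUnique hC
  have hinj : Function.Injective (ContinuousLinearMap.id ℝ (Cyl d →ᵇ ℝ) - L) := by
    rw [injective_iff_map_eq_zero]
    intro U hU
    refine (hex 0).unique ?_ (by simp)
    rw [zero_add]
    exact (sub_eq_zero.1 hU).symm
  have hsurj : Function.Surjective (ContinuousLinearMap.id ℝ (Cyl d →ᵇ ℝ) - L) := by
    intro W
    obtain ⟨U, hU, -⟩ := hex W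
    exact ⟨U, sub_eq_iff_eq_add.2 hU.symm⟩
  exact ⟨ContinuousLinearEquiv.ofBijective _ (LinearMap.ker_eq_bot.2 hinj)
    (LinearMap.range_eq_top.2 hsurj), by ext; rfl⟩

end

/-! ### The mild equation and its smooth solution. -/

section

open Filter Topology
open scoped BoundedContinuousFunction

theorem exists_abs_le_mul_decayWeight {d : ℕ} {g : Space d → ℝ} (hg : Continuous g)
    (hgc : HasCompactSupport g) (m : ℕ) : ∃ a ≥ 0, ∀ x, |g x| ≤ a * decayWeight m x := by
  obtain ⟨a, ha⟩ := (hgc.mul_left (f := fun x => (1 + ‖x‖) ^ m)).exists_bound_of_continuous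
    (by fun_prop)
  refine ⟨a, (norm_nonneg _).trans (ha 0), fun x => ?_⟩
  have h := ha x
  simp only [Pi.mul_apply] at h
  rw [norm_mul, Real.norm_of_nonneg (by positivity), Real.norm_eq_abs] at h
  unfold decayWeight
  rw [← div_eq_mul_inv, le_div_iff₀ (by positivity)]
  linarith

/-- Constant functions. -/
noncomputable def constLift (X E : Type) [TopologicalSpace X] [NormedAddCommGroup E]
    [NormedSpace ℝ E] : E →L[ℝ] (X →ᵇ E) :=
  LinearMap.mkContinuous
    { toFun := BoundedContinuousFunction.const X
      map_add' := fun _ _ => rfl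
      map_smul' := fun _ _ => rfl } 1 fun e => by
    rw [one_mul]
    exact (BoundedContinuousFunction.norm_le (norm_nonneg e)).2 fun x => le_rfl

@[simp]
theorem constLift_apply {X E : Type} [TopologicalSpace X] [NormedAddCommGroup E]
    [NormedSpace ℝ E] (e : E) (x : X) : constLift X E e x = e := rfl

/-- The function `(s, x) ↦ (y, U (s, x))`. -/
noncomputable def pairLift (d : ℕ) :
    (Space d × (Cyl d →ᵇ ℝ)) →L[ℝ] (Cyl d →ᵇ (Space d × ℝ)) :=
  ((ContinuousLinearMap.inl ℝ (Space d) ℝ).compLeftContinuousBounded (Cyl d)) ∘L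
      (constLift (Cyl d) (Space d)) ∘L ContinuousLinearMap.fst ℝ (Space d) (Cyl d →ᵇ ℝ)
    + ((ContinuousLinearMap.inr ℝ (Space d) ℝ).compLeftContinuousBounded (Cyl d)) ∘L
      ContinuousLinearMap.snd ℝ (Space d) (Cyl d →ᵇ ℝ)

theorem pairLift_apply {d : ℕ} (q : Space d × (Cyl d →ᵇ ℝ)) (p : Cyl d) :
    pairLift d q p = (q.1, q.2 p) := by
  simp [pairLift]

/-- The right hand side of the evolution equation `u_t = -u + (1 - Δ)⁻¹ (u - div f(x, u))`. -/
noncomputable def mildRhs {d : ℕ} (f : Space d × ℝ → Space d) (w : Space d → ℝ) (x : Space d) : ℝ :=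
  -w x + kernelAvg besselKernel w x
    - ∑ i, kernelAvg (besselGradKernel i) (fun y => f (y, w y) i) x

section Mild

variable {d : ℕ} (f : Space d × ℝ → Space d) (hf : ContDiff ℝ ∞ f) (hfc : HasCompactSupport f)
    (u₀ : Space d → ℝ) (hu₀ : ContDiff ℝ ∞ u₀) (hu₀c : HasCompactSupport u₀)

/-- The flux `(s, x) ↦ f (x + y, U (s, x))`. -/
noncomputable def shiftedFlux (q : Space d × (Cyl d →ᵇ ℝ)) : Cyl d →ᵇ Space d :=
  superposition f hf hfc ⟨fun p : Cyl d => (p.2, (0 : ℝ)), by fun_prop⟩ (pairLift d q)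

theorem shiftedFlux_apply (q : Space d × (Cyl d →ᵇ ℝ)) (p : Cyl d) :
    shiftedFlux f hf hfc q p = f (p.2 + q.1, q.2 p) := by
  simp [shiftedFlux, pairLift_apply]

/-- The right hand side of the evolution equation, translated by `y`. -/
noncomputable def shiftedRhs (q : Space d × (Cyl d →ᵇ ℝ)) : Cyl d →ᵇ ℝ :=
  -q.2 + spaceAvg isRapidKernel_besselKernel q.2
    - ∑ i, spaceAvg (isRapidKernel_besselGradKernel i)
      ((EuclideanSpace.proj (𝕜 := ℝ) i).compLeftContinuousBounded (Cyl d)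
        (shiftedFlux f hf hfc q))

theorem shiftedRhs_apply (q : Space d × (Cyl d →ᵇ ℝ)) (s : unitInterval) (x : Space d) :
    shiftedRhs f hf hfc q (s, x) = -q.2 (s, x)
      + kernelAvg besselKernel (fun y => q.2 (s, y)) x
      - ∑ i, kernelAvg (besselGradKernel i) (fun y => f (y + q.1, q.2 (s, y)) i) x := by
  simp [shiftedRhs, spaceAvg_apply, shiftedFlux_apply]

/-- The fixed points of `mildMap` at `(t, y)` are `(s, x) ↦ u (t s, x + y)` for solutions `u` of
the evolution equation. -/
noncomputable def mildMap (q : (ℝ × Space d) × (Cyl d →ᵇ ℝ)) : Cyl d →ᵇ ℝ :=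
  superposition u₀ hu₀ hu₀c ⟨fun p : Cyl d => p.2, by fun_prop⟩ (constLift (Cyl d) (Space d) q.1.2)
    + q.1.1 • timeAvg d (shiftedRhs f hf hfc (q.1.2, q.2))

theorem mildMap_apply (q : (ℝ × Space d) × (Cyl d →ᵇ ℝ)) (s : unitInterval) (x : Space d) :
    mildMap f hf hfc u₀ hu₀ hu₀c q (s, x) = u₀ (x + q.1.2)
      + q.1.1 * (s * ∫ σ : unitInterval, shiftedRhs f hf hfc (q.1.2, q.2) (s * σ, x)) := by
  simp [mildMap, timeAvg_apply]

theorem contDiff_shiftedFlux : ContDiff ℝ ∞ (shiftedFlux f hf hfc) :=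
  (contDiff_superposition f hf hfc _).comp (pairLift d).contDiff

theorem contDiff_shiftedRhs : ContDiff ℝ ∞ (shiftedRhs f hf hfc) := by
  unfold shiftedRhs
  refine (contDiff_snd.neg.add ((spaceAvg _).contDiff.comp contDiff_snd)).sub ?_
  refine ContDiff.sum fun i _ => (spaceAvg _).contDiff.comp ?_
  exact (ContinuousLinearMap.contDiff _).comp (contDiff_shiftedFlux f hf hfc)

theorem contDiff_mildMap : ContDiff ℝ ∞ (mildMap f hf hfc u₀ hu₀ hu₀c) := by
  unfold mildMap
  refine ContDiff.add ((contDiff_superposition u₀ hu₀ hu₀c _).comp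
    ((constLift (Cyl d) (Space d)).contDiff.comp contDiff_fst.snd)) ?_
  refine contDiff_fst.fst.smul ((timeAvg d).contDiff.comp ?_)
  exact (contDiff_shiftedRhs f hf hfc).comp (contDiff_fst.snd.prodMk contDiff_snd)

/-- The term with `u₀` cancels in differences, the right hand side is Lipschitz in every weighted
norm, and the time primitive supplies the factor `1 / l`. -/
theorem exists_causalBound_mildMap (m : ℕ) (p : ℝ × Space d) :
    ∃ C ≥ 0, CausalBound m C fun U => mildMap f hf hfc u₀ hu₀ hu₀c (p, U) := by
  obtain ⟨L, hL0, hL⟩ := exists_forall_norm_sub_le hf hfc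
  -- The three terms account for `-U`, for `(1 - Δ)⁻¹ U`, and for the flux, which carries its
  -- Lipschitz constant `L`.
  set K := 1 + kernelMoment (besselKernel (d := d)) m
    + ∑ i : Fin d, kernelMoment (besselGradKernel i) m * L with hK
  have hK0 : 0 ≤ K := by
    have := kernelMoment_nonneg (besselKernel (d := d)) m
    have : 0 ≤ ∑ i : Fin d, kernelMoment (besselGradKernel i) m * L :=
      Finset.sum_nonneg fun i _ => mul_nonneg (kernelMoment_nonneg _ m) hL0
    positivity
  refine ⟨|p.1| * K, by positivity, fun l hl b hb U V hUV s x => ?_⟩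
  have hR : ∀ (s : unitInterval) x, |(shiftedRhs f hf hfc (p.2, U) - shiftedRhs f hf hfc (p.2, V))
      (s, x)| ≤ (K * b * decayWeight m x) * Real.exp (l * s) := by
    intro s x
    set e : Cyl d →ᵇ ℝ := U - V with he
    set g : Fin d → (Cyl d →ᵇ ℝ) := fun i =>
      (EuclideanSpace.proj (𝕜 := ℝ) i).compLeftContinuousBounded (Cyl d)
        (shiftedFlux f hf hfc (p.2, U)) - (EuclideanSpace.proj (𝕜 := ℝ) i).compLeftContinuousBounded
        (Cyl d) (shiftedFlux f hf hfc (p.2, V)) with hg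
    have hE := Real.exp_pos (l * s)
    have hρ := decayWeight_pos m x
    have hdec : shiftedRhs f hf hfc (p.2, U) - shiftedRhs f hf hfc (p.2, V)
        = -e + spaceAvg isRapidKernel_besselKernel e
          - ∑ i, spaceAvg (isRapidKernel_besselGradKernel i) (g i) := by
      simp only [shiftedRhs, he, hg, map_sub, Finset.sum_sub_distrib]
      abel
    have h1 : ∀ x, |e (s, x)| ≤ b * Real.exp (l * s) * decayWeight m x := fun x => hUV s x
    have h2 : ∀ i x, |g i (s, x)| ≤ (L * (b * Real.exp (l * s))) * decayWeight m x := by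
      intro i x
      have h3 : |g i (s, x)| ≤ ‖f (x + p.2, U (s, x)) - f (x + p.2, V (s, x))‖ := by
        simpa [hg, shiftedFlux_apply] using
          PiLp.norm_apply_le (f (x + p.2, U (s, x)) - f (x + p.2, V (s, x))) i
      refine (h3.trans (hL _ _)).trans ?_
      rw [mul_assoc]
      refine mul_le_mul_of_nonneg_left ?_ hL0
      simpa using hUV s x
    have h4 := abs_kernelAvg_le isRapidKernel_besselKernel (by positivity) h1 x
    have h5 : |∑ i, spaceAvg (isRapidKernel_besselGradKernel i) (g i) (s, x)|
        ≤ ∑ i : Fin d, kernelMoment (besselGradKernel i) m * L *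
          (b * Real.exp (l * s) * decayWeight m x) := by
      refine (Finset.abs_sum_le_sum_abs _ _).trans (Finset.sum_le_sum fun i _ => ?_)
      refine (abs_kernelAvg_le (isRapidKernel_besselGradKernel i) (by positivity) (h2 i) x).trans
        (le_of_eq (by ring))
    rw [← Finset.sum_mul] at h5
    rw [hdec]
    simp only [BoundedContinuousFunction.coe_sub, BoundedContinuousFunction.coe_add,
      BoundedContinuousFunction.coe_neg, Pi.sub_apply, Pi.add_apply, Pi.neg_apply,
      BoundedContinuousFunction.sum_apply, spaceAvg_apply]
    simp only [spaceAvg_apply] at h5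
    have h6 := abs_sub (-e (s, x) + kernelAvg besselKernel (fun y => e (s, y)) x)
      (∑ i, kernelAvg (besselGradKernel i) (fun y => g i (s, y)) x)
    have h7 := abs_add_le (-e (s, x)) (kernelAvg besselKernel (fun y => e (s, y)) x)
    rw [abs_neg] at h7
    have h8 := h1 x
    calc _ ≤ _ := h6
      _ ≤ K * (b * Real.exp (l * s) * decayWeight m x) := by rw [hK]; linarith
      _ = _ := by ring
  have hρ := decayWeight_pos m x
  have h1 := abs_timeAvg_le hl (by positivity) (fun s => hR s x) s
  rw [map_sub] at h1
  simp only [mildMap, BoundedContinuousFunction.coe_add, BoundedContinuousFunction.coe_smul,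
    Pi.add_apply, add_sub_add_left_eq_sub, smul_eq_mul, ← mul_sub, abs_mul]
  refine (mul_le_mul_of_nonneg_left h1 (abs_nonneg p.1)).trans (le_of_eq ?_)
  field_simp

theorem existsUnique_mildMap (p : ℝ × Space d) :
    ∃! U, mildMap f hf hfc u₀ hu₀ hu₀c (p, U) = U := by
  obtain ⟨C, hC, h⟩ := exists_causalBound_mildMap f hf hfc u₀ hu₀ hu₀c 0 p
  exact h.existsUnique hC

/-- The fixed point of `mildMap`. -/
noncomputable def mildSol (p : ℝ × Space d) : Cyl d →ᵇ ℝ :=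
  (existsUnique_mildMap f hf hfc u₀ hu₀ hu₀c p).choose

theorem mildMap_mildSol (p : ℝ × Space d) :
    mildMap f hf hfc u₀ hu₀ hu₀c (p, mildSol f hf hfc u₀ hu₀ hu₀c p)
      = mildSol f hf hfc u₀ hu₀ hu₀c p :=
  (existsUnique_mildMap f hf hfc u₀ hu₀ hu₀c p).choose_spec.1

theorem eq_mildSol {p : ℝ × Space d} {U : Cyl d →ᵇ ℝ}
    (h : mildMap f hf hfc u₀ hu₀ hu₀c (p, U) = U) : U = mildSol f hf hfc u₀ hu₀ hu₀c p :=
  (existsUnique_mildMap f hf hfc u₀ hu₀ hu₀c p).unique h (mildMap_mildSol f hf hfc u₀ hu₀ hu₀c p)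

/-- The implicit function theorem for `G(p, U) = U - M(p, U)`. The implicit function consists of
fixed points, and fixed points are globally unique, so it coincides with `mildSol` near `p`; no
prior continuity of `mildSol` is required. -/
theorem contDiff_mildSol : ContDiff ℝ ∞ (mildSol f hf hfc u₀ hu₀ hu₀c) := by
  rw [contDiff_iff_contDiffAt]
  intro p
  set M := mildMap f hf hfc u₀ hu₀ hu₀c with hM
  set S := mildSol f hf hfc u₀ hu₀ hu₀c with hS
  set G : (ℝ × Space d) × (Cyl d →ᵇ ℝ) → (Cyl d →ᵇ ℝ) := fun q => q.2 - M q with hG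
  have hMc : ContDiff ℝ ∞ M := contDiff_mildMap f hf hfc u₀ hu₀ hu₀c
  have hGc : ContDiff ℝ ∞ G := contDiff_snd.sub hMc
  have hGp : ContDiffAt ℝ ∞ G (p, S p) := hGc.contDiffAt
  have h1 : HasFDerivAt (fun U : Cyl d →ᵇ ℝ => (p, U))
      (ContinuousLinearMap.inr ℝ (ℝ × Space d) (Cyl d →ᵇ ℝ)) (S p) := hasFDerivAt_prodMk_right p (S p)
  have h2 : HasFDerivAt (fun U : Cyl d →ᵇ ℝ => M (p, U)) (fderiv ℝ M (p, S p) ∘L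
      ContinuousLinearMap.inr ℝ (ℝ × Space d) (Cyl d →ᵇ ℝ)) (S p) :=
    ((hMc.differentiable (by simp)) _).hasFDerivAt.comp (S p) h1
  have h3 : HasFDerivAt (fun U : Cyl d →ᵇ ℝ => G (p, U)) (fderiv ℝ G (p, S p) ∘L
      ContinuousLinearMap.inr ℝ (ℝ × Space d) (Cyl d →ᵇ ℝ)) (S p) :=
    ((hGc.differentiable (by simp)) _).hasFDerivAt.comp (S p) h1
  -- Identifies the partial derivative of `G` in `U` as the identity minus that of `M`, the form in
  -- which invertibility is available.
  have h4 := h3.unique ((hasFDerivAt_id (S p)).sub h2)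
  obtain ⟨C, hC, hb⟩ := exists_causalBound_mildMap f hf hfc u₀ hu₀ hu₀c 0 p
  have hinv : (fderiv ℝ G (p, S p) ∘L
      ContinuousLinearMap.inr ℝ (ℝ × Space d) (Cyl d →ᵇ ℝ)).IsInvertible := by
    rw [h4]
    exact (hb.of_hasFDerivAt hC h2).bijective_id_sub hC
  have h5 := hGp.eventually_apply_implicitFunction (by simp) hinv
  have h6 := hGp.contDiffAt_implicitFunction (by simp) hinv
  refine h6.congr_of_eventuallyEq (h5.mono fun x hx => ?_)
  have h7 : G (p, S p) = 0 := sub_eq_zero.2 (mildMap_mildSol f hf hfc u₀ hu₀ hu₀c p).symm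
  rw [h7] at hx
  exact (eq_mildSol f hf hfc u₀ hu₀ hu₀c (sub_eq_zero.1 hx).symm).symm

theorem kernelAvg_translate (k : ℝ × Space d → ℝ) (w : Space d → ℝ) (x y : Space d) :
    kernelAvg k (fun z => w (x + z)) y = kernelAvg k w (x + y) := by
  simp only [kernelAvg, add_assoc]

/-- Rescaling time by `s` and translating space by `x` carries the fixed point for `(t, y)` to a
fixed point for `(t s, y + x)`, so uniqueness applies. Thus smooth dependence on the parameters is
smoothness in the space-time variables. -/
theorem mildSol_apply (t : ℝ) (y : Space d) (s : unitInterval) (x : Space d) :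
    mildSol f hf hfc u₀ hu₀ hu₀c (t, y) (s, x)
      = mildSol f hf hfc u₀ hu₀ hu₀c (t * s, y + x) (1, 0) := by
  set U := mildSol f hf hfc u₀ hu₀ hu₀c (t, y) with hU
  set V : Cyl d →ᵇ ℝ := U.compContinuous ⟨fun p : Cyl d => ((s * p.1, x + p.2) : Cyl d),
    by fun_prop⟩ with hV
  have hVa : ∀ s' x', V (s', x') = U (s * s', x + x') := fun _ _ => rfl
  have hfix : mildMap f hf hfc u₀ hu₀ hu₀c ((t * s, y + x), V) = V := by
    ext ⟨s', x'⟩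
    have hfixU := DFunLike.congr_fun (mildMap_mildSol f hf hfc u₀ hu₀ hu₀c (t, y)) (s * s', x + x')
    rw [← hU] at hfixU
    rw [hVa, mildMap_apply, ← hfixU, mildMap_apply]
    have hrhs : ∀ σ : unitInterval, shiftedRhs f hf hfc (y + x, V) (s' * σ, x')
        = shiftedRhs f hf hfc (y, U) (s * s' * σ, x + x') := by
      intro σ
      rw [shiftedRhs_apply, shiftedRhs_apply]
      simp only [hVa]
      rw [kernelAvg_translate besselKernel (fun z => U (s * (s' * σ), z)) x x', mul_assoc]
      congr 1
      refine Finset.sum_congr rfl fun i _ => ?_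
      rw [← kernelAvg_translate]
      congr 1; ext z
      rw [show z + (y + x) = x + z + y by abel]
    simp only [hrhs]
    rw [show x' + (y + x) = x + x' + y by abel]
    push_cast
    ring
  have := eq_mildSol f hf hfc u₀ hu₀ hu₀c hfix
  rw [← this, hVa]
  simp

/-- The smooth solution. -/
noncomputable def smoothSol (p : ℝ × Space d) : ℝ := mildSol f hf hfc u₀ hu₀ hu₀c p (1, 0)

theorem contDiff_smoothSol : ContDiff ℝ ∞ (smoothSol f hf hfc u₀ hu₀ hu₀c) :=
  ContDiff.comp (g := fun U : Cyl d →ᵇ ℝ => BoundedContinuousFunction.evalCLM ℝ ((1, 0) : Cyl d) U)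
    (ContinuousLinearMap.contDiff _) (contDiff_mildSol f hf hfc u₀ hu₀ hu₀c)

theorem smoothSol_eq (t : ℝ) (s : unitInterval) (x : Space d) :
    smoothSol f hf hfc u₀ hu₀ hu₀c (t * s, x) = mildSol f hf hfc u₀ hu₀ hu₀c (t, 0) (s, x) := by
  rw [mildSol_apply, zero_add]; rfl

theorem smoothSol_eq_integral (t : ℝ) (x : Space d) :
    smoothSol f hf hfc u₀ hu₀ hu₀c (t, x) = u₀ x + ∫ τ in (0 : ℝ)..t,
      mildRhs f (fun y => smoothSol f hf hfc u₀ hu₀ hu₀c (τ, y)) x := by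
  have h := smoothSol_eq f hf hfc u₀ hu₀ hu₀c t 1 x
  rw [← mildMap_mildSol, mildMap_apply] at h
  simp only [Set.Icc.coe_one, mul_one, one_mul, add_zero] at h
  rw [h]
  congr 1
  have hrhs : ∀ σ : unitInterval, shiftedRhs f hf hfc (0, mildSol f hf hfc u₀ hu₀ hu₀c (t, 0)) (σ, x)
      = mildRhs f (fun y => smoothSol f hf hfc u₀ hu₀ hu₀c (t * σ, y)) x := by
    intro σ
    rw [shiftedRhs_apply]
    simp only [mildRhs, smoothSol_eq, add_zero]
  simp only [hrhs]
  have e := integral_subtype_comap (μ := volume) (measurableSet_Icc (a := (0 : ℝ)) (b := 1))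
    fun σ : ℝ => mildRhs f (fun y => smoothSol f hf hfc u₀ hu₀ hu₀c (t * σ, y)) x
  refine (congrArg (t * ·) e).trans ?_
  rw [integral_Icc_eq_integral_Ioc, ← intervalIntegral.integral_of_le zero_le_one]
  rw [intervalIntegral.mul_integral_comp_mul_left (f := fun τ =>
    mildRhs f (fun y => smoothSol f hf hfc u₀ hu₀ hu₀c (τ, y)) x)]
  simp

/-- A single fixed point, the one for `(T, 0)`, contains all times of `[0, T]` through `t = T · (t /
T)`. The image of `0` decays because `u₀` and `f(·, 0)` have compact support. -/
theorem smoothSol_decay {T : ℝ} (hT : 0 < T) (m : ℕ) : ∃ b ≥ 0, ∀ t ∈ Icc 0 T, ∀ x,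
    |smoothSol f hf hfc u₀ hu₀ hu₀c (t, x)| ≤ b * decayWeight m x := by
  obtain ⟨C, hC, h⟩ := exists_causalBound_mildMap f hf hfc u₀ hu₀ hu₀c 0 (T, 0)
  obtain ⟨C', hC', h'⟩ := exists_causalBound_mildMap f hf hfc u₀ hu₀ hu₀c m (T, 0)
  obtain ⟨a, ha, hua⟩ := exists_abs_le_mul_decayWeight hu₀.continuous hu₀c m
  have hfa : ∀ i : Fin d, ∃ a ≥ 0, ∀ x, |f (x, 0) i| ≤ a * decayWeight m x := fun i => by
    refine exists_abs_le_mul_decayWeight (by have := hf.continuous; fun_prop) ?_ m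
    refine HasCompactSupport.intro (hfc.isCompact.image continuous_fst) fun x hx => ?_
    rw [image_eq_zero_of_notMem_tsupport fun h => hx ⟨_, h, rfl⟩]
    rfl
  choose A hA0 hA using hfa
  set K := ∑ i, kernelMoment (besselGradKernel i) m * A i with hK
  have hK0 : 0 ≤ K := Finset.sum_nonneg fun i _ => mul_nonneg (kernelMoment_nonneg _ m) (hA0 i)
  -- The constant `a` bounds `u₀`; the time primitive is estimated with weight `l = 1`, which
  -- produces `exp 1`.
  have h0 : ∀ s x, |mildMap f hf hfc u₀ hu₀ hu₀c ((T, 0), 0) (s, x)|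
      ≤ (a + T * (K * Real.exp 1)) * decayWeight m x := by
    intro s x
    have hρ := decayWeight_pos m x
    have hR : ∀ s : unitInterval, |shiftedRhs f hf hfc (0, 0) (s, x)|
        ≤ (K * decayWeight m x) * Real.exp (1 * s) := by
      intro s
      rw [shiftedRhs_apply]
      have h1 : |∑ i, kernelAvg (besselGradKernel i) (fun y => f (y, 0) i) x|
          ≤ K * decayWeight m x := by
        rw [hK, Finset.sum_mul]
        refine (Finset.abs_sum_le_sum_abs _ _).trans (Finset.sum_le_sum fun i _ => ?_)
        rw [mul_assoc]
        exact abs_kernelAvg_le (isRapidKernel_besselGradKernel i) (hA0 i) (hA i) x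
      have h2 : 1 ≤ Real.exp (1 * s) := Real.one_le_exp (by simpa using s.2.1)
      refine le_trans ?_ (le_mul_of_one_le_right (by positivity) h2)
      simpa [kernelAvg] using h1
    have h1 := abs_timeAvg_le one_pos (by positivity) hR s
    have h2 : Real.exp (1 * s) ≤ Real.exp 1 := Real.exp_le_exp.2 (by simpa using s.2.2)
    simp only [mildMap, BoundedContinuousFunction.coe_add, BoundedContinuousFunction.coe_smul,
      Pi.add_apply, superposition_apply, constLift_apply, ContinuousMap.coe_mk, add_zero, smul_eq_mul]
    refine (abs_add_le _ _).trans ?_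
    rw [add_mul, abs_mul, abs_of_pos hT]
    refine add_le_add (hua x) ?_
    rw [mul_assoc]
    refine mul_le_mul_of_nonneg_left (h1.trans ?_) hT.le
    rw [inv_one, one_mul]
    calc _ ≤ K * decayWeight m x * Real.exp 1 := by gcongr
      _ = _ := by ring
  -- `CausalBound.decay` asks for one constant serving both weights, hence the maximum.
  obtain ⟨b, hb, hbd⟩ := (h.mono (le_max_left C C')).decay (hC.trans (le_max_left C C'))
    (h'.mono (le_max_right C C')) (a := a + T * (K * Real.exp 1)) (by positivity) h0
    (mildMap_mildSol f hf hfc u₀ hu₀ hu₀c (T, 0))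
  refine ⟨b, hb, fun t ht x => ?_⟩
  have := hbd ⟨t / T, div_nonneg ht.1 hT.le, div_le_one_of_le₀ ht.2 hT.le⟩ x
  rw [← smoothSol_eq] at this
  rwa [show T * (t / T) = t by field_simp] at this

end Mild

end

/-! ### Space-time `L²` estimates and transposition of the averages. -/

section

open Filter Topology

/-- Cauchy–Schwarz for the factors `√k` and `√k g`. -/
theorem sq_lintegral_mul_le {α : Type*} [MeasurableSpace α] (μ : Measure α) {k g : α → ENNReal}
    (hk : AEMeasurable k μ) (hg : AEMeasurable g μ) :
    (∫⁻ a, k a * g a ∂μ) ^ 2 ≤ (∫⁻ a, k a ∂μ) * ∫⁻ a, k a * g a ^ 2 ∂μ := by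
  have h := ENNReal.lintegral_mul_le_Lp_mul_Lq μ Real.HolderConjugate.two_two
    (f := fun a => k a ^ (1 / 2 : ℝ)) (g := fun a => k a ^ (1 / 2 : ℝ) * g a)
    (hk.pow_const _) ((hk.pow_const _).mul hg)
  have e1 : ∀ a, k a ^ (1 / 2 : ℝ) * (k a ^ (1 / 2 : ℝ) * g a) = k a * g a := fun a => by
    rw [← mul_assoc, ← ENNReal.rpow_add_of_nonneg _ _ (by norm_num) (by norm_num)]
    norm_num
  have e2 : ∀ a, (k a ^ (1 / 2 : ℝ)) ^ (2 : ℝ) = k a := fun a => by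
    rw [← ENNReal.rpow_mul]; norm_num
  have e3 : ∀ a, (k a ^ (1 / 2 : ℝ) * g a) ^ (2 : ℝ) = k a * g a ^ 2 := fun a => by
    rw [ENNReal.mul_rpow_of_nonneg _ _ (by norm_num), e2]
    norm_num
  simp only [Pi.mul_apply, e1, e2, e3] at h
  refine (pow_le_pow_left₀ zero_le h 2).trans (le_of_eq ?_)
  rw [mul_pow]
  congr 1
  all_goals
    rw [← ENNReal.rpow_natCast, ← ENNReal.rpow_mul]
    norm_num

variable {d : ℕ} {T : ℝ}

/-- The averages `kernelAvg k` in the space variable. -/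
noncomputable def spaceOp (k : ℝ × Space d → ℝ) (W : ℝ × Space d → ℝ) (p : ℝ × Space d) : ℝ :=
  kernelAvg k (fun y => W (p.1, y)) p.2

/-- The primitive in time vanishing at `t = 0`. -/
noncomputable def timeInt (W : ℝ × Space d → ℝ) (p : ℝ × Space d) : ℝ :=
  ∫ τ in Ioc 0 p.1, W (τ, p.2)

theorem measurable_spaceOp {k W : ℝ × Space d → ℝ} (hk : Measurable k) (hW : Measurable W) :
    Measurable (spaceOp k W) := by
  have h : Measurable fun a : (ℝ × Space d) × (ℝ × Space d) =>
      k a.2 * W (a.1.1, a.1.2 + a.2.1 • a.2.2) := by fun_prop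
  exact (h.stronglyMeasurable.integral_prod_right (ν := halfMeasure d)).measurable

theorem measurable_timeInt {W : ℝ × Space d → ℝ} (hW : Measurable W) :
    Measurable (timeInt W) := by
  have hS : MeasurableSet {a : (ℝ × Space d) × ℝ | a.2 ∈ Ioc 0 a.1.1} :=
    (measurableSet_lt measurable_const measurable_snd).inter
      (measurableSet_le measurable_snd measurable_fst.fst)
  have h : Measurable (indicator {a : (ℝ × Space d) × ℝ | a.2 ∈ Ioc 0 a.1.1}
      fun a : (ℝ × Space d) × ℝ => W (a.2, a.1.2)) :=
    Measurable.indicator (by fun_prop) hS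
  have h2 := (h.stronglyMeasurable.integral_prod_right' (ν := (volume : Measure ℝ))).measurable
  convert h2 using 1
  ext p
  unfold timeInt
  rw [← integral_indicator measurableSet_Ioc]
  rfl

theorem slabMeasure_eq_prod (d : ℕ) (T : ℝ) :
    slabMeasure d T = (volume.restrict (Ioo 0 T)).prod volume := by
  unfold slabMeasure
  rw [Measure.volume_eq_prod, ← Measure.prod_restrict, Measure.restrict_univ]

instance (d : ℕ) (T : ℝ) : SFinite (slabMeasure d T) := by
  rw [slabMeasure_eq_prod]; infer_instance

/-- The energy `∫ |W (t, x)|² dx` at time `t`. -/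
noncomputable def energy (W : ℝ × Space d → ℝ) (t : ℝ) : ENNReal := ∫⁻ x, ‖W (t, x)‖ₑ ^ 2

theorem measurable_energy {W : ℝ × Space d → ℝ} (hW : Measurable W) : Measurable (energy W) := by
  have h : Measurable fun p : ℝ × Space d => ‖W p‖ₑ ^ 2 := hW.enorm.pow_const 2
  exact h.lintegral_prod_right'

theorem lintegral_enorm_sq_slab {W : ℝ × Space d → ℝ} (hW : Measurable W) :
    ∫⁻ p, ‖W p‖ₑ ^ 2 ∂(slabMeasure d T) = ∫⁻ t in Ioo 0 T, energy W t := by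
  rw [slabMeasure_eq_prod, lintegral_prod _ (hW.enorm.pow_const 2).aemeasurable]
  rfl

theorem memLp_two_iff {α : Type*} [MeasurableSpace α] {μ : Measure α} {W : α → ℝ}
    (hW : AEStronglyMeasurable W μ) : MemLp W 2 μ ↔ ∫⁻ p, ‖W p‖ₑ ^ 2 ∂μ < ⊤ := by
  have h : MemLp W 2 μ ↔ eLpNorm W 2 μ < ⊤ := ⟨fun h => h.2, fun h => ⟨hW, h⟩⟩
  rw [h, eLpNorm_lt_top_iff_lintegral_rpow_enorm_lt_top two_ne_zero (by simp)]
  simp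

theorem memLp_slab_iff {W : ℝ × Space d → ℝ} (hW : Measurable W) :
    MemLp W 2 (slabMeasure d T) ↔ ∫⁻ t in Ioo 0 T, energy W t < ⊤ := by
  rw [memLp_two_iff hW.aestronglyMeasurable, lintegral_enorm_sq_slab hW]

/-- Young's inequality: Cauchy–Schwarz against the weight `|k|`, then Tonelli and translation
invariance in `x`. -/
theorem energy_spaceOp_le {k W : ℝ × Space d → ℝ} (hk : Measurable k) (hW : Measurable W) (t : ℝ) :
    energy (spaceOp k W) t ≤ (∫⁻ q, ‖k q‖ₑ ∂(halfMeasure d)) ^ 2 * energy W t := by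
  set K := ∫⁻ q, ‖k q‖ₑ ∂(halfMeasure d) with hK
  have h1 : ∀ x, ‖spaceOp k W (t, x)‖ₑ ^ 2 ≤
      K * ∫⁻ q, ‖k q‖ₑ * ‖W (t, x + q.1 • q.2)‖ₑ ^ 2 ∂(halfMeasure d) := by
    intro x
    refine le_trans ?_ (sq_lintegral_mul_le (halfMeasure d) hk.enorm.aemeasurable
      (g := fun q => ‖W (t, x + q.1 • q.2)‖ₑ) (by fun_prop))
    refine pow_le_pow_left₀ zero_le ((enorm_integral_le_lintegral_enorm _).trans ?_) 2
    exact le_of_eq (lintegral_congr fun q => enorm_mul _ _)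
  have hm : Measurable fun a : Space d × (ℝ × Space d) =>
      ‖k a.2‖ₑ * ‖W (t, a.1 + a.2.1 • a.2.2)‖ₑ ^ 2 := by fun_prop
  calc energy (spaceOp k W) t ≤ ∫⁻ x, K * ∫⁻ q, ‖k q‖ₑ * ‖W (t, x + q.1 • q.2)‖ₑ ^ 2
        ∂(halfMeasure d) := lintegral_mono h1
    _ = K * ∫⁻ x, ∫⁻ q, ‖k q‖ₑ * ‖W (t, x + q.1 • q.2)‖ₑ ^ 2 ∂(halfMeasure d) :=
        lintegral_const_mul _ hm.lintegral_prod_right'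
    _ = K * ∫⁻ q, ∫⁻ x, ‖k q‖ₑ * ‖W (t, x + q.1 • q.2)‖ₑ ^ 2 ∂volume ∂(halfMeasure d) := by
        rw [lintegral_lintegral_swap hm.aemeasurable]
    _ = K * ∫⁻ q, ‖k q‖ₑ * energy W t ∂(halfMeasure d) := by
        congr 1
        refine lintegral_congr fun q => ?_
        rw [lintegral_const_mul _ (by fun_prop),
          lintegral_add_right_eq_self (fun x => ‖W (t, x)‖ₑ ^ 2)]
        rfl
    _ = _ := by rw [lintegral_mul_const _ hk.enorm]; ring

/-- Cauchy–Schwarz in time. The integral is kept on `(0, t]` rather than enlarged to `(0, T)`, as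
Gronwall's argument requires. -/
theorem energy_timeInt_le {W : ℝ × Space d → ℝ} (hW : Measurable W) {t : ℝ} (ht : t ≤ T) :
    energy (timeInt W) t ≤ ENNReal.ofReal T * ∫⁻ τ in Ioc 0 t, energy W τ := by
  have h1 : ∀ x, ‖timeInt W (t, x)‖ₑ ^ 2 ≤
      ENNReal.ofReal T * ∫⁻ τ in Ioc 0 t, ‖W (τ, x)‖ₑ ^ 2 := by
    intro x
    have h := sq_lintegral_mul_le (volume.restrict (Ioc 0 t)) (k := fun _ => 1)
      (g := fun τ => ‖W (τ, x)‖ₑ) (by fun_prop) (by fun_prop)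
    simp only [one_mul, lintegral_const, Measure.restrict_apply MeasurableSet.univ, univ_inter,
      Real.volume_Ioc, sub_zero] at h
    refine (pow_le_pow_left₀ zero_le (enorm_integral_le_lintegral_enorm _) 2).trans
      (h.trans ?_)
    gcongr
  have hm : Measurable fun a : Space d × ℝ => ‖W (a.2, a.1)‖ₑ ^ 2 := by fun_prop
  calc energy (timeInt W) t
      ≤ ∫⁻ x, ENNReal.ofReal T * ∫⁻ τ in Ioc 0 t, ‖W (τ, x)‖ₑ ^ 2 := lintegral_mono h1
    _ = ENNReal.ofReal T * ∫⁻ x, ∫⁻ τ in Ioc 0 t, ‖W (τ, x)‖ₑ ^ 2 :=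
        lintegral_const_mul _ hm.lintegral_prod_right'
    _ = _ := by
        rw [lintegral_lintegral_swap hm.aemeasurable]
        rfl

theorem memLp_spaceOp {k W : ℝ × Space d → ℝ} (hk : IsRapidKernel k) (hW : Measurable W)
    (h : MemLp W 2 (slabMeasure d T)) : MemLp (spaceOp k W) 2 (slabMeasure d T) := by
  rw [memLp_slab_iff (measurable_spaceOp hk.measurable hW)]
  rw [memLp_slab_iff hW] at h
  refine (lintegral_mono fun t => energy_spaceOp_le hk.measurable hW t).trans_lt ?_
  rw [lintegral_const_mul _ (measurable_energy hW)]
  exact ENNReal.mul_lt_top (ENNReal.pow_lt_top hk.integrable.2) h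

theorem memLp_timeInt {W : ℝ × Space d → ℝ} (hW : Measurable W)
    (h : MemLp W 2 (slabMeasure d T)) : MemLp (timeInt W) 2 (slabMeasure d T) := by
  rw [memLp_slab_iff (measurable_timeInt hW)]
  rw [memLp_slab_iff hW] at h
  have h1 : ∀ t ∈ Ioo 0 T, energy (timeInt W) t ≤
      ENNReal.ofReal T * ∫⁻ τ in Ioo 0 T, energy W τ := fun t ht => by
    refine (energy_timeInt_le hW ht.2.le).trans ?_
    exact mul_le_mul_right (lintegral_mono_set
      (show Ioc 0 t ⊆ Ioo 0 T from fun τ hτ => ⟨hτ.1, hτ.2.trans_lt ht.2⟩)) _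
  refine (setLIntegral_mono measurable_const h1).trans_lt ?_
  rw [lintegral_const]
  refine ENNReal.mul_lt_top (ENNReal.mul_lt_top ENNReal.ofReal_lt_top h) ?_
  simp

theorem measurePreserving_translate_slab (v : Space d) :
    MeasurePreserving (fun p : ℝ × Space d => (p.1, p.2 + v)) (slabMeasure d T)
      (slabMeasure d T) := by
  rw [slabMeasure_eq_prod]
  exact (MeasurePreserving.id _).prod (measurePreserving_add_right volume v)

/-- Fubini and the translation `x ↦ x + r z` move the average onto `ψ`, with the opposite shift. -/
theorem integral_spaceOp_mul {k W ψ : ℝ × Space d → ℝ} (hk : IsRapidKernel k)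
    (hW : Measurable W) (hW2 : MemLp W 2 (slabMeasure d T))
    (hψ : Measurable ψ) (hψ2 : MemLp ψ 2 (slabMeasure d T)) :
    ∫ p, spaceOp k W p * ψ p ∂(slabMeasure d T) = ∫ p, W p *
      (∫ q, k q * ψ (p.1, p.2 - q.1 • q.2) ∂(halfMeasure d)) ∂(slabMeasure d T) := by
  have hkm := hk.measurable
  set μ := slabMeasure d T with hμ
  have htr : ∀ (v : Space d) {w : ℝ × Space d → ℝ}, Measurable w → MemLp w 2 μ →
      MemLp (fun p : ℝ × Space d => w (p.1, p.2 + v)) 2 μ := fun v w _ hw2 =>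
    hw2.comp_measurePreserving (measurePreserving_translate_slab v)
  -- The sign `s = ±1` treats both sides at once. Integrability on the product follows from `2|ab| ≤
  -- a² + b²` and translation invariance, which bound the inner integral uniformly in `q`.
  have hint : ∀ {w φ : ℝ × Space d → ℝ} (s : ℝ), Measurable w → MemLp w 2 μ → Measurable φ →
      MemLp φ 2 μ → Integrable (fun a : (ℝ × Space d) × (ℝ × Space d) =>
        k a.2 * (w (a.1.1, a.1.2 + (s * a.2.1) • a.2.2) * φ a.1)) (μ.prod (halfMeasure d)) := by
    intro w φ s hw hw2 hφ hφ2
    have hI : ∀ v : Space d, Integrable (fun p : ℝ × Space d => w (p.1, p.2 + v) * φ p) μ :=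
      fun v => (htr v hw hw2).integrable_mul hφ2
    rw [integrable_prod_iff' (by fun_prop)]
    refine ⟨ae_of_all _ fun q => (hI ((s * q.1) • q.2)).const_mul (k q), ?_⟩
    refine (hk.integrable.abs.mul_const ((∫ p, w p ^ 2 ∂μ) + ∫ p, φ p ^ 2 ∂μ)).mono' ?_
      (ae_of_all _ fun q => ?_)
    · have hm : Measurable fun a : (ℝ × Space d) × (ℝ × Space d) =>
        ‖k a.1 * (w (a.2.1, a.2.2 + (s * a.1.1) • a.1.2) * φ a.2)‖ := by fun_prop
      exact (hm.stronglyMeasurable.integral_prod_right (ν := μ)).aestronglyMeasurable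
    · rw [Real.norm_of_nonneg (integral_nonneg fun p => norm_nonneg _)]
      simp only [norm_mul, integral_const_mul, Real.norm_eq_abs]
      refine mul_le_mul_of_nonneg_left ?_ (abs_nonneg _)
      have h1 := (htr ((s * q.1) • q.2) hw hw2).integrable_sq
      have h2 := hφ2.integrable_sq
      have h3 : ∫ p, w (p.1, p.2 + (s * q.1) • q.2) ^ 2 ∂μ = ∫ p, w p ^ 2 ∂μ := by
        have := (measurePreserving_translate_slab (T := T) ((s * q.1) • q.2)).map_eq
        conv_rhs => rw [hμ, ← this]
        rw [integral_map (by fun_prop) (by fun_prop)]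
      rw [← h3, ← integral_add h1 h2]
      refine integral_mono_of_nonneg (ae_of_all _ fun p => by positivity) (h1.add h2)
        (ae_of_all _ fun p => ?_)
      have h4 := two_mul_le_add_sq |w (p.1, p.2 + (s * q.1) • q.2)| |φ p|
      rw [sq_abs, sq_abs] at h4
      have h5 := mul_nonneg (abs_nonneg (w (p.1, p.2 + (s * q.1) • q.2))) (abs_nonneg (φ p))
      beta_reduce
      linarith
  have h1 := hint 1 hW hW2 hψ hψ2
  have h2 := hint (-1) hψ hψ2 hW hW2
  simp only [one_mul, neg_mul, neg_smul, ← sub_eq_add_neg] at h1 h2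
  have e1 : ∀ p, spaceOp k W p * ψ p
      = ∫ q, k q * (W (p.1, p.2 + q.1 • q.2) * ψ p) ∂(halfMeasure d) := fun p => by
    unfold spaceOp kernelAvg
    rw [← integral_mul_const]
    congr 1; ext q; ring
  have e2 : ∀ p, W p * (∫ q, k q * ψ (p.1, p.2 - q.1 • q.2) ∂(halfMeasure d))
      = ∫ q, k q * (ψ (p.1, p.2 - q.1 • q.2) * W p) ∂(halfMeasure d) := fun p => by
    rw [← integral_const_mul]
    congr 1; ext q; ring
  simp only [e1, e2]
  rw [integral_integral_swap (f := fun p q => k q * (W (p.1, p.2 + q.1 • q.2) * ψ p)) h1,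
    integral_integral_swap (f := fun p q => k q * (ψ (p.1, p.2 - q.1 • q.2) * W p)) h2]
  congr 1; ext q
  rw [integral_const_mul, integral_const_mul]
  congr 1
  have := (measurePreserving_translate_slab (T := T) (q.1 • q.2)).map_eq
  conv_rhs => rw [hμ, ← this]
  rw [integral_map (by fun_prop) (by fun_prop)]
  congr 1; ext p
  simp [mul_comm]

end

/-! ### Directional derivatives and the pairing with `(1 - Δ) χ`. -/

section

open Filter Topology

section DirectionalDerivatives

variable {d : ℕ}

theorem two_le_infty : (2 : WithTop ℕ∞) ≤ ∞ := WithTop.coe_le_coe.2 (le_top (a := (2 : ℕ∞)))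

/-- The derivative in the direction `v`. -/
noncomputable def dirDeriv {E : Type*} [NormedAddCommGroup E] [NormedSpace ℝ E] (v : E) (φ : E → ℝ)
    (p : E) : ℝ :=
  fderiv ℝ φ p v

theorem ContDiff.dirDeriv {E : Type*} [NormedAddCommGroup E] [NormedSpace ℝ E] {φ : E → ℝ}
    (hφ : ContDiff ℝ ∞ φ) (v : E) : ContDiff ℝ ∞ (dirDeriv v φ) :=
  (hφ.fderiv_right (by simp)).clm_apply contDiff_const

theorem HasCompactSupport.dirDeriv {E : Type*} [NormedAddCommGroup E] [NormedSpace ℝ E] {φ : E → ℝ}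
    (hφ : HasCompactSupport φ) (v : E) : HasCompactSupport (dirDeriv v φ) :=
  hφ.fderiv_apply ℝ v

theorem dirDeriv_comm {E : Type*} [NormedAddCommGroup E] [NormedSpace ℝ E] {φ : E → ℝ}
    (hφ : ContDiff ℝ ∞ φ) (v w : E) : dirDeriv v (dirDeriv w φ) = dirDeriv w (dirDeriv v φ) := by
  ext p
  have hs : IsSymmSndFDerivAt ℝ φ p :=
    hφ.contDiffAt.isSymmSndFDerivAt (by
      simpa [minSmoothness_of_isRCLikeNormedField] using two_le_infty)
  have hd : DifferentiableAt ℝ (fderiv ℝ φ) p :=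
    (hφ.fderiv_right (m := ∞) (by simp)).differentiable (by simp) p
  have e : ∀ v w : E, _root_.dirDeriv v (_root_.dirDeriv w φ) p = fderiv ℝ (fderiv ℝ φ) p v w := by
    intro v w
    have := (hd.hasFDerivAt.clm_apply (hasFDerivAt_const w p)).fderiv
    unfold _root_.dirDeriv
    rw [this]
    simp
  rw [e, e]
  exact hs v w

theorem dirDeriv_sum {E : Type*} [NormedAddCommGroup E] [NormedSpace ℝ E] {ι : Type*}
    (s : Finset ι) {φ : ι → E → ℝ} (hφ : ∀ i, ContDiff ℝ ∞ (φ i)) (v : E) (p : E) :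
    dirDeriv v (fun p => ∑ i ∈ s, φ i p) p = ∑ i ∈ s, dirDeriv v (φ i) p := by
  unfold dirDeriv
  rw [fderiv_fun_sum fun i _ => (hφ i).differentiable (by simp) p]
  simp

theorem dirDeriv_sub {E : Type*} [NormedAddCommGroup E] [NormedSpace ℝ E] {φ ψ : E → ℝ}
    (hφ : ContDiff ℝ ∞ φ) (hψ : ContDiff ℝ ∞ ψ) (v : E) (p : E) :
    dirDeriv v (fun p => φ p - ψ p) p = dirDeriv v φ p - dirDeriv v ψ p := by
  unfold dirDeriv
  rw [fderiv_fun_sub (hφ.differentiable (by simp) p) (hψ.differentiable (by simp) p)]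
  simp

/-- The direction of time. -/
def timeDir (d : ℕ) : ℝ × Space d := (1, 0)

/-- The `i`-th direction of space. -/
noncomputable def spaceDir {d : ℕ} (i : Fin d) : ℝ × Space d := (0, EuclideanSpace.single i 1)

theorem hasDerivAt_time {φ : ℝ × Space d → ℝ} (hφ : ContDiff ℝ ∞ φ) (p : ℝ × Space d) :
    HasDerivAt (fun s => φ (s, p.2)) (dirDeriv (timeDir d) φ p) p.1 := by
  have h1 : HasDerivAt (fun s : ℝ => (s, p.2)) (timeDir d) p.1 :=
    (hasDerivAt_id p.1).prodMk (hasDerivAt_const p.1 p.2)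
  exact ((hφ.differentiable (by simp) p).hasFDerivAt).comp_hasDerivAt p.1 h1

theorem timeDeriv_eq_dirDeriv {φ : ℝ × Space d → ℝ} (hφ : ContDiff ℝ ∞ φ) :
    timeDeriv φ = dirDeriv (timeDir d) φ := by
  ext p
  exact (hasDerivAt_time hφ p).deriv

theorem hasFDerivAt_slice {φ : ℝ × Space d → ℝ} (hφ : ContDiff ℝ ∞ φ) (t : ℝ) (x : Space d) :
    HasFDerivAt (fun y => φ (t, y)) (fderiv ℝ φ (t, x) ∘L ContinuousLinearMap.inr ℝ ℝ (Space d))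
      x :=
  ((hφ.differentiable (by simp) (t, x)).hasFDerivAt).comp x (hasFDerivAt_prodMk_right t x)

theorem partialDeriv_slice {φ : ℝ × Space d → ℝ} (hφ : ContDiff ℝ ∞ φ) (i : Fin d) (t : ℝ) :
    partialDeriv i (fun y => φ (t, y)) = fun y => dirDeriv (spaceDir i) φ (t, y) := by
  ext x
  unfold partialDeriv
  rw [(hasFDerivAt_slice hφ t x).fderiv]
  rfl

theorem contDiff_slice {φ : ℝ × Space d → ℝ} (hφ : ContDiff ℝ ∞ φ) (t : ℝ) :
    ContDiff ℝ ∞ fun y => φ (t, y) :=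
  hφ.comp (contDiff_const.prodMk contDiff_id)

theorem inner_spaceGradient {φ : ℝ × Space d → ℝ} (hφ : ContDiff ℝ ∞ φ) (v : Space d)
    (p : ℝ × Space d) :
    inner ℝ v (spaceGradient φ p) = ∑ i, v i * dirDeriv (spaceDir i) φ p := by
  unfold spaceGradient
  rw [real_inner_comm, inner_gradient_left, fderiv_apply_eq_sum_partialDeriv]
  simp only [partialDeriv_slice hφ]

theorem laplacian_eq_sumPartialSq {φ : Space d → ℝ} (hφ : ContDiff ℝ ∞ φ) (x : Space d) :
    Laplacian.laplacian φ x = sumPartialSq φ x := by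
  rw [InnerProductSpace.laplacian_eq_iteratedFDeriv_orthonormalBasis φ
    (EuclideanSpace.basisFun (Fin d) ℝ)]
  unfold sumPartialSq
  refine Finset.sum_congr rfl fun i _ => ?_
  have hd : DifferentiableAt ℝ (fderiv ℝ φ) x :=
    (hφ.fderiv_right (m := ∞) (by simp)).differentiable (by simp) x
  have := (hd.hasFDerivAt.clm_apply (hasFDerivAt_const (EuclideanSpace.single i (1 : ℝ)) x)).fderiv
  unfold partialDeriv
  rw [this, iteratedFDeriv_two_apply]
  simp

/-- The Laplacian in the space variable as a sum of iterated directional derivatives. -/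
noncomputable def lap (φ : ℝ × Space d → ℝ) (p : ℝ × Space d) : ℝ :=
  ∑ i : Fin d, dirDeriv (spaceDir i) (dirDeriv (spaceDir i) φ) p

theorem sumPartialSq_slice {φ : ℝ × Space d → ℝ} (hφ : ContDiff ℝ ∞ φ) (t : ℝ) (x : Space d) :
    sumPartialSq (fun y => φ (t, y)) x = lap φ (t, x) := by
  unfold sumPartialSq lap
  refine Finset.sum_congr rfl fun i _ => ?_
  rw [partialDeriv_slice hφ, partialDeriv_slice (hφ.dirDeriv _)]

theorem spaceLaplacian_eq_lap {φ : ℝ × Space d → ℝ} (hφ : ContDiff ℝ ∞ φ) :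
    spaceLaplacian φ = lap φ := by
  ext p
  unfold spaceLaplacian
  rw [laplacian_eq_sumPartialSq (contDiff_slice hφ p.1), sumPartialSq_slice hφ]

theorem contDiff_lap {φ : ℝ × Space d → ℝ} (hφ : ContDiff ℝ ∞ φ) : ContDiff ℝ ∞ (lap φ) :=
  ContDiff.sum fun _ _ => (hφ.dirDeriv _).dirDeriv _

theorem dirDeriv_lap {φ : ℝ × Space d → ℝ} (hφ : ContDiff ℝ ∞ φ) (v : ℝ × Space d) :
    dirDeriv v (lap φ) = lap (dirDeriv v φ) := by
  ext p
  unfold lap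
  rw [dirDeriv_sum _ (fun i => (hφ.dirDeriv _).dirDeriv _)]
  refine Finset.sum_congr rfl fun i _ => ?_
  rw [dirDeriv_comm (hφ.dirDeriv _), dirDeriv_comm hφ]

theorem HasCompactSupport.lap {φ : ℝ × Space d → ℝ} (hφ : HasCompactSupport φ) :
    HasCompactSupport (lap φ) := by
  have e : _root_.lap φ = ∑ i : Fin d,
      _root_.dirDeriv (spaceDir i) (_root_.dirDeriv (spaceDir i) φ) := by
    ext p
    simp [_root_.lap]
  rw [e]
  exact HasCompactSupport.finset_sum
    fun i _ => (hφ.dirDeriv (spaceDir i)).dirDeriv (spaceDir i)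

/-- The operator `1 - Δ` in the space variable. -/
noncomputable def oneSubLap (φ : ℝ × Space d → ℝ) (p : ℝ × Space d) : ℝ := φ p - lap φ p

theorem contDiff_oneSubLap {φ : ℝ × Space d → ℝ} (hφ : ContDiff ℝ ∞ φ) :
    ContDiff ℝ ∞ (oneSubLap φ) :=
  hφ.sub (contDiff_lap hφ)

theorem HasCompactSupport.oneSubLap {φ : ℝ × Space d → ℝ} (hφ : HasCompactSupport φ) :
    HasCompactSupport (oneSubLap φ) :=
  hφ.sub hφ.lap

theorem dirDeriv_oneSubLap {φ : ℝ × Space d → ℝ} (hφ : ContDiff ℝ ∞ φ) (v : ℝ × Space d) :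
    dirDeriv v (oneSubLap φ) = oneSubLap (dirDeriv v φ) := by
  ext p
  unfold oneSubLap
  rw [dirDeriv_sub hφ (contDiff_lap hφ), dirDeriv_lap hφ]

end DirectionalDerivatives

section TestFunctions

variable {d : ℕ} {T : ℝ}

theorem measurePreserving_reflect_halfMeasure (d : ℕ) :
    MeasurePreserving (fun q : ℝ × Space d => (q.1, -q.2)) (halfMeasure d) (halfMeasure d) := by
  unfold halfMeasure
  exact (MeasurePreserving.id _).prod (Measure.measurePreserving_neg volume)

/-- The reflection `z ↦ -z` turns the transposed average back into `kernelAvg`; the parity `ε` is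
`1` for `besselKernel` and `-1` for `besselGradKernel`. -/
theorem integral_kernel_mul_sub {k : ℝ × Space d → ℝ} {ε : ℝ}
    (hk : ∀ q : ℝ × Space d, k (q.1, -q.2) = ε * k q) (w : Space d → ℝ) (x : Space d) :
    ∫ q, k q * w (x - q.1 • q.2) ∂(halfMeasure d) = ε * kernelAvg k w x := by
  have he : MeasurableEmbedding fun q : ℝ × Space d => (q.1, -q.2) :=
    ((MeasurableEquiv.refl ℝ).prodCongr (MeasurableEquiv.neg (Space d))).measurableEmbedding
  rw [← (measurePreserving_reflect_halfMeasure d).integral_comp he]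
  unfold kernelAvg
  rw [← integral_const_mul]
  congr 1; ext q
  simp only [hk, smul_neg, sub_neg_eq_add]
  ring

theorem besselKernel_reflect (q : ℝ × Space d) : besselKernel (q.1, -q.2) = 1 * besselKernel q := by
  simp [besselKernel, gaussianWeight]

theorem besselGradKernel_reflect (i : Fin d) (q : ℝ × Space d) :
    besselGradKernel i (q.1, -q.2) = (-1) * besselGradKernel i q := by
  simp [besselGradKernel, gaussianWeight]

theorem exists_slice_bounds {χ : ℝ × Space d → ℝ} (hχ : ContDiff ℝ ∞ χ)
    (hc : HasCompactSupport χ) (t : ℝ) : ∃ C, (∀ x, |χ (t, x)| ≤ C) ∧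
      (∀ i x, |partialDeriv i (fun y => χ (t, y)) x| ≤ C) ∧
      (∀ i x, |partialDeriv i (partialDeriv i fun y => χ (t, y)) x| ≤ C) := by
  obtain ⟨C0, h0⟩ := hc.exists_bound_of_continuous hχ.continuous
  have h1 := fun i : Fin d => (hc.dirDeriv (spaceDir i)).exists_bound_of_continuous
    (hχ.dirDeriv (spaceDir i)).continuous
  have h2 := fun i : Fin d => ((hc.dirDeriv (spaceDir i)).dirDeriv
    (spaceDir i)).exists_bound_of_continuous ((hχ.dirDeriv (spaceDir i)).dirDeriv
    (spaceDir i)).continuous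
  choose C1 h1 using h1
  choose C2 h2 using h2
  have n1 : ∀ i, 0 ≤ C1 i := fun i => (norm_nonneg _).trans (h1 i 0)
  have n2 : ∀ i, 0 ≤ C2 i := fun i => (norm_nonneg _).trans (h2 i 0)
  have n0 : 0 ≤ C0 := (norm_nonneg _).trans (h0 0)
  have s1 : 0 ≤ ∑ i, C1 i := Finset.sum_nonneg fun i _ => n1 i
  have s2 : 0 ≤ ∑ i, C2 i := Finset.sum_nonneg fun i _ => n2 i
  refine ⟨C0 + ∑ i, C1 i + ∑ i, C2 i, fun x => ?_, fun i x => ?_, fun i x => ?_⟩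
  · have := h0 (t, x)
    rw [Real.norm_eq_abs] at this
    linarith
  · rw [partialDeriv_slice hχ]
    have := h1 i (t, x)
    rw [Real.norm_eq_abs] at this
    have := Finset.single_le_sum (fun i _ => n1 i) (Finset.mem_univ i)
    linarith
  · rw [partialDeriv_slice hχ, partialDeriv_slice (hχ.dirDeriv _)]
    have := h2 i (t, x)
    rw [Real.norm_eq_abs] at this
    have := Finset.single_le_sum (fun i _ => n2 i) (Finset.mem_univ i)
    linarith

theorem kernelAvg_besselKernel_oneSubLap {χ : ℝ × Space d → ℝ} (hχ : ContDiff ℝ ∞ χ)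
    (hc : HasCompactSupport χ) (t : ℝ) (x : Space d) :
    kernelAvg besselKernel (fun y => oneSubLap χ (t, y)) x = χ (t, x) := by
  obtain ⟨C, h0, h1, h2⟩ := exists_slice_bounds hχ hc t
  have := kernelAvg_besselKernel_sub ((contDiff_slice hχ t).of_le two_le_infty)
    h0 h1 h2 x
  simpa only [sumPartialSq_slice hχ, oneSubLap] using this

theorem integral_besselKernel_mul_sub {χ : ℝ × Space d → ℝ} (hχ : ContDiff ℝ ∞ χ)
    (hc : HasCompactSupport χ) (p : ℝ × Space d) :
    ∫ q, besselKernel q * oneSubLap χ (p.1, p.2 - q.1 • q.2) ∂(halfMeasure d) = χ p := by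
  rw [integral_kernel_mul_sub besselKernel_reflect (fun y => oneSubLap χ (p.1, y)), one_mul,
    kernelAvg_besselKernel_oneSubLap hχ hc]

theorem integral_besselGradKernel_mul_sub {χ : ℝ × Space d → ℝ} (hχ : ContDiff ℝ ∞ χ)
    (hc : HasCompactSupport χ) (i : Fin d) (p : ℝ × Space d) :
    ∫ q, besselGradKernel i q * oneSubLap χ (p.1, p.2 - q.1 • q.2) ∂(halfMeasure d)
      = -dirDeriv (spaceDir i) χ p := by
  have hψ := contDiff_oneSubLap hχ
  obtain ⟨C, h0, h1, -⟩ := exists_slice_bounds hψ hc.oneSubLap p.1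
  rw [integral_kernel_mul_sub (besselGradKernel_reflect i) (fun y => oneSubLap χ (p.1, y)),
    kernelAvg_besselGradKernel i ((contDiff_slice hψ p.1).of_le (by exact_mod_cast le_top)) h0
    (h1 i), partialDeriv_slice hψ, dirDeriv_oneSubLap hχ,
    kernelAvg_besselKernel_oneSubLap (hχ.dirDeriv _) (hc.dirDeriv _)]
  ring

/-- The right hand side of the mild equation with flux `g`. -/
noncomputable def mildOp (W : ℝ × Space d → ℝ) (g : Fin d → ℝ × Space d → ℝ) (p : ℝ × Space d) :
    ℝ :=
  -W p + spaceOp besselKernel W p - ∑ i, spaceOp (besselGradKernel i) (g i) p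

theorem measurable_mildOp {W : ℝ × Space d → ℝ} {g : Fin d → ℝ × Space d → ℝ} (hW : Measurable W)
    (hg : ∀ i, Measurable (g i)) : Measurable (mildOp W g) := by
  unfold mildOp
  have h1 := measurable_spaceOp isRapidKernel_besselKernel.measurable hW
  have h2 := fun i => measurable_spaceOp (isRapidKernel_besselGradKernel i).measurable (hg i)
  fun_prop

theorem memLp_mildOp {W : ℝ × Space d → ℝ} {g : Fin d → ℝ × Space d → ℝ} (hW : Measurable W)
    (hg : ∀ i, Measurable (g i)) (hW2 : MemLp W 2 (slabMeasure d T))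
    (hg2 : ∀ i, MemLp (g i) 2 (slabMeasure d T)) : MemLp (mildOp W g) 2 (slabMeasure d T) := by
  unfold mildOp
  refine (hW2.neg.add (memLp_spaceOp isRapidKernel_besselKernel hW hW2)).sub ?_
  exact memLp_finsetSum _ fun i _ => memLp_spaceOp (isRapidKernel_besselGradKernel i) (hg i) (hg2 i)

theorem memLp_of_hasCompactSupport {χ : ℝ × Space d → ℝ} (hχ : Continuous χ)
    (hc : HasCompactSupport χ) : MemLp χ 2 (slabMeasure d T) :=
  (hχ.memLp_of_hasCompactSupport hc (μ := volume)).restrict _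

/-- After transposition the kernels meet `(1 - Δ) χ` and return `χ` and `-∂ᵢ χ`; then `-(1 - Δ) χ +
χ = Δ χ`. No derivative falls on `W` or `g`, so this translates between mild and weak forms for mere
`L²` functions. -/
theorem integral_mildOp_mul {W : ℝ × Space d → ℝ} {g : Fin d → ℝ × Space d → ℝ} (hW : Measurable W)
    (hg : ∀ i, Measurable (g i)) (hW2 : MemLp W 2 (slabMeasure d T))
    (hg2 : ∀ i, MemLp (g i) 2 (slabMeasure d T)) {χ : ℝ × Space d → ℝ} (hχ : ContDiff ℝ ∞ χ)
    (hc : HasCompactSupport χ) :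
    ∫ p, mildOp W g p * oneSubLap χ p ∂(slabMeasure d T)
      = ∫ p, (∑ i, g i p * dirDeriv (spaceDir i) χ p + W p * lap χ p) ∂(slabMeasure d T) := by
  have hψ := (contDiff_oneSubLap hχ).continuous
  have hψ2 := memLp_of_hasCompactSupport (T := T) hψ hc.oneSubLap
  have hχ2 := memLp_of_hasCompactSupport (T := T) hχ.continuous hc
  have hl2 := memLp_of_hasCompactSupport (T := T) (contDiff_lap hχ).continuous hc.lap
  have hd2 := fun i : Fin d => memLp_of_hasCompactSupport (T := T)
    (hχ.dirDeriv (spaceDir i)).continuous (hc.dirDeriv (spaceDir i))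
  have hB := memLp_spaceOp (T := T) isRapidKernel_besselKernel hW hW2
  have hC := fun i => memLp_spaceOp (T := T) (isRapidKernel_besselGradKernel i) (hg i) (hg2 i)
  have i1 : Integrable (fun p => W p * oneSubLap χ p) (slabMeasure d T) := hW2.integrable_mul hψ2
  have i2 : Integrable (fun p => spaceOp besselKernel W p * oneSubLap χ p) (slabMeasure d T) :=
    hB.integrable_mul hψ2
  have i3 : ∀ i, Integrable (fun p => spaceOp (besselGradKernel i) (g i) p * oneSubLap χ p)
    (slabMeasure d T) := fun i => (hC i).integrable_mul hψ2
  have i4 : Integrable (fun p => W p * χ p) (slabMeasure d T) := hW2.integrable_mul hχ2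
  have i5 : Integrable (fun p => W p * lap χ p) (slabMeasure d T) := hW2.integrable_mul hl2
  have i6 : ∀ i, Integrable (fun p => g i p * dirDeriv (spaceDir i) χ p) (slabMeasure d T) :=
    fun i => (hg2 i).integrable_mul (hd2 i)
  have e1 := integral_spaceOp_mul isRapidKernel_besselKernel hW hW2 hψ.measurable hψ2
  simp only [integral_besselKernel_mul_sub hχ hc] at e1
  have e2 := fun i => integral_spaceOp_mul (isRapidKernel_besselGradKernel i) (hg i) (hg2 i)
    hψ.measurable hψ2
  simp only [integral_besselGradKernel_mul_sub hχ hc] at e2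
  have e3 : ∫ p, mildOp W g p * oneSubLap χ p ∂(slabMeasure d T)
      = -(∫ p, W p * oneSubLap χ p ∂(slabMeasure d T))
        + (∫ p, spaceOp besselKernel W p * oneSubLap χ p ∂(slabMeasure d T))
        - ∑ i, ∫ p, spaceOp (besselGradKernel i) (g i) p * oneSubLap χ p ∂(slabMeasure d T) := by
    have n1 : Integrable (fun p => -(W p * oneSubLap χ p)) (slabMeasure d T) := i1.neg
    have n2 : Integrable (fun p => -(W p * oneSubLap χ p)
        + spaceOp besselKernel W p * oneSubLap χ p) (slabMeasure d T) := n1.add i2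
    rw [← integral_neg, ← integral_add n1 i2, ← integral_finsetSum _ fun i _ => i3 i,
      ← integral_sub n2 (integrable_finsetSum _ fun i _ => i3 i)]
    congr 1; ext p
    simp only [mildOp, sub_mul, add_mul, neg_mul, Finset.sum_mul]
  rw [e3, e1, Finset.sum_congr rfl fun i _ => e2 i,
    integral_add (integrable_finsetSum _ fun i _ => i6 i) i5, integral_finsetSum _ fun i _ => i6 i]
  simp only [mul_neg, integral_neg, Finset.sum_neg_distrib, sub_neg_eq_add]
  have e4 : ∫ p, W p * oneSubLap χ p ∂(slabMeasure d T) = (∫ p, W p * χ p ∂(slabMeasure d T))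
      - ∫ p, W p * lap χ p ∂(slabMeasure d T) := by
    rw [← integral_sub i4 i5]
    simp only [oneSubLap, mul_sub]
  rw [e4]
  ring

end TestFunctions

end

/-! ### From mild to weak solutions; energy bounds and Gronwall's lemma. -/

section

open Filter Topology

variable {d : ℕ} {T : ℝ}

theorem measurePreserving_exchange {α β : Type*} [MeasurableSpace α] [MeasurableSpace β]
    (μ : Measure α) (ν : Measure β) [SFinite μ] [SFinite ν] :
    MeasurePreserving (fun a : (α × β) × α => ((a.2, a.1.2), a.1.1)) ((μ.prod ν).prod μ)
      ((μ.prod ν).prod μ) := by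
  have h1 := measurePreserving_prodAssoc μ ν μ
  have h2 : MeasurePreserving (Prod.map id Prod.swap) (μ.prod (ν.prod μ)) (μ.prod (μ.prod ν)) :=
    (MeasurePreserving.id μ).prod Measure.measurePreserving_swap
  have h3 : MeasurePreserving Prod.swap (μ.prod (μ.prod ν)) ((μ.prod ν).prod μ) :=
    Measure.measurePreserving_swap
  exact h3.comp (h2.comp h1)

/-- Fubini on the triangle `τ ≤ t`: the transpose of the primitive from `0` is the integral from `t`
up to `T`. -/
theorem integral_timeInt_mul {W ζ : ℝ × Space d → ℝ} (hW : Measurable W)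
    (hW2 : MemLp W 2 (slabMeasure d T)) (hζ : Measurable ζ) (hζ2 : MemLp ζ 2 (slabMeasure d T)) :
    ∫ p, timeInt W p * ζ p ∂(slabMeasure d T)
      = ∫ p, W p * (∫ τ in Ico p.1 T, ζ (τ, p.2)) ∂(slabMeasure d T) := by
  set ν : Measure ℝ := volume.restrict (Ioo 0 T) with hν
  have hslab : slabMeasure d T = ν.prod volume := slabMeasure_eq_prod d T
  have hmem : ∀ᵐ p ∂(slabMeasure d T), p.1 ∈ Ioo 0 T := by
    have : ∀ᵐ p ∂(slabMeasure d T), p ∈ Ioo 0 T ×ˢ (univ : Set (Space d)) :=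
      ae_restrict_mem (measurableSet_Ioo.prod MeasurableSet.univ)
    exact this.mono fun p hp => hp.1
  set H : (ℝ × Space d) × ℝ → ℝ := indicator {a | a.2 ≤ a.1.1} fun a => W (a.2, a.1.2) * ζ a.1
    with hH
  have hS : MeasurableSet {a : (ℝ × Space d) × ℝ | a.2 ≤ a.1.1} :=
    measurableSet_le measurable_snd measurable_fst.fst
  have hHm : Measurable H := Measurable.indicator (by fun_prop) hS
  have hex := measurePreserving_exchange ν (volume : Measure (Space d))
  rw [← hslab] at hex
  have hHi : Integrable H ((slabMeasure d T).prod ν) := by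
    have h1 : Integrable (fun a : (ℝ × Space d) × ℝ => ζ a.1 ^ 2) ((slabMeasure d T).prod ν) :=
      hζ2.integrable_sq.comp_fst ν
    have h2 : Integrable (fun a : (ℝ × Space d) × ℝ => W a.1 ^ 2) ((slabMeasure d T).prod ν) :=
      hW2.integrable_sq.comp_fst ν
    -- Exchanging the two time variables preserves the product measure, which yields square
    -- integrability of `W(τ, x)` in all of `(t, x, τ)`.
    have h3 : Integrable (fun a : (ℝ × Space d) × ℝ => W (a.2, a.1.2) ^ 2)
        ((slabMeasure d T).prod ν) := hex.integrable_comp_of_integrable h2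
    refine (h3.add h1).mono' hHm.aestronglyMeasurable (ae_of_all _ fun a => ?_)
    rw [hH]
    refine (norm_indicator_le_norm_self _ _).trans ?_
    rw [norm_mul, Real.norm_eq_abs, Real.norm_eq_abs]
    have h4 := two_mul_le_add_sq |W (a.2, a.1.2)| |ζ a.1|
    rw [sq_abs, sq_abs] at h4
    have h5 := mul_nonneg (abs_nonneg (W (a.2, a.1.2))) (abs_nonneg (ζ a.1))
    simp only [Pi.add_apply]
    linarith
  have e1 : ∫ p, timeInt W p * ζ p ∂(slabMeasure d T)
      = ∫ p, ∫ τ, H (p, τ) ∂ν ∂(slabMeasure d T) := by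
    refine integral_congr_ae (hmem.mono fun p hp => ?_)
    have : ∀ τ, H (p, τ) = indicator (Iic p.1) (fun τ => W (τ, p.2) * ζ p) τ := fun τ => rfl
    simp only [this]
    rw [integral_indicator measurableSet_Iic, hν, Measure.restrict_restrict measurableSet_Iic,
      integral_mul_const]
    unfold timeInt
    congr 3
    ext τ
    simp only [mem_Ioc, mem_inter_iff, mem_Iic, mem_Ioo]
    exact ⟨fun h => ⟨h.2, h.1, h.2.trans_lt hp.2⟩, fun h => ⟨h.2.1, h.1⟩⟩
  have e2 : ∫ p, W p * (∫ τ in Ico p.1 T, ζ (τ, p.2)) ∂(slabMeasure d T)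
      = ∫ p, ∫ τ, H ((τ, p.2), p.1) ∂ν ∂(slabMeasure d T) := by
    refine integral_congr_ae (hmem.mono fun p hp => ?_)
    have : ∀ τ, H ((τ, p.2), p.1) = indicator (Ici p.1) (fun τ => W p * ζ (τ, p.2)) τ :=
      fun τ => rfl
    simp only [this]
    rw [integral_indicator measurableSet_Ici, hν, Measure.restrict_restrict measurableSet_Ici,
      integral_const_mul]
    congr 3
    ext τ
    simp only [mem_Ico, mem_inter_iff, mem_Ici, mem_Ioo]
    exact ⟨fun h => ⟨h.1, hp.1.trans_le h.1, h.2⟩, fun h => ⟨h.1, h.2.2⟩⟩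
  rw [e1, e2, ← integral_prod _ hHi,
    ← integral_prod (fun a : (ℝ × Space d) × ℝ => H ((a.2, a.1.2), a.1.1))
      (hex.integrable_comp_of_integrable hHi)]
  have := hex.map_eq
  conv_lhs => rw [← this]
  rw [integral_map (by fun_prop) hHm.aestronglyMeasurable]

theorem oneSubLap_eq_zero_of_notMem {φ : ℝ × Space d → ℝ} {p : ℝ × Space d} (hp : p ∉ tsupport φ) :
    oneSubLap φ p = 0 := by
  have h : ∀ (v : ℝ × Space d) (χ : ℝ × Space d → ℝ), p ∉ tsupport χ → p ∉ tsupport (dirDeriv v χ) :=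
    fun v χ hχ hp => hχ (tsupport_fderiv_apply_subset ℝ v hp)
  unfold oneSubLap lap
  rw [image_eq_zero_of_notMem_tsupport hp, Finset.sum_eq_zero fun i _ =>
    image_eq_zero_of_notMem_tsupport (h _ _ (h _ _ hp)), sub_zero]

theorem integral_Ico_dirDeriv_time {ψ : ℝ × Space d → ℝ} (hψ : ContDiff ℝ ∞ ψ) {t : ℝ} (ht : t ≤ T)
    (x : Space d) (h0 : ψ (T, x) = 0) :
    ∫ τ in Ico t T, dirDeriv (timeDir d) ψ (τ, x) = -ψ (t, x) := by
  have hc : Continuous fun τ => dirDeriv (timeDir d) ψ (τ, x) := by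
    have := (hψ.dirDeriv (timeDir d)).continuous
    fun_prop
  rw [integral_Ico_eq_integral_Ioc, ← intervalIntegral.integral_of_le ht,
    intervalIntegral.integral_eq_sub_of_hasDerivAt (f := fun τ => ψ (τ, x))
      (fun τ _ => hasDerivAt_time hψ (τ, x)) (hc.intervalIntegrable _ _), h0, zero_sub]

theorem weak_integrand_eq {φ : ℝ × Space d → ℝ} (hφ : ContDiff ℝ ∞ φ) (u : ℝ × Space d → ℝ)
    (f : Space d × ℝ → Space d) (p : ℝ × Space d) :
    u p * timeDeriv φ p + inner ℝ (f (p.2, u p)) (spaceGradient φ p)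
        + u p * spaceLaplacian φ p - u p * timeDeriv (spaceLaplacian φ) p
      = u p * dirDeriv (timeDir d) (oneSubLap φ) p
        + (∑ i, f (p.2, u p) i * dirDeriv (spaceDir i) φ p + u p * lap φ p) := by
  rw [spaceLaplacian_eq_lap hφ, timeDeriv_eq_dirDeriv hφ, timeDeriv_eq_dirDeriv (contDiff_lap hφ),
    inner_spaceGradient hφ]
  have : dirDeriv (timeDir d) (oneSubLap φ) p
      = dirDeriv (timeDir d) φ p - dirDeriv (timeDir d) (lap φ) p :=
    dirDeriv_sub hφ (contDiff_lap hφ) _ _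
  rw [this]
  ring

/-- The time derivative in the weak form falls on `ψ = (1 - Δ) φ`. Integration by parts in time
leaves the datum `-∫ u₀ ψ(0, ·)`, nothing at `T` since `ψ(T, ·) = 0`, and `-∫ mildOp · ψ`, which
`integral_mildOp_mul` cancels against the flux and Laplacian terms. -/
theorem weak_eq_of_mild {f : Space d × ℝ → Space d} {u₀ : Space d → ℝ} (hT : 0 < T)
    (hu₀ : Continuous u₀) {u : ℝ × Space d → ℝ} (hu : Measurable u)
    (hu2 : MemLp u 2 (slabMeasure d T)) {g : Fin d → ℝ × Space d → ℝ} (hg : ∀ i, Measurable (g i))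
    (hg2 : ∀ i, MemLp (g i) 2 (slabMeasure d T)) (hgf : ∀ i p, g i p = f (p.2, u p) i)
    (hmild : ∀ᵐ p ∂(slabMeasure d T), u p = u₀ p.2 + timeInt (mildOp u g) p)
    {φ : ℝ × Space d → ℝ} (hφ : IsTestFunction T φ) :
    (∫ p, (u p * timeDeriv φ p + inner ℝ (f (p.2, u p)) (spaceGradient φ p)
        + u p * spaceLaplacian φ p - u p * timeDeriv (spaceLaplacian φ) p) ∂(slabMeasure d T))
      + ∫ x : Space d, u₀ x * (φ (0, x) - spaceLaplacian φ (0, x)) = 0 := by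
  have hs := hφ.smooth
  have hc := hφ.compactSupport
  set ψ := oneSubLap φ with hψdef
  have hψ : ContDiff ℝ ∞ ψ := contDiff_oneSubLap hs
  have hψc : HasCompactSupport ψ := hc.oneSubLap
  set ψt := dirDeriv (timeDir d) ψ with hψt
  have hψtc : Continuous ψt := (hψ.dirDeriv _).continuous
  have hψts : HasCompactSupport ψt := hψc.dirDeriv _
  have hψT : ∀ x, ψ (T, x) = 0 := fun x => oneSubLap_eq_zero_of_notMem fun h =>
    lt_irrefl T (hφ.support_subset h).1
  have hψt2 := memLp_of_hasCompactSupport (T := T) hψtc hψts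
  have hn := measurable_mildOp hu hg
  have hn2 := memLp_mildOp hu hg hu2 hg2
  have hmem : ∀ᵐ p ∂(slabMeasure d T), p.1 ∈ Ioo 0 T := by
    have : ∀ᵐ p ∂(slabMeasure d T), p ∈ Ioo 0 T ×ˢ (univ : Set (Space d)) :=
      ae_restrict_mem (measurableSet_Ioo.prod MeasurableSet.univ)
    exact this.mono fun p hp => hp.1
  have i1 : Integrable (fun p => u p * ψt p) (slabMeasure d T) := hu2.integrable_mul hψt2
  have i2 : Integrable (fun p => ∑ i, g i p * dirDeriv (spaceDir i) φ p + u p * lap φ p)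
      (slabMeasure d T) := by
    refine (integrable_finsetSum _ fun i _ => ?_).add ?_
    · exact (hg2 i).integrable_mul
        (memLp_of_hasCompactSupport (hs.dirDeriv _).continuous (hc.dirDeriv _))
    · exact hu2.integrable_mul (memLp_of_hasCompactSupport (contDiff_lap hs).continuous hc.lap)
  have i3 : Integrable (fun p : ℝ × Space d => u₀ p.2 * ψt p) (slabMeasure d T) :=
    ((by fun_prop : Continuous fun p : ℝ × Space d => u₀ p.2 * ψt p).integrable_of_hasCompactSupport
      (hψts.mul_left (f := fun p : ℝ × Space d => u₀ p.2))).restrict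
  have i4 : Integrable (fun p => timeInt (mildOp u g) p * ψt p) (slabMeasure d T) :=
    (memLp_timeInt hn hn2).integrable_mul hψt2
  have e0 : ∀ p, (u p * timeDeriv φ p + inner ℝ (f (p.2, u p)) (spaceGradient φ p)
        + u p * spaceLaplacian φ p - u p * timeDeriv (spaceLaplacian φ) p)
      = u p * ψt p + (∑ i, g i p * dirDeriv (spaceDir i) φ p + u p * lap φ p) := fun p => by
    simp only [hgf]
    exact weak_integrand_eq hs u f p
  have e1 : ∫ p, u p * ψt p ∂(slabMeasure d T) = (∫ p, u₀ p.2 * ψt p ∂(slabMeasure d T))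
      + ∫ p, timeInt (mildOp u g) p * ψt p ∂(slabMeasure d T) := by
    rw [← integral_add i3 i4]
    refine integral_congr_ae (hmild.mono fun p hp => ?_)
    beta_reduce
    rw [hp, add_mul]
  have e2 : ∫ p, timeInt (mildOp u g) p * ψt p ∂(slabMeasure d T)
      = -∫ p, mildOp u g p * ψ p ∂(slabMeasure d T) := by
    rw [integral_timeInt_mul hn hn2 hψtc.measurable hψt2, ← integral_neg]
    refine integral_congr_ae (hmem.mono fun p hp => ?_)
    beta_reduce
    rw [integral_Ico_dirDeriv_time hψ hp.2.le p.2 (hψT p.2)]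
    ring
  have e3 : ∫ p, u₀ p.2 * ψt p ∂(slabMeasure d T) = -∫ x : Space d, u₀ x * ψ (0, x) := by
    rw [slabMeasure_eq_prod] at i3 ⊢
    rw [integral_prod_symm _ i3, ← integral_neg]
    refine integral_congr_ae (ae_of_all _ fun x => ?_)
    dsimp only
    rw [integral_const_mul, ← integral_Ico_eq_integral_Ioo,
      integral_Ico_dirDeriv_time hψ hT.le x (hψT x)]
    ring
  have e4 : ∀ x, φ (0, x) - spaceLaplacian φ (0, x) = ψ (0, x) := fun x => by
    rw [spaceLaplacian_eq_lap hs]; rfl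
  simp only [e0, e4]
  rw [integral_add i1 i2, e1, e2, e3, ← integral_mildOp_mul hu hg hu2 hg2 hs hc]
  ring

theorem energy_add_le {V W : ℝ × Space d → ℝ} (hV : Measurable V) (t : ℝ) :
    energy (fun p => V p + W p) t ≤ 2 * (energy V t + energy W t) := by
  have hsq : ∀ a b : ℝ, ‖a + b‖ₑ ^ 2 ≤ 2 * (‖a‖ₑ ^ 2 + ‖b‖ₑ ^ 2) := fun a b => by
    refine (pow_le_pow_left₀ zero_le (enorm_add_le a b) 2).trans ?_
    have h : ∀ x y : NNReal, (x + y) ^ 2 ≤ 2 * (x ^ 2 + y ^ 2) := fun x y => add_sq_le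
    have := h ‖a‖₊ ‖b‖₊
    simp only [enorm_eq_nnnorm]
    exact_mod_cast this
  unfold energy
  have hm : Measurable fun x => ‖V (t, x)‖ₑ ^ 2 := by fun_prop
  rw [← lintegral_add_left hm, ← lintegral_const_mul' _ _ (by simp)]
  exact lintegral_mono fun x => hsq _ _

theorem exists_energy_sum_le {ι : Type*} (s : Finset ι) : ∃ M : ENNReal, M ≠ ⊤ ∧
    ∀ (W : ι → ℝ × Space d → ℝ), (∀ i, Measurable (W i)) → ∀ (t : ℝ) (e : ENNReal),
    (∀ i, energy (W i) t ≤ e) → energy (fun p => ∑ i ∈ s, W i p) t ≤ M * e := by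
  classical
  induction s using Finset.induction_on with
  | empty => exact ⟨0, by simp, fun W _ t e _ => by simp [energy]⟩
  | insert a s ha ih =>
    obtain ⟨M, hM, h⟩ := ih
    refine ⟨2 * (1 + M), ENNReal.mul_ne_top (by simp) (by simp [hM]), fun W hW t e he => ?_⟩
    simp only [Finset.sum_insert ha]
    refine (energy_add_le (hW a) t).trans ?_
    rw [mul_assoc, add_mul, one_mul]
    gcongr
    · exact he a
    · exact h W hW t e he

theorem exists_energy_mildOp_le (d : ℕ) (L : ENNReal) (hL : L ≠ ⊤) : ∃ M : ENNReal, M ≠ ⊤ ∧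
    ∀ (W : ℝ × Space d → ℝ) (g : Fin d → ℝ × Space d → ℝ), Measurable W → (∀ i, Measurable (g i)) →
    (∀ i p, ‖g i p‖ₑ ≤ L * ‖W p‖ₑ) → ∀ t, energy (mildOp W g) t ≤ M * energy W t := by
  obtain ⟨M, hM, hsum⟩ := exists_energy_sum_le (d := d) (Finset.univ : Finset (Fin d))
  set K := ∫⁻ q, ‖besselKernel q‖ₑ ∂(halfMeasure d) with hK
  set K' := ∑ i : Fin d, (∫⁻ q, ‖besselGradKernel i q‖ₑ ∂(halfMeasure d)) ^ 2 with hK'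
  have hKt : K ≠ ⊤ := isRapidKernel_besselKernel.integrable.2.ne
  have hK't : K' ≠ ⊤ := ENNReal.sum_ne_top.2 fun i _ =>
    ENNReal.pow_ne_top (isRapidKernel_besselGradKernel i).integrable.2.ne
  refine ⟨2 * (2 * (1 + K ^ 2) + M * (K' * L ^ 2)), ?_, fun W g hW hg hgW t => ?_⟩
  · refine ENNReal.mul_ne_top (by simp) (ENNReal.add_ne_top.2 ⟨ENNReal.mul_ne_top (by simp)
      (ENNReal.add_ne_top.2 ⟨by simp, ENNReal.pow_ne_top hKt⟩), ENNReal.mul_ne_top hM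
      (ENNReal.mul_ne_top hK't (ENNReal.pow_ne_top hL))⟩)
  have hgE : ∀ i, energy (g i) t ≤ L ^ 2 * energy W t := fun i => by
    unfold energy
    rw [← lintegral_const_mul' _ _ (ENNReal.pow_ne_top hL)]
    refine lintegral_mono fun x => ?_
    rw [← mul_pow]
    exact pow_le_pow_left₀ zero_le (hgW i _) 2
  have hB := measurable_spaceOp isRapidKernel_besselKernel.measurable hW
  have hC := fun i => measurable_spaceOp (isRapidKernel_besselGradKernel i).measurable (hg i)
  have h1 : energy (fun p => ∑ i, -spaceOp (besselGradKernel i) (g i) p) t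
      ≤ M * (K' * (L ^ 2 * energy W t)) := by
    refine hsum (fun i p => -spaceOp (besselGradKernel i) (g i) p) (fun i => (hC i).neg) t _ fun i => ?_
    have e : energy (fun p => -spaceOp (besselGradKernel i) (g i) p) t
        = energy (spaceOp (besselGradKernel i) (g i)) t := by simp [energy]
    rw [e]
    refine (energy_spaceOp_le (isRapidKernel_besselGradKernel i).measurable (hg i) t).trans ?_
    refine mul_le_mul' ?_ (hgE i)
    exact Finset.single_le_sum (f := fun i : Fin d =>
      (∫⁻ q, ‖besselGradKernel i q‖ₑ ∂(halfMeasure d)) ^ 2) (fun _ _ => zero_le) (Finset.mem_univ i)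
  have h2 : energy (fun p => -W p + spaceOp besselKernel W p) t
      ≤ 2 * (energy W t + K ^ 2 * energy W t) := by
    refine (energy_add_le (V := fun p => -W p) hW.neg t).trans ?_
    have e : energy (fun p => -W p) t = energy W t := by simp [energy]
    rw [e]
    gcongr
    exact energy_spaceOp_le isRapidKernel_besselKernel.measurable hW t
  have e : mildOp W g = fun p => (-W p + spaceOp besselKernel W p)
      + ∑ i, -spaceOp (besselGradKernel i) (g i) p := by
    ext p
    simp [mildOp, sub_eq_add_neg]
  rw [e]
  refine (energy_add_le (V := fun p => -W p + spaceOp besselKernel W p) (hW.neg.add hB) t).trans ?_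
  calc _ ≤ 2 * (2 * (energy W t + K ^ 2 * energy W t) + M * (K' * (L ^ 2 * energy W t))) := by
        gcongr
    _ = _ := by ring

/-- Gronwall's lemma for a merely integrable function. Let `S` be the integral of `exp (-l t) a(t)`
over `(0, T)`. Tonelli gives `S ≤ (M / l) S`, and `l = 2M + 1` makes the factor at most `1 / 2`; as
`S` is finite, it vanishes. -/
theorem lintegral_eq_zero_of_le_primitive {a : ℝ → ENNReal} (ha : Measurable a)
    (hfin : ∫⁻ t in Ioo 0 T, a t ≠ ⊤) {M : ENNReal} (hM : M ≠ ⊤)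
    (h : ∀ᵐ t ∂(volume.restrict (Ioo 0 T)), a t ≤ M * ∫⁻ τ in Ioc 0 t, a τ) :
    ∫⁻ t in Ioo 0 T, a t = 0 := by
  set l : ℝ := 2 * M.toReal + 1 with hl
  have hl0 : 0 < l := by have := ENNReal.toReal_nonneg (a := M); linarith
  set ν : Measure ℝ := volume.restrict (Ioo 0 T) with hν
  set E : ℝ → ENNReal := fun t => ENNReal.ofReal (Real.exp (-(l * t))) with hE
  have hEm : Measurable E := by fun_prop
  have hEa : Measurable fun t => E t * a t := hEm.mul ha
  set S := ∫⁻ t, E t * a t ∂ν with hS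
  have hSfin : S ≠ ⊤ := by
    refine ne_top_of_le_ne_top hfin (setLIntegral_mono ha fun t ht => ?_)
    refine mul_le_of_le_one_left zero_le ?_
    rw [hE]
    beta_reduce
    rw [ENNReal.ofReal_le_one, Real.exp_le_one_iff]
    have := mul_pos hl0 ht.1
    linarith
  have htail : ∀ τ : ℝ, ∫⁻ t in Ici τ, E t = ENNReal.ofReal (l⁻¹) * E τ := fun τ => by
    have hint : IntegrableOn (fun t => Real.exp (-l * t)) (Ioi τ) :=
      integrableOn_exp_mul_Ioi (by linarith) τ
    rw [setLIntegral_congr Ioi_ae_eq_Ici.symm, hE]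
    have hint' : IntegrableOn (fun t => Real.exp (-(l * t))) (Ioi τ) := by
      simpa only [neg_mul] using hint
    rw [← ofReal_integral_eq_lintegral_ofReal hint' (ae_of_all _ fun t => (Real.exp_pos _).le)]
    have := integral_exp_mul_Ioi (a := -l) (by linarith) τ
    simp only [neg_mul] at this
    rw [this, ← ENNReal.ofReal_mul (by positivity)]
    congr 1
    field_simp
  have key : S ≤ M * ENNReal.ofReal (l⁻¹) * S := by
    have hmS : MeasurableSet {b : ℝ × ℝ | b.2 ≤ b.1} := measurableSet_le measurable_snd measurable_fst
    set H : ℝ × ℝ → ENNReal := indicator {b | b.2 ≤ b.1} fun b => E b.1 * a b.2 with hH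
    have hHm : Measurable H := Measurable.indicator (by fun_prop) hmS
    have h1 : S ≤ ∫⁻ t, M * ∫⁻ τ, H (t, τ) ∂ν ∂ν := by
      refine lintegral_mono_ae ?_
      filter_upwards [h, ae_restrict_mem measurableSet_Ioo] with t ht htm
      have e1 : ∫⁻ τ, H (t, τ) ∂ν = E t * ∫⁻ τ in Ioc 0 t, a τ := by
        have : ∀ τ, H (t, τ) = indicator (Iic t) (fun τ => E t * a τ) τ := fun τ => rfl
        simp only [this]
        rw [lintegral_indicator measurableSet_Iic, hν, Measure.restrict_restrict measurableSet_Iic,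
          lintegral_const_mul _ ha]
        congr 3
        ext τ
        simp only [mem_Ioc, mem_inter_iff, mem_Iic, mem_Ioo]
        exact ⟨fun h => ⟨h.2.1, h.1⟩, fun h => ⟨h.2, h.1, h.2.trans_lt htm.2⟩⟩
      rw [e1]
      calc E t * a t ≤ E t * (M * ∫⁻ τ in Ioc 0 t, a τ) := by gcongr
        _ = _ := by ring
    refine h1.trans ?_
    rw [lintegral_const_mul _ hHm.lintegral_prod_right', mul_assoc]
    gcongr
    rw [lintegral_lintegral_swap (f := fun t τ => H (t, τ)) hHm.aemeasurable, hS,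
      ← lintegral_const_mul _ hEa]
    refine lintegral_mono fun τ => ?_
    have : ∀ t, H (t, τ) = indicator (Ici τ) (fun t => E t * a τ) t := fun t => rfl
    simp only [this]
    rw [lintegral_indicator measurableSet_Ici, lintegral_mul_const _ hEm, ← mul_assoc, ← htail]
    gcongr
    exact Measure.restrict_le_self
  have hlt : M * ENNReal.ofReal (l⁻¹) ≤ ENNReal.ofReal (1 / 2) := by
    rw [← ENNReal.ofReal_toReal hM, ← ENNReal.ofReal_mul ENNReal.toReal_nonneg]
    refine ENNReal.ofReal_le_ofReal ?_
    rw [← div_eq_mul_inv, div_le_div_iff₀ hl0 two_pos]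
    linarith
  have hS0 : S = 0 := by
    by_contra hne
    have h2 : S ≤ ENNReal.ofReal (1 / 2) * S := key.trans (by gcongr)
    have h3 := ENNReal.toReal_mono (ENNReal.mul_ne_top ENNReal.ofReal_ne_top hSfin) h2
    rw [ENNReal.toReal_mul, ENNReal.toReal_ofReal (by norm_num)] at h3
    have := ENNReal.toReal_pos hne hSfin
    linarith
  rw [hS, lintegral_eq_zero_iff hEa] at hS0
  rw [lintegral_eq_zero_iff ha]
  refine hS0.mono fun t ht => ?_
  have hpos : E t ≠ 0 := by simp [hE, Real.exp_pos]
  simpa [hpos] using ht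

end

/-! ### From weak to mild solutions; injectivity of `1 - Δ`. -/

section

open Filter Topology
open scoped Convolution

variable {d : ℕ} {T : ℝ}

theorem dirDeriv_convolution {E : Type*} [NormedAddCommGroup E] [NormedSpace ℝ E]
    [MeasurableSpace E] [BorelSpace E] {μ : Measure E} [SFinite μ] [μ.IsAddLeftInvariant] {q θ : E → ℝ}
    (hq : LocallyIntegrable q μ) (hθ : ContDiff ℝ ∞ θ) (hc : HasCompactSupport θ) (v : E) :
    dirDeriv v (q ⋆[ContinuousLinearMap.mul ℝ ℝ, μ] θ)
      = q ⋆[ContinuousLinearMap.mul ℝ ℝ, μ] (dirDeriv v θ) := by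
  ext z
  unfold dirDeriv
  rw [(hc.hasFDerivAt_convolution_right (ContinuousLinearMap.mul ℝ ℝ) hq
    (hθ.of_le (by simp)) z).fderiv]
  exact convolution_precompR_apply (ContinuousLinearMap.mul ℝ ℝ) hq (hc.fderiv ℝ)
    (hθ.continuous_fderiv (by simp)) z v

instance isAddHaarMeasure_volume_prod :
    (volume : Measure (ℝ × Space d)).IsAddHaarMeasure := by
  rw [Measure.volume_eq_prod]
  infer_instance

/-- A crude form of Cauchy–Schwarz; only boundedness uniform in `z` is needed. -/
theorem abs_convolution_le {q θ : ℝ × Space d → ℝ} (hq : MemLp q 2 volume) (hθ : Continuous θ)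
    (hc : HasCompactSupport θ) (z : ℝ × Space d) :
    |(q ⋆[ContinuousLinearMap.mul ℝ ℝ, volume] θ) z| ≤ (∫ p, q p ^ 2) + ∫ p, θ p ^ 2 := by
  have h1 := hq.integrable_sq
  have h2 : Integrable (fun p => θ p ^ 2) volume :=
    (hθ.memLp_of_hasCompactSupport hc (p := 2)).integrable_sq
  have h3 : Integrable (fun p => θ (z - p) ^ 2) volume := h2.comp_sub_left z
  have h4 : ∫ p, θ (z - p) ^ 2 = ∫ p, θ p ^ 2 :=
    integral_sub_left_eq_self (fun p => θ p ^ 2) volume z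
  rw [← h4, ← integral_add h1 h3, convolution_def, ← Real.norm_eq_abs]
  refine norm_integral_le_of_norm_le (h1.add h3) (ae_of_all _ fun p => ?_)
  rw [ContinuousLinearMap.mul_apply', norm_mul, Real.norm_eq_abs, Real.norm_eq_abs]
  have h5 := two_mul_le_add_sq |q p| |θ (z - p)|
  rw [sq_abs, sq_abs] at h5
  have h6 := mul_nonneg (abs_nonneg (q p)) (abs_nonneg (θ (z - p)))
  linarith

theorem dirDeriv_comp_sub_left {E : Type*} [NormedAddCommGroup E] [NormedSpace ℝ E] (φ : E → ℝ)
    (v a : E) : dirDeriv v (fun p => φ (a - p)) = fun p => -dirDeriv v φ (a - p) := by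
  ext p
  unfold dirDeriv
  have h := fderiv_comp_smul (𝕜 := ℝ) (f := fun p => φ (a + p)) (x := p) (-1 : ℝ)
  simp only [neg_smul, one_smul, ← sub_eq_add_neg] at h
  rw [h, fderiv_comp_add_left, ← sub_eq_add_neg]
  rfl

theorem dirDeriv_neg {E : Type*} [NormedAddCommGroup E] [NormedSpace ℝ E] (φ : E → ℝ)
    (v : E) : dirDeriv v (fun p => -φ p) = fun p => -dirDeriv v φ p := by
  ext p
  unfold dirDeriv
  rw [fderiv_fun_neg]
  simp

theorem oneSubLap_comp_sub_left (φ : ℝ × Space d → ℝ) (a : ℝ × Space d) :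
    oneSubLap (fun p => φ (a - p)) = fun p => oneSubLap φ (a - p) := by
  ext p
  unfold oneSubLap lap
  congr 1
  refine Finset.sum_congr rfl fun i _ => ?_
  rw [dirDeriv_comp_sub_left, dirDeriv_neg, dirDeriv_comp_sub_left]
  simp

/-- For a test function `χ`, convolve the extension by zero `Q` of `q` with the reflection of `χ`.
On the slice `t = 0` the smooth convolution `Φ` satisfies `Φ - Δ Φ = 0`, because spatial translates
of `χ` remain admissible. Since `Φ` and its derivatives are bounded, Bessel inversion gives `Φ = 0`
at the origin, where its value is `∫ Q χ`. -/
theorem ae_eq_zero_of_integral_mul_oneSubLap {q : ℝ × Space d → ℝ}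
    (hq2 : MemLp q 2 (slabMeasure d T))
    (h : ∀ χ : ℝ × Space d → ℝ, ContDiff ℝ ∞ χ → HasCompactSupport χ → tsupport χ ⊆ Ioo 0 T ×ˢ univ →
      ∫ p, q p * oneSubLap χ p ∂(slabMeasure d T) = 0) :
    ∀ᵐ p ∂(slabMeasure d T), q p = 0 := by
  set U : Set (ℝ × Space d) := Ioo 0 T ×ˢ univ with hU
  have hUm : MeasurableSet U := measurableSet_Ioo.prod MeasurableSet.univ
  have hUo : IsOpen U := isOpen_Ioo.prod isOpen_univ
  set Q : ℝ × Space d → ℝ := indicator U q with hQ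
  have hQ2 : MemLp Q 2 volume := (memLp_indicator_iff_restrict hUm).2 hq2
  have hQl : LocallyIntegrable Q volume := hQ2.locallyIntegrable (by norm_num)
  have hQi : ∀ θ : ℝ × Space d → ℝ, ∫ p, Q p * θ p = ∫ p, q p * θ p ∂(slabMeasure d T) := by
    intro θ
    unfold slabMeasure
    rw [← integral_indicator hUm]
    congr 1; ext p
    rw [hQ, indicator_mul_left]
  have main : ∀ᵐ p ∂(volume : Measure (ℝ × Space d)), p ∈ U → Q p = 0 := by
    refine hUo.ae_eq_zero_of_integral_contDiff_smul_eq_zero (hQl.locallyIntegrableOn U)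
      fun χ hχ hc hs => ?_
    set θ : ℝ × Space d → ℝ := fun p => χ (0 - p) with hθ
    have hθs : ContDiff ℝ ∞ θ := hχ.comp (contDiff_const.sub contDiff_id)
    have hθc : HasCompactSupport θ := hc.comp_homeomorph (Homeomorph.subLeft 0)
    set Φ : ℝ × Space d → ℝ := Q ⋆[ContinuousLinearMap.mul ℝ ℝ, volume] θ with hΦ
    have hΦs : ContDiff ℝ ∞ Φ := hθc.contDiff_convolution_right _ hQl hθs
    have hd1 : ∀ i : Fin d, dirDeriv (spaceDir i) Φ
        = Q ⋆[ContinuousLinearMap.mul ℝ ℝ, volume] (dirDeriv (spaceDir i) θ) := fun i =>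
      dirDeriv_convolution hQl hθs hθc _
    have hd2 : ∀ i : Fin d, dirDeriv (spaceDir i) (dirDeriv (spaceDir i) Φ)
        = Q ⋆[ContinuousLinearMap.mul ℝ ℝ, volume]
          (dirDeriv (spaceDir i) (dirDeriv (spaceDir i) θ)) := fun i => by
      rw [hd1, dirDeriv_convolution hQl (hθs.dirDeriv _) (hθc.dirDeriv _)]
    have hconv : ∀ {ξ : ℝ × Space d → ℝ}, Continuous ξ → HasCompactSupport ξ → ∀ z,
        Integrable (fun p => Q p * ξ (z - p)) volume := fun {ξ} hξ hξc z =>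
      (hξc.convolutionExists_right (ContinuousLinearMap.mul ℝ ℝ) hQl hξ z :)
    have hzero : ∀ y : Space d, oneSubLap Φ (0, y) = 0 := by
      intro y
      have e1 : oneSubLap Φ (0, y) = ∫ p, Q p * oneSubLap θ ((0, y) - p) := by
        unfold oneSubLap lap
        simp only [hd2, mul_sub, Finset.mul_sum]
        rw [integral_sub (hconv hθs.continuous hθc _) (integrable_finsetSum _ fun i _ =>
          hconv ((hθs.dirDeriv _).dirDeriv _).continuous ((hθc.dirDeriv _).dirDeriv _) _),
          integral_finsetSum _ fun i _ =>
          hconv ((hθs.dirDeriv _).dirDeriv _).continuous ((hθc.dirDeriv _).dirDeriv _) _]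
        rfl
      rw [e1, hQi]
      have e2 : (fun p => oneSubLap θ ((0, y) - p)) = oneSubLap fun p => θ ((0, y) - p) :=
        (oneSubLap_comp_sub_left θ (0, y)).symm
      have e3 := congrFun e2
      beta_reduce at e3
      simp only [e3]
      refine h _ (hθs.comp (contDiff_const.sub contDiff_id))
        (hθc.comp_homeomorph (Homeomorph.subLeft (0, y))) ?_
      have e4 : (fun p => θ ((0, y) - p)) = χ ∘ Homeomorph.subRight ((0 : ℝ), y) := by
        ext p
        simp [hθ]
      rw [e4, tsupport_comp_eq_preimage]
      intro p hp
      have := hs hp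
      simpa [hU] using this
    obtain ⟨C, h0, h1, h2⟩ : ∃ C, (∀ x, |Φ (0, x)| ≤ C) ∧
        (∀ i x, |partialDeriv i (fun y => Φ (0, y)) x| ≤ C) ∧
        (∀ i x, |partialDeriv i (partialDeriv i fun y => Φ (0, y)) x| ≤ C) := by
      have n1 : ∀ i : Fin d, 0 ≤ ∫ p, dirDeriv (spaceDir i) θ p ^ 2 := fun i =>
        integral_nonneg fun p => sq_nonneg _
      have n2 : ∀ i : Fin d, 0 ≤ ∫ p, dirDeriv (spaceDir i) (dirDeriv (spaceDir i) θ) p ^ 2 :=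
        fun i => integral_nonneg fun p => sq_nonneg _
      have n0 : 0 ≤ ∫ p, θ p ^ 2 := integral_nonneg fun p => sq_nonneg _
      have s1 := Finset.sum_nonneg fun i (_ : i ∈ Finset.univ) => n1 i
      have s2 := Finset.sum_nonneg fun i (_ : i ∈ Finset.univ) => n2 i
      refine ⟨(∫ p, Q p ^ 2) + ((∫ p, θ p ^ 2) + (∑ i, ∫ p, dirDeriv (spaceDir i) θ p ^ 2)
        + ∑ i, ∫ p, dirDeriv (spaceDir i) (dirDeriv (spaceDir i) θ) p ^ 2), fun x => ?_,
        fun i x => ?_, fun i x => ?_⟩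
      · refine (abs_convolution_le hQ2 hθs.continuous hθc _).trans ?_
        linarith
      · rw [partialDeriv_slice hΦs, hd1]
        refine (abs_convolution_le hQ2 (hθs.dirDeriv _).continuous (hθc.dirDeriv _) _).trans ?_
        have := Finset.single_le_sum (fun i _ => n1 i) (Finset.mem_univ i)
        linarith
      · rw [partialDeriv_slice hΦs, partialDeriv_slice (hΦs.dirDeriv _), hd2]
        refine (abs_convolution_le hQ2 ((hθs.dirDeriv _).dirDeriv _).continuous
          ((hθc.dirDeriv _).dirDeriv _) _).trans ?_
        have := Finset.single_le_sum (fun i _ => n2 i) (Finset.mem_univ i)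
        linarith
    have key := kernelAvg_besselKernel_sub ((contDiff_slice hΦs 0).of_le two_le_infty) h0 h1 h2 0
    simp only [sumPartialSq_slice hΦs] at key
    have hz : ∀ y : Space d, Φ (0, y) - lap Φ (0, y) = 0 := hzero
    simp only [hz] at key
    have hk0 : kernelAvg besselKernel (fun _ : Space d => (0 : ℝ)) 0 = 0 := by simp [kernelAvg]
    rw [hk0] at key
    have : Φ (0, 0) = ∫ p, Q p * χ p := by
      rw [hΦ, convolution_def]
      congr 1; ext p
      rw [ContinuousLinearMap.mul_apply', hθ]
      beta_reduce
      rw [zero_sub, neg_sub, show ((0 : ℝ), (0 : Space d)) = 0 from rfl, sub_zero]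
    rw [this] at key
    rw [key]
    congr 1; ext p
    rw [smul_eq_mul, mul_comm]
  unfold slabMeasure
  rw [ae_restrict_iff' hUm]
  filter_upwards [main] with p hp hpU
  have := hp hpU
  rwa [hQ, indicator_of_mem hpU] at this

theorem oneSubLap_congr {φ ψ : ℝ × Space d → ℝ} {p : ℝ × Space d} (h : φ =ᶠ[𝓝 p] ψ) :
    oneSubLap φ p = oneSubLap ψ p := by
  have hd : ∀ (v : ℝ × Space d) {φ ψ : ℝ × Space d → ℝ}, φ =ᶠ[𝓝 p] ψ →
      dirDeriv v φ =ᶠ[𝓝 p] dirDeriv v ψ := fun v φ ψ h =>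
    (Filter.EventuallyEq.fderiv (𝕜 := ℝ) h).mono fun x hx => by unfold dirDeriv; rw [hx]
  unfold oneSubLap lap
  rw [h.eq_of_nhds, Finset.sum_congr rfl fun i _ => (hd _ (hd _ h)).eq_of_nhds]

theorem oneSubLap_neg (φ : ℝ × Space d → ℝ) (p : ℝ × Space d) :
    oneSubLap (fun p => -φ p) p = -oneSubLap φ p := by
  unfold oneSubLap lap
  simp only [dirDeriv_neg, Finset.sum_neg_distrib]
  ring

/-- The window integral of `χ` over `[t, t + T]`. For `t > 0` the upper end lies beyond the support
of `χ`, so the time derivative is `-χ`. The finite window, unlike the primitive from `t` to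
infinity, also vanishes for very negative `t`, which gives compact support. -/
theorem exists_testFunction_dirDeriv_eq_neg {χ : ℝ × Space d → ℝ} (hT : 0 < T)
    (hχ : ContDiff ℝ ∞ χ) (hc : HasCompactSupport χ) (hs : tsupport χ ⊆ Ioo 0 T ×ˢ univ) :
    ∃ Φ : ℝ × Space d → ℝ, IsTestFunction T Φ ∧
      ∀ p : ℝ × Space d, 0 < p.1 → dirDeriv (timeDir d) Φ =ᶠ[𝓝 p] fun p => -χ p := by
  have hcol : ∀ x, Continuous fun τ => χ (τ, x) := fun x => by
    have := hχ.continuous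
    fun_prop
  set Φ : ℝ × Space d → ℝ := fun p => ∫ τ in p.1..(p.1 + T), χ (τ, p.2) with hΦ
  set K : Set (ℝ × Space d) := (fun a : (ℝ × Space d) × ℝ => (a.1.1 - a.2, a.1.2)) ''
    (tsupport χ ×ˢ Icc 0 T) with hK
  have hKc : IsCompact K := (hc.isCompact.prod isCompact_Icc).image (by fun_prop)
  have hΦK : ∀ p, p ∉ K → Φ p = 0 := by
    intro p hp
    simp only [hΦ]
    rw [intervalIntegral.integral_of_le (by linarith)]
    refine setIntegral_eq_zero_of_forall_eq_zero fun τ hτ => ?_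
    refine image_eq_zero_of_notMem_tsupport fun h => hp ⟨((τ, p.2), τ - p.1), ⟨h, ?_⟩, ?_⟩
    · exact ⟨by linarith [hτ.1], by linarith [hτ.2]⟩
    · ext <;> simp
  have hsm : ContDiff ℝ ∞ Φ := by
    set g : Space d → ℝ → ℝ := fun x τ => χ (τ, x) with hg
    -- The window integral is the convolution in time of `χ(·, x)` with the indicator of `[-T, 0)`,
    -- depending smoothly on `x`.
    have h1 := contDiffOn_convolution_right_with_param (𝕜 := ℝ) (n := ⊤) (μ := (volume : Measure ℝ))
      (ContinuousLinearMap.mul ℝ ℝ) (g := g) (s := univ)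
      (k := Prod.fst '' tsupport χ) (f := indicator (Ico (-T) 0) fun _ => (1 : ℝ)) isOpen_univ
      (hc.isCompact.image continuous_fst)
      (fun x τ _ hτ => image_eq_zero_of_notMem_tsupport (f := χ) (x := (τ, x)) fun h =>
        hτ ⟨(τ, x), h, rfl⟩)
      ((integrable_indicator_iff measurableSet_Ico).2
        (integrableOn_const (by simp))).locallyIntegrable
      (by
        rw [univ_prod_univ]
        exact (hχ.comp (contDiff_snd.prodMk contDiff_fst)).contDiffOn)
    rw [univ_prod_univ, contDiffOn_univ] at h1
    have h2 : ContDiff ℝ ∞ fun p : ℝ × Space d => (p.2, p.1) := contDiff_snd.prodMk contDiff_fst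
    convert h1.comp h2 using 1
    ext p
    simp only [hΦ, Function.comp_apply, convolution_def, ContinuousLinearMap.mul_apply', hg]
    have e : ∀ t, indicator (Ico (-T) 0) (fun _ => (1 : ℝ)) t * χ (p.1 - t, p.2)
        = indicator (Ico (-T) 0) (fun t => χ (p.1 - t, p.2)) t := fun t => by
      by_cases ht : t ∈ Ico (-T) 0 <;> simp [ht]
    simp only [e]
    rw [integral_indicator measurableSet_Ico, integral_Ico_eq_integral_Ioc,
      ← intervalIntegral.integral_of_le (by linarith),
      intervalIntegral.integral_comp_sub_left (fun τ => χ (τ, p.2))]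
    simp
  refine ⟨Φ, ⟨hsm, HasCompactSupport.intro hKc hΦK, ?_⟩, fun p hp => ?_⟩
  · have : tsupport Φ ⊆ K := closure_minimal (fun p hp => by
      by_contra h
      exact hp (hΦK p h)) hKc.isClosed
    refine this.trans ?_
    rintro _ ⟨⟨a, σ⟩, ⟨ha, hσ⟩, rfl⟩
    have := (hs ha).1
    exact ⟨by simp only [mem_Iio]; linarith [this.2, hσ.1], trivial⟩
  · have hopen : ∀ᶠ p' in 𝓝 p, p'.1 ∈ Ioi (0 : ℝ) :=
      continuous_fst.continuousAt.eventually (isOpen_Ioi.mem_nhds hp)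
    refine hopen.mono fun p' hp' => ?_
    have h1 := hasDerivAt_time hsm p'
    have hi : ∀ a b, IntervalIntegrable (fun τ => χ (τ, p'.2)) volume a b := fun a b =>
      (hcol p'.2).intervalIntegrable a b
    have h2 : HasDerivAt (fun s => Φ (s, p'.2)) (χ (p'.1 + T, p'.2) - χ p') p'.1 := by
      have e : (fun s => Φ (s, p'.2)) = fun s =>
          (∫ τ in (0 : ℝ)..(s + T), χ (τ, p'.2)) - ∫ τ in (0 : ℝ)..s, χ (τ, p'.2) := by
        ext s
        rw [intervalIntegral.integral_interval_sub_left (hi _ _) (hi _ _)]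
      rw [e]
      have h3 : ∀ b, HasDerivAt (fun s => ∫ τ in (0 : ℝ)..s, χ (τ, p'.2)) (χ (b, p'.2)) b :=
        fun b => intervalIntegral.integral_hasDerivAt_right (hi _ _)
          ((hcol p'.2).stronglyMeasurableAtFilter _ _) (hcol p'.2).continuousAt
      have h4 : HasDerivAt (fun s => ∫ τ in (0 : ℝ)..(s + T), χ (τ, p'.2))
          (χ (p'.1 + T, p'.2)) p'.1 := (h3 (p'.1 + T)).comp_add_const p'.1 T
      exact h4.sub (h3 p'.1)
    rw [h1.unique h2, image_eq_zero_of_notMem_tsupport (f := χ) (x := (p'.1 + T, p'.2)), zero_sub]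
    intro h
    have h5 := (hs h).1.2
    have h6 : 0 < p'.1 := hp'
    simp only at h5
    linarith

/-- Given `χ`, a test function with time derivative `-χ` turns the weak equation into `∫ (w -
timeInt (mildOp w g)) (1 - Δ) χ = 0`, and injectivity of `1 - Δ` concludes. There is no initial term
because this serves the difference of two solutions with the same datum. -/
theorem ae_eq_timeInt_of_weak (hT : 0 < T) {w : ℝ × Space d → ℝ} {g : Fin d → ℝ × Space d → ℝ}
    (hw : Measurable w) (hg : ∀ i, Measurable (g i)) (hw2 : MemLp w 2 (slabMeasure d T))
    (hg2 : ∀ i, MemLp (g i) 2 (slabMeasure d T))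
    (h : ∀ φ : ℝ × Space d → ℝ, IsTestFunction T φ →
      ∫ p, (w p * dirDeriv (timeDir d) (oneSubLap φ) p
        + (∑ i, g i p * dirDeriv (spaceDir i) φ p + w p * lap φ p)) ∂(slabMeasure d T) = 0) :
    ∀ᵐ p ∂(slabMeasure d T), w p = timeInt (mildOp w g) p := by
  have hn := measurable_mildOp hw hg
  have hn2 := memLp_mildOp hw hg hw2 hg2
  have hJ := measurable_timeInt hn
  have hJ2 := memLp_timeInt hn hn2
  have hmem : ∀ᵐ p ∂(slabMeasure d T), p.1 ∈ Ioo 0 T := by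
    have : ∀ᵐ p ∂(slabMeasure d T), p ∈ Ioo 0 T ×ˢ (univ : Set (Space d)) :=
      ae_restrict_mem (measurableSet_Ioo.prod MeasurableSet.univ)
    exact this.mono fun p hp => hp.1
  refine (ae_eq_zero_of_integral_mul_oneSubLap (q := fun p => w p - timeInt (mildOp w g) p)
    (hw2.sub hJ2) fun χ hχ hc hs => ?_).mono fun p hp => sub_eq_zero.1 hp
  obtain ⟨Φ, hΦ, hΦχ⟩ := exists_testFunction_dirDeriv_eq_neg hT hχ hc hs
  have hsΦ := hΦ.smooth
  have hcΦ := hΦ.compactSupport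
  set ζ := oneSubLap χ with hζ
  have hζc : Continuous ζ := (contDiff_oneSubLap hχ).continuous
  have hζ2 := memLp_of_hasCompactSupport (T := T) hζc hc.oneSubLap
  have hψ := contDiff_oneSubLap hsΦ
  have hψt : ∀ p : ℝ × Space d, 0 < p.1 → dirDeriv (timeDir d) (oneSubLap Φ) p = -ζ p := by
    intro p hp
    rw [dirDeriv_oneSubLap hsΦ, oneSubLap_congr (hΦχ p hp), oneSubLap_neg]
  have hψT : ∀ x, oneSubLap Φ (T, x) = 0 := fun x => oneSubLap_eq_zero_of_notMem fun h =>
    lt_irrefl T (hΦ.support_subset h).1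
  have htail : ∀ p : ℝ × Space d, p.1 ∈ Ioo 0 T →
      ∫ τ in Ico p.1 T, ζ (τ, p.2) = oneSubLap Φ p := by
    intro p hp
    have e := integral_Ico_dirDeriv_time hψ hp.2.le p.2 (hψT p.2)
    rw [setIntegral_congr_fun measurableSet_Ico (fun τ hτ => hψt (τ, p.2) (hp.1.trans_le hτ.1)),
      integral_neg, neg_inj] at e
    exact e
  have hψt2 := memLp_of_hasCompactSupport (T := T) (hψ.dirDeriv (timeDir d)).continuous
    (hcΦ.oneSubLap.dirDeriv (timeDir d))
  have i1 : Integrable (fun p => w p * dirDeriv (timeDir d) (oneSubLap Φ) p) (slabMeasure d T) :=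
    hw2.integrable_mul hψt2
  have i2 : Integrable (fun p => ∑ i, g i p * dirDeriv (spaceDir i) Φ p + w p * lap Φ p)
      (slabMeasure d T) := by
    refine (integrable_finsetSum _ fun i _ => ?_).add ?_
    · exact (hg2 i).integrable_mul
        (memLp_of_hasCompactSupport (hsΦ.dirDeriv _).continuous (hcΦ.dirDeriv _))
    · exact hw2.integrable_mul (memLp_of_hasCompactSupport (contDiff_lap hsΦ).continuous hcΦ.lap)
  have i3 : Integrable (fun p => w p * ζ p) (slabMeasure d T) := hw2.integrable_mul hζ2
  have i4 : Integrable (fun p => timeInt (mildOp w g) p * ζ p) (slabMeasure d T) :=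
    hJ2.integrable_mul hζ2
  have e0 := h Φ hΦ
  rw [integral_add i1 i2, ← integral_mildOp_mul hw hg hw2 hg2 hsΦ hcΦ] at e0
  have e1 : ∫ p, w p * dirDeriv (timeDir d) (oneSubLap Φ) p ∂(slabMeasure d T)
      = -∫ p, w p * ζ p ∂(slabMeasure d T) := by
    rw [← integral_neg]
    refine integral_congr_ae (hmem.mono fun p hp => ?_)
    beta_reduce
    rw [hψt p hp.1, mul_neg]
  have e2 : ∫ p, timeInt (mildOp w g) p * ζ p ∂(slabMeasure d T)
      = ∫ p, mildOp w g p * oneSubLap Φ p ∂(slabMeasure d T) := by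
    rw [integral_timeInt_mul hn hn2 hζc.measurable hζ2]
    refine integral_congr_ae (hmem.mono fun p hp => ?_)
    beta_reduce
    rw [htail p hp]
  simp only [sub_mul]
  rw [integral_sub i3 i4, e2]
  linarith

/-- The mild equation bounds the energy of `w` at time `t` by a constant times its integral over
`(0, t]`, the flux being controlled by `|g i| ≤ L |w|`. -/
theorem ae_eq_zero_of_weak (hT : 0 < T) {w : ℝ × Space d → ℝ} {g : Fin d → ℝ × Space d → ℝ}
    (hw : Measurable w) (hg : ∀ i, Measurable (g i)) (hw2 : MemLp w 2 (slabMeasure d T))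
    (hg2 : ∀ i, MemLp (g i) 2 (slabMeasure d T)) {L : ENNReal} (hL : L ≠ ⊤)
    (hgw : ∀ i p, ‖g i p‖ₑ ≤ L * ‖w p‖ₑ)
    (h : ∀ φ : ℝ × Space d → ℝ, IsTestFunction T φ →
      ∫ p, (w p * dirDeriv (timeDir d) (oneSubLap φ) p
        + (∑ i, g i p * dirDeriv (spaceDir i) φ p + w p * lap φ p)) ∂(slabMeasure d T) = 0) :
    ∀ᵐ p ∂(slabMeasure d T), w p = 0 := by
  have hmild := ae_eq_timeInt_of_weak hT hw hg hw2 hg2 h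
  obtain ⟨M, hM, hMb⟩ := exists_energy_mildOp_le d L hL
  have hn := measurable_mildOp hw hg
  have hfin := (memLp_slab_iff hw).1 hw2
  have hE : ∀ᵐ t ∂(volume.restrict (Ioo 0 T)), energy w t
      ≤ (ENNReal.ofReal T * M) * ∫⁻ τ in Ioc 0 t, energy w τ := by
    rw [slabMeasure_eq_prod] at hmild
    filter_upwards [Measure.ae_ae_of_ae_prod hmild, ae_restrict_mem measurableSet_Ioo] with t ht htm
    have e : energy w t = energy (timeInt (mildOp w g)) t :=
      lintegral_congr_ae (ht.mono fun x hx => by beta_reduce; rw [hx])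
    rw [e]
    refine (energy_timeInt_le hn htm.2.le).trans ?_
    rw [mul_assoc, ← lintegral_const_mul _ (measurable_energy hw)]
    gcongr with τ
    exact hMb w g hw hg hgw τ
  have h0 := lintegral_eq_zero_of_le_primitive (measurable_energy hw) hfin.ne
    (ENNReal.mul_ne_top ENNReal.ofReal_ne_top hM) hE
  rw [← lintegral_enorm_sq_slab hw, lintegral_eq_zero_iff (hw.enorm.pow_const 2)] at h0
  exact h0.mono fun p hp => by simpa using hp

end

/-! ### Integrability, the classical equation and uniqueness. -/

section

open Filter Topology

variable {d : ℕ} {T : ℝ}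

theorem decayWeight_le_one (m : ℕ) (x : Space d) : decayWeight m x ≤ 1 := by
  unfold decayWeight
  exact inv_le_one_of_one_le₀ (one_le_pow₀ (by linarith [norm_nonneg x]))

theorem continuous_decayWeight (m : ℕ) : Continuous (decayWeight m : Space d → ℝ) := by
  unfold decayWeight
  refine Continuous.inv₀ (by fun_prop) fun x => ?_
  have := norm_nonneg x
  positivity

/-- The exponent `d + 1` makes the weight integrable, and being at most `1` it dominates its square.
-/
theorem memLp_decayWeight : MemLp (decayWeight (d + 1) : Space d → ℝ) 2 volume := by
  have hc := (continuous_decayWeight (d := d) (d + 1)).aestronglyMeasurable (μ := volume)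
  have h1 : Integrable (decayWeight (d + 1) : Space d → ℝ) volume := by
    have := integrable_one_add_norm (E := Space d) (μ := volume) (r := ((d + 1 : ℕ) : ℝ)) (by simp)
    refine this.congr (ae_of_all _ fun x => ?_)
    have hx : 0 ≤ 1 + ‖x‖ := by positivity
    beta_reduce
    rw [Real.rpow_neg hx, Real.rpow_natCast]
    rfl
  refine (memLp_two_iff_integrable_sq hc).2 (h1.mono' (hc.pow 2) (ae_of_all _ fun x => ?_))
  have h0 := (decayWeight_pos (d + 1) x).le
  rw [Real.norm_of_nonneg (by positivity), pow_two]
  exact mul_le_of_le_one_right h0 (decayWeight_le_one _ x)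

theorem memLp_slab_of_abs_le {W : ℝ × Space d → ℝ} (hW : Measurable W) {b : ℝ}
    (h : ∀ t ∈ Ioo 0 T, ∀ x, |W (t, x)| ≤ b * decayWeight (d + 1) x) :
    MemLp W 2 (slabMeasure d T) := by
  have h1 : MemLp (fun p : ℝ × Space d => b * decayWeight (d + 1) p.2) 2 (slabMeasure d T) := by
    rw [slabMeasure_eq_prod]
    exact (memLp_decayWeight.comp_snd (volume.restrict (Ioo 0 T))).const_mul b
  refine h1.of_le hW.aestronglyMeasurable ?_
  have : ∀ᵐ p ∂(slabMeasure d T), p ∈ Ioo 0 T ×ˢ (univ : Set (Space d)) :=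
    ae_restrict_mem (measurableSet_Ioo.prod MeasurableSet.univ)
  exact this.mono fun p hp => (h p.1 hp.1 p.2).trans (le_abs_self _)

theorem exists_norm_le_mul_decayWeight {f : Space d × ℝ → Space d} (hf : Continuous f)
    (hfc : HasCompactSupport f) (m : ℕ) : ∃ a, ∀ x v, ‖f (x, v)‖ ≤ a * decayWeight m x := by
  obtain ⟨a, ha⟩ := (hfc.smul_left (f := fun y => (1 + ‖y.1‖) ^ m)).exists_bound_of_continuous
    (by fun_prop)
  refine ⟨a, fun x v => ?_⟩
  have h := ha (x, v)
  simp only [Pi.smul_apply'] at h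
  rw [norm_smul, Real.norm_of_nonneg (by positivity)] at h
  unfold decayWeight
  rw [← div_eq_mul_inv, le_div_iff₀ (by positivity)]
  linarith

/-- Compact support of `f` in `x` gives decay uniformly in the value of `v`, so no integrability of
`v` is needed. -/
theorem memLp_flux {f : Space d × ℝ → Space d} (hf : Continuous f) (hfc : HasCompactSupport f)
    {v : ℝ × Space d → ℝ} (hv : Measurable v) (i : Fin d) :
    MemLp (fun p => f (p.2, v p) i) 2 (slabMeasure d T) := by
  obtain ⟨a, ha⟩ := exists_norm_le_mul_decayWeight hf hfc (d + 1)
  refine memLp_slab_of_abs_le (b := a) ?_ fun t _ x => ?_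
  · have h1 : Measurable fun q => f q i := by
      have : Continuous fun q => f q i := by fun_prop
      exact this.measurable
    exact h1.comp (measurable_snd.prodMk hv)
  · exact (PiLp.norm_apply_le _ i).trans (ha x _)

theorem integral_mul_dirDeriv {a φ : ℝ × Space d → ℝ} (ha : ContDiff ℝ ∞ a) (hφ : ContDiff ℝ ∞ φ)
    (hc : HasCompactSupport φ) (v : ℝ × Space d) :
    ∫ p, a p * dirDeriv v φ p = -∫ p, dirDeriv v a p * φ p := by
  refine integral_mul_fderiv_eq_neg_fderiv_mul_of_integrable (μ := volume) ?_ ?_ ?_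
    (fun x _ => ha.differentiable (by simp) x) (fun x _ => hφ.differentiable (by simp) x)
  · exact ((ha.dirDeriv v).continuous.mul hφ.continuous).integrable_of_hasCompactSupport hc.mul_left
  · exact (ha.continuous.mul (hφ.dirDeriv v).continuous).integrable_of_hasCompactSupport
      (hc.dirDeriv v).mul_left
  · exact (ha.continuous.mul hφ.continuous).integrable_of_hasCompactSupport hc.mul_left

theorem integrable_mul_of_hasCompactSupport {a φ : ℝ × Space d → ℝ} (ha : ContDiff ℝ ∞ a)
    (hφ : ContDiff ℝ ∞ φ) (hc : HasCompactSupport φ) :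
    Integrable (fun p => a p * φ p) volume :=
  (ha.continuous.mul hφ.continuous).integrable_of_hasCompactSupport hc.mul_left

theorem integral_mul_lap {a φ : ℝ × Space d → ℝ} (ha : ContDiff ℝ ∞ a) (hφ : ContDiff ℝ ∞ φ)
    (hc : HasCompactSupport φ) : ∫ p, a p * lap φ p = ∫ p, lap a p * φ p := by
  unfold lap
  simp only [Finset.mul_sum, Finset.sum_mul]
  rw [integral_finsetSum _ fun i _ => integrable_mul_of_hasCompactSupport ha
      ((hφ.dirDeriv _).dirDeriv _) ((hc.dirDeriv _).dirDeriv _),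
    integral_finsetSum _ fun i _ => integrable_mul_of_hasCompactSupport
      ((ha.dirDeriv _).dirDeriv _) hφ hc]
  refine Finset.sum_congr rfl fun i _ => ?_
  rw [integral_mul_dirDeriv ha (hφ.dirDeriv _) (hc.dirDeriv _),
    integral_mul_dirDeriv (ha.dirDeriv _) hφ hc, neg_neg]

theorem lap_eq_zero_of_notMem {φ : ℝ × Space d → ℝ} {p : ℝ × Space d} (hp : p ∉ tsupport φ) :
    lap φ p = 0 := by
  have h1 := oneSubLap_eq_zero_of_notMem hp
  have h2 := image_eq_zero_of_notMem_tsupport hp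
  unfold oneSubLap at h1
  linarith

/-- Integrating by parts, the smooth residual is orthogonal to all test functions in the open slab,
hence zero there; continuity extends this to the closure, which contains `t = 0`. -/
theorem residual_eq_zero_of_weak {u : ℝ × Space d → ℝ} {g : Fin d → ℝ × Space d → ℝ}
    (hu : ContDiff ℝ ∞ u) (hg : ∀ i, ContDiff ℝ ∞ (g i))
    (h : ∀ φ : ℝ × Space d → ℝ, ContDiff ℝ ∞ φ → HasCompactSupport φ →
      tsupport φ ⊆ Ioo 0 T ×ˢ univ →
      ∫ p, (u p * dirDeriv (timeDir d) (oneSubLap φ) p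
        + (∑ i, g i p * dirDeriv (spaceDir i) φ p + u p * lap φ p)) ∂(slabMeasure d T) = 0)
    {t : ℝ} (ht : t ∈ Ico 0 T) (x : Space d) :
    dirDeriv (timeDir d) u (t, x) + ∑ i, dirDeriv (spaceDir i) (g i) (t, x)
      = lap u (t, x) + dirDeriv (timeDir d) (lap u) (t, x) := by
  set U : Set (ℝ × Space d) := Ioo 0 T ×ˢ univ with hU
  have hUo : IsOpen U := isOpen_Ioo.prod isOpen_univ
  set R : ℝ × Space d → ℝ := fun p => (dirDeriv (timeDir d) u p - lap (dirDeriv (timeDir d) u) p)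
    + (∑ i, dirDeriv (spaceDir i) (g i) p - lap u p) with hR
  have hut := hu.dirDeriv (timeDir d)
  have hdg : ContDiff ℝ ∞ fun p => ∑ i, dirDeriv (spaceDir i) (g i) p :=
    ContDiff.sum fun i _ => (hg i).dirDeriv _
  have hRs : ContDiff ℝ ∞ R := (hut.sub (contDiff_lap hut)).add (hdg.sub (contDiff_lap hu))
  have main : ∀ᵐ p ∂(volume : Measure (ℝ × Space d)), p ∈ U → R p = 0 := by
    refine hUo.ae_eq_zero_of_integral_contDiff_smul_eq_zero
      (hRs.continuous.locallyIntegrable.locallyIntegrableOn U) fun φ hφ hc hs => ?_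
    have h1 := h φ hφ hc hs
    have hψ := contDiff_oneSubLap hφ
    unfold slabMeasure at h1
    -- The integrand vanishes off the support of `φ`, so the slab may be replaced by the whole space
    -- and integration by parts has no boundary terms.
    rw [setIntegral_eq_integral_of_forall_compl_eq_zero] at h1
    swap
    · intro p hp
      have hp' : p ∉ tsupport φ := fun hm => hp (hs hm)
      have hz : ∀ v, dirDeriv v φ p = 0 := fun v => by
        unfold dirDeriv
        rw [image_eq_zero_of_notMem_tsupport fun hm => hp' (tsupport_fderiv_subset ℝ hm)]
        rfl
      have hp'' : p ∉ tsupport (dirDeriv (timeDir d) φ) := fun hm => hp' (by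
        refine closure_minimal (fun q hq => ?_) (isClosed_tsupport φ) hm
        refine tsupport_fderiv_subset ℝ (subset_tsupport _ fun h0 => hq ?_)
        unfold dirDeriv
        rw [h0]
        rfl)
      rw [dirDeriv_oneSubLap hφ, oneSubLap_eq_zero_of_notMem hp'', lap_eq_zero_of_notMem hp']
      simp [hz]
    have i0 := integrable_mul_of_hasCompactSupport hu (hψ.dirDeriv (timeDir d))
      (hc.oneSubLap.dirDeriv (timeDir d))
    have i1 := fun i => integrable_mul_of_hasCompactSupport (hg i) (hφ.dirDeriv (spaceDir i))
      (hc.dirDeriv (spaceDir i))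
    have i2 := integrable_mul_of_hasCompactSupport hu (contDiff_lap hφ) hc.lap
    have i3 := integrable_mul_of_hasCompactSupport hut hφ hc
    have i4 := integrable_mul_of_hasCompactSupport (contDiff_lap hut) hφ hc
    have i5 := fun i => integrable_mul_of_hasCompactSupport ((hg i).dirDeriv (spaceDir i)) hφ hc
    have i6 := integrable_mul_of_hasCompactSupport (contDiff_lap hu) hφ hc
    have i7 := integrable_mul_of_hasCompactSupport hut (contDiff_lap hφ) hc.lap
    have s1 : Integrable (fun p => ∑ i, g i p * dirDeriv (spaceDir i) φ p) volume :=
      integrable_finsetSum _ fun i _ => i1 i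
    have s5 : Integrable (fun p => ∑ i, dirDeriv (spaceDir i) (g i) p * φ p) volume :=
      integrable_finsetSum _ fun i _ => i5 i
    have s2 : Integrable (fun p => ∑ i, g i p * dirDeriv (spaceDir i) φ p + u p * lap φ p) volume :=
      s1.add i2
    rw [integral_add i0 s2, integral_add s1 i2,
      integral_finsetSum _ fun i _ => i1 i, integral_mul_dirDeriv hu hψ hc.oneSubLap,
      integral_mul_lap hu hφ hc] at h1
    simp only [integral_mul_dirDeriv (hg _) hφ hc] at h1
    have e1 : ∫ p, dirDeriv (timeDir d) u p * oneSubLap φ p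
        = (∫ p, dirDeriv (timeDir d) u p * φ p) - ∫ p, lap (dirDeriv (timeDir d) u) p * φ p := by
      rw [← integral_mul_lap hut hφ hc, ← integral_sub i3 i7]
      simp only [oneSubLap, mul_sub]
    have e2 : ∫ p, φ p • R p = ((∫ p, dirDeriv (timeDir d) u p * φ p)
        - ∫ p, lap (dirDeriv (timeDir d) u) p * φ p)
        + ((∑ i, ∫ p, dirDeriv (spaceDir i) (g i) p * φ p) - ∫ p, lap u p * φ p) := by
      rw [← integral_sub i3 i4, ← integral_finsetSum _ fun i _ => i5 i,
        ← integral_sub s5 i6]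
      refine Eq.trans ?_ (integral_add (i3.sub i4) (s5.sub i6))
      congr 1; ext p
      simp only [smul_eq_mul, hR, ← Finset.sum_mul]
      ring
    rw [e2]
    rw [e1, Finset.sum_neg_distrib] at h1
    linarith
  have hRU : EqOn R 0 U := by
    refine Measure.eqOn_open_of_ae_eq (μ := volume) ?_ hUo hRs.continuous.continuousOn
      continuousOn_const
    exact (ae_restrict_iff' hUo.measurableSet).2 main
  have hcl : closure U ⊆ {p | R p = 0} :=
    closure_minimal hRU (isClosed_eq hRs.continuous continuous_const)
  have hT : (0 : ℝ) ≠ T := (ht.1.trans_lt ht.2).ne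
  have hmem : (t, x) ∈ closure U := by
    rw [hU, closure_prod_eq, closure_Ioo hT, closure_univ]
    exact ⟨⟨ht.1, ht.2.le⟩, trivial⟩
  have := hcl hmem
  simp only [mem_ofPred_eq, hR] at this
  rw [dirDeriv_lap hu]
  linarith

theorem timeDerivWithin_Ico {φ : ℝ × Space d → ℝ} (hφ : ContDiff ℝ ∞ φ) {t : ℝ} (ht : t ∈ Ico 0 T)
    (x : Space d) : timeDerivWithin (Ico 0 T) φ (t, x) = dirDeriv (timeDir d) φ (t, x) :=
  (hasDerivAt_time hφ (t, x)).hasDerivWithinAt.derivWithin (uniqueDiffOn_Ico 0 T t ht)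

theorem contDiff_flux {f : Space d × ℝ → Space d} (hf : ContDiff ℝ ∞ f) {u : ℝ × Space d → ℝ}
    (hu : ContDiff ℝ ∞ u) (i : Fin d) : ContDiff ℝ ∞ fun p => f (p.2, u p) i :=
  contDiff_euclidean.1 (hf.comp (contDiff_snd.prodMk hu)) i

theorem divergence_flux {f : Space d × ℝ → Space d} (hf : ContDiff ℝ ∞ f) {u : ℝ × Space d → ℝ}
    (hu : ContDiff ℝ ∞ u) (t : ℝ) (x : Space d) :
    divergence (fun y => f (y, u (t, y))) x
      = ∑ i, dirDeriv (spaceDir i) (fun p => f (p.2, u p) i) (t, x) := by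
  have hF : ContDiff ℝ ∞ fun y => f (y, u (t, y)) :=
    hf.comp (contDiff_id.prodMk (contDiff_slice hu t))
  refine Finset.sum_congr rfl fun i _ => ?_
  have h1 := congrFun (partialDeriv_slice (contDiff_flux hf hu i) i t) x
  rw [← h1]
  unfold partialDeriv
  have h2 : HasFDerivAt (fun y => f (y, u (t, y)) i) _ x :=
    (EuclideanSpace.proj (𝕜 := ℝ) i).hasFDerivAt.comp x (hF.differentiable (by simp) x).hasFDerivAt
  rw [h2.fderiv]
  rfl

section

variable (f : Space d × ℝ → Space d) (hf : ContDiff ℝ ∞ f) (hfc : HasCompactSupport f)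
  (u₀ : Space d → ℝ) (hu₀ : ContDiff ℝ ∞ u₀) (hu₀c : HasCompactSupport u₀)

theorem isWeakSolution_smoothSol (hT : 0 < T) :
    IsWeakSolution T f u₀ (smoothSol f hf hfc u₀ hu₀ hu₀c) := by
  set u := smoothSol f hf hfc u₀ hu₀ hu₀c with hu
  have hum : Measurable u := (contDiff_smoothSol f hf hfc u₀ hu₀ hu₀c).continuous.measurable
  obtain ⟨b, _, hb⟩ := smoothSol_decay f hf hfc u₀ hu₀ hu₀c hT (d + 1)
  have hu2 : MemLp u 2 (slabMeasure d T) :=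
    memLp_slab_of_abs_le hum fun t ht => hb t (Ioo_subset_Icc_self ht)
  refine ⟨hu2, fun φ hφ => ?_⟩
  refine weak_eq_of_mild hT hu₀.continuous hum hu2 (g := fun i p => f (p.2, u p) i)
    (fun i => (contDiff_flux hf (contDiff_smoothSol f hf hfc u₀ hu₀ hu₀c) i).continuous.measurable)
    (memLp_flux hf.continuous hfc hum) (fun _ _ => rfl) ?_ hφ
  have : ∀ᵐ p ∂(slabMeasure d T), p ∈ Ioo 0 T ×ˢ (univ : Set (Space d)) :=
    ae_restrict_mem (measurableSet_Ioo.prod MeasurableSet.univ)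
  refine this.mono fun p hp => ?_
  have h1 := smoothSol_eq_integral f hf hfc u₀ hu₀ hu₀c p.1 p.2
  rw [intervalIntegral.integral_of_le hp.1.1.le] at h1
  exact h1

/-- The solution is smooth on all of `ℝ × ℝ^d`, negative times included, so smoothness up to `t = 0`
and `t = T` is mere restriction. The equation follows from the weak form with test functions
supported in the open slab, for which the initial term drops out. -/
theorem isSmoothClassicalSolution_smoothSol (hT : 0 < T) :
    IsSmoothClassicalSolution T f u₀ (smoothSol f hf hfc u₀ hu₀ hu₀c) := by
  have hweak := isWeakSolution_smoothSol f hf hfc u₀ hu₀ hu₀c hT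
  have hs := contDiff_smoothSol f hf hfc u₀ hu₀ hu₀c
  have hstart : ∀ x, smoothSol f hf hfc u₀ hu₀ hu₀c (0, x) = u₀ x := fun x => by
    rw [smoothSol_eq_integral, intervalIntegral.integral_same, add_zero]
  set u := smoothSol f hf hfc u₀ hu₀ hu₀c with hu
  refine ⟨hs.contDiffOn, fun t ht x => ?_, hstart⟩
  rw [spaceLaplacian_eq_lap hs, timeDerivWithin_Ico hs ht, timeDerivWithin_Ico (contDiff_lap hs) ht,
    divergence_flux hf hs]
  refine residual_eq_zero_of_weak hs (contDiff_flux hf hs) (fun φ hφ hc hsupp => ?_) ht x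
  have h1 := hweak.weak_eq φ ⟨hφ, hc, hsupp.trans (prod_mono Ioo_subset_Iio_self le_rfl)⟩
  have h2 : ∀ x : Space d, φ (0, x) - spaceLaplacian φ (0, x) = 0 := fun x => by
    rw [spaceLaplacian_eq_lap hφ]
    exact oneSubLap_eq_zero_of_notMem fun hm => lt_irrefl (0 : ℝ) (hsupp hm).1.1
  simpa only [h2, mul_zero, integral_zero, add_zero, weak_integrand_eq hφ] using h1

theorem IsWeakSolution.congr_ae {f : Space d × ℝ → Space d} {u₀ : Space d → ℝ}
    {u v : ℝ × Space d → ℝ} (hu : IsWeakSolution T f u₀ u) (h : u =ᵐ[slabMeasure d T] v) :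
    IsWeakSolution T f u₀ v := by
  refine ⟨hu.memLp.ae_eq h, fun φ hφ => ?_⟩
  refine Eq.trans ?_ (hu.weak_eq φ hφ)
  congr 1
  symm
  refine integral_congr_ae (h.mono fun p hp => ?_)
  beta_reduce
  rw [hp]

theorem integrable_weak_integrand {w : ℝ × Space d → ℝ} {g : Fin d → ℝ × Space d → ℝ}
    (hw2 : MemLp w 2 (slabMeasure d T)) (hg2 : ∀ i, MemLp (g i) 2 (slabMeasure d T))
    {φ : ℝ × Space d → ℝ} (hφ : ContDiff ℝ ∞ φ) (hc : HasCompactSupport φ) :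
    Integrable (fun p => w p * dirDeriv (timeDir d) (oneSubLap φ) p
        + (∑ i, g i p * dirDeriv (spaceDir i) φ p + w p * lap φ p)) (slabMeasure d T) := by
  refine Integrable.add ?_ (Integrable.add (integrable_finsetSum _ fun i _ => ?_) ?_)
  · exact hw2.integrable_mul (memLp_of_hasCompactSupport
      ((contDiff_oneSubLap hφ).dirDeriv _).continuous (hc.oneSubLap.dirDeriv _))
  · exact (hg2 i).integrable_mul
      (memLp_of_hasCompactSupport (hφ.dirDeriv _).continuous (hc.dirDeriv _))
  · exact hw2.integrable_mul (memLp_of_hasCompactSupport (contDiff_lap hφ).continuous hc.lap)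

/-- In the difference of the weak equations the datum cancels, and the flux difference is bounded by
the Lipschitz constant of `f` times `|v - u|`. -/
theorem IsWeakSolution.ae_eq_of_measurable {f : Space d × ℝ → Space d} (hf : ContDiff ℝ ∞ f)
    (hfc : HasCompactSupport f) {u₀ : Space d → ℝ} (hT : 0 < T) {u v : ℝ × Space d → ℝ}
    (hu : IsWeakSolution T f u₀ u) (hv : IsWeakSolution T f u₀ v) (hum : Measurable u)
    (hvm : Measurable v) : v =ᵐ[slabMeasure d T] u := by
  obtain ⟨C, hC, hL⟩ := exists_forall_norm_sub_le hf hfc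
  have hflux : ∀ {w : ℝ × Space d → ℝ}, Measurable w → ∀ i, Measurable fun p => f (p.2, w p) i :=
    fun {w} hw i => by
      have : Continuous fun q => f q i := by
        have := hf.continuous
        fun_prop
      exact this.measurable.comp (measurable_snd.prodMk hw)
  have hfu := fun i => memLp_flux (T := T) hf.continuous hfc hum i
  have hfv := fun i => memLp_flux (T := T) hf.continuous hfc hvm i
  refine (ae_eq_zero_of_weak hT (w := fun p => v p - u p)
    (g := fun i p => f (p.2, v p) i - f (p.2, u p) i) (hvm.sub hum)
    (fun i => (hflux hvm i).sub (hflux hum i)) (hv.memLp.sub hu.memLp)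
    (fun i => (hfv i).sub (hfu i)) (L := ENNReal.ofReal C) ENNReal.ofReal_ne_top
    (fun i p => ?_) fun φ hφ => ?_).mono fun p hp => sub_eq_zero.1 hp
  · rw [← ofReal_norm, ← ofReal_norm, ← ENNReal.ofReal_mul hC]
    refine ENNReal.ofReal_le_ofReal ?_
    have h1 := PiLp.norm_apply_le (f (p.2, v p) - f (p.2, u p)) i
    have h2 := hL (p.2, v p) (p.2, u p)
    have h3 : ‖((p.2, v p) : Space d × ℝ) - (p.2, u p)‖ = ‖v p - u p‖ := by
      simp [Prod.norm_def]
    rw [h3] at h2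
    exact h1.trans h2
  · have e1 := hv.weak_eq φ hφ
    have e2 := hu.weak_eq φ hφ
    simp only [weak_integrand_eq hφ.smooth] at e1 e2
    have j1 := integrable_weak_integrand hv.memLp hfv hφ.smooth hφ.compactSupport
    have j2 := integrable_weak_integrand hu.memLp hfu hφ.smooth hφ.compactSupport
    have e3 := integral_sub j1 j2
    have e4 : ∀ a b c : ℝ, a + c = 0 → b + c = 0 → a - b = 0 := fun a b c h h2 => by linarith
    rw [e4 _ _ _ e1 e2] at e3
    rw [← e3]
    congr 1; ext p
    simp only [sub_mul, Finset.sum_sub_distrib]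
    ring

end

end

theorem theorem1p1 (d : ℕ) (T : ℝ) (hT : 0 < T)
    (f : Space d × ℝ → Space d) (hf : ContDiff ℝ ∞ f) (hfc : HasCompactSupport f)
    (u₀ : Space d → ℝ) (hu₀ : ContDiff ℝ ∞ u₀) (hu₀c : HasCompactSupport u₀) :
    ∃ u : ℝ × Space d → ℝ,
      IsWeakSolution T f u₀ u ∧
      IsSmoothClassicalSolution T f u₀ u ∧
      ∀ v : ℝ × Space d → ℝ, IsWeakSolution T f u₀ v → v =ᵐ[slabMeasure d T] u := by
  have hweak := isWeakSolution_smoothSol f hf hfc u₀ hu₀ hu₀c hT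
  refine ⟨smoothSol f hf hfc u₀ hu₀ hu₀c, hweak,
    isSmoothClassicalSolution_smoothSol f hf hfc u₀ hu₀ hu₀c hT, fun v hv => ?_⟩
  -- A weak solution is only almost everywhere measurable, so it is replaced by a measurable
  -- representative, which is again a weak solution.
  have hvm := hv.memLp.1.aemeasurable
  refine hvm.ae_eq_mk.trans (IsWeakSolution.ae_eq_of_measurable hf hfc hT hweak
    (hv.congr_ae hvm.ae_eq_mk) ?_ hvm.measurable_mk)
  exact (contDiff_smoothSol f hf hfc u₀ hu₀ hu₀c).continuous.measurable
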